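/- **Conventions.** Let $k=\mathbb{R}$ or $\mathbb{C}$. For $g\in \mathsf{GL}_n(k)$ let $\sigma_1(g)\ge\cdots\ge\sigma_n(g)>0$ be its singular values. Let $\Gamma$ be a finitely generated group and let $|\gamma|_\Gamma$ be the word length of $\gamma\in\Gamma$ with respect to a finite generating set (the notions below do not depend on its choice). A representation $\rho:\Gamma\to\mathsf{GL}_n(k)$ is a *quasi-isometric embedding* if there are $c,\theta>0$ with $\frac{\sigma_1(\rho(\gamma))}{\sigma_n(\rho(\gamma))}\ge c\,e^{\theta|\gamma|_\Gamma}$ for all $\gamma\in\Gamma$. For $1\le j\le n-1$ it is *$j$-Anosov* (into $\mathsf{GL}_n(k)$) if there are $c,\varepsilon>0$ with $\frac{\sigma_j(\rho(\gamma))}{\sigma_{j+1}(\rho(\gamma))}\ge c\,e^{\varepsilon|\gamma|_\Gamma}$ for all $\gamma\in\Gamma$. The set $\mathrm{Hom}(\Gamma,\mathsf{GL}_n(k))$ of representations carries the topology of pointwise convergence, and $\mathrm{Hom}(\Gamma,\mathsf{GL}_n(\mathbb{R}))$ is regarded as a subset of $\mathrm{Hom}(\Gamma,\mathsf{GL}_n(\mathbb{C}))$.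 A representation $\rho$ in $\mathrm{Hom}(\Gamma,\mathsf{GL}_n(\mathbb{C}))$ is *locally rigid* if it has a neighbourhood in this space all of whose elements are conjugate to $\rho$ by elements of $\mathsf{GL}_n(\mathbb{C})$. A group is *virtually free* if it has a free subgroup of finite index. **Theorem 1.2.** Let $d\ge 2$ be an even integer. There exist a finite group $F$ and an integer $m\ge 1$, depending only on $d$, such that the group $\Gamma=(\mathbb{Z}\times F)*\mathsf{F}_m$, where $\mathsf{F}_m$ is the free group of rank $m$, is virtually free and has the following property. For every $n\ge d+1$ there are a representation $\psi_n:\Gamma\to\mathsf{GL}_n(\mathbb{R})$ and an open neighbourhood $\mathcal{O}_n$ of $\psi_n$ in $\mathrm{Hom}(\Gamma,\mathsf{GL}_n(\mathbb{C}))$ such that: 1. every representation in $\mathcal{O}_n$ is a quasi-isometric embedding and is not locally rigid; 2. for every $j=1,\dots,d-1$, no representation in $\mathcal{O}_n$ is $j$-Anosov into $\mathsf{GL}_n(\mathbb{C})$; 3. for every $r=1,\dots,n-1$, no representation of $\Gamma$ into $\mathsf{GL}_n(\mathbb{R})$ that lies in $\mathcal{O}_n$ is $r$-Anosov into $\mathsf{GL}_n(\mathbb{R})$.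 -/

import Mathlib

/-- The group `(ℤ × F) * F_m`: the free product of `ℤ × F` with a free group of rank `m`. -/
abbrev FreeProdGroup (F : Type) [Group F] (m : ℕ) : Type :=
  Monoid.Coprod (Multiplicative ℤ × F) (FreeGroup (Fin m))

/-- A group is virtually free if it has a free subgroup of finite index. -/
def IsVirtuallyFree (Γ : Type*) [Group Γ] : Prop :=
  ∃ H : Subgroup Γ, H.FiniteIndex ∧ IsFreeGroup H

/-- The word length of `γ` with respect to `S`: the least length of a word in the letters
`S ∪ S⁻¹` that represents `γ`. (Only used when `S` generates, so that such a word exists.) -/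
noncomputable def wordLength {Γ : Type*} [Group Γ] (S : Finset Γ) (γ : Γ) : ℕ :=
  sInf {k : ℕ | ∃ l : List Γ, l.length = k ∧ (∀ x ∈ l, x ∈ S ∨ x⁻¹ ∈ S) ∧ l.prod = γ}

/-- The `j`-th singular value `σ_j(g)` of `g ∈ GL_n(𝕜)`, numbered from `1` and in
non-increasing order: `σ_1(g) ≥ ⋯ ≥ σ_n(g) > 0`.
Mathlib numbers the singular values of a linear map from `0`. -/
noncomputable def sigma {𝕜 : Type*} [RCLike 𝕜] {n : ℕ} (j : ℕ)
    (g : Matrix.GeneralLinearGroup (Fin n) 𝕜) : ℝ :=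
  (Matrix.toEuclideanLin (g : Matrix (Fin n) (Fin n) 𝕜)).singularValues (j - 1)

/-- `ρ : Γ → GL_n(𝕜)` is a quasi-isometric embedding: `Γ` is finitely generated and, for the word
length of a finite generating set and some `c, θ > 0`, one has
`σ_1(ρ(γ)) / σ_n(ρ(γ)) ≥ c e^{θ |γ|}` for all `γ`. The word lengths of two finite generating sets
are bi-Lipschitz equivalent, so the choice of the generating set does not matter. -/
def IsQIEmbedding {Γ : Type*} [Group Γ] {𝕜 : Type*} [RCLike 𝕜] {n : ℕ}
    (ρ : Γ →* Matrix.GeneralLinearGroup (Fin n) 𝕜) : Prop :=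
  ∃ S : Finset Γ, Subgroup.closure (S : Set Γ) = ⊤ ∧
    ∃ c θ : ℝ, 0 < c ∧ 0 < θ ∧
      ∀ γ : Γ, c * Real.exp (θ * wordLength S γ) ≤ sigma 1 (ρ γ) / sigma n (ρ γ)

/-- `ρ : Γ → GL_n(𝕜)` is `j`-Anosov, `1 ≤ j ≤ n - 1`: `Γ` is finitely generated and, for the word
length of a finite generating set and some `c, ε > 0`, one has
`σ_j(ρ(γ)) / σ_{j+1}(ρ(γ)) ≥ c e^{ε |γ|}` for all `γ`. The choice of the finite generating set
does not matter. -/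
def IsAnosov {Γ : Type*} [Group Γ] {𝕜 : Type*} [RCLike 𝕜] {n : ℕ} (j : ℕ)
    (ρ : Γ →* Matrix.GeneralLinearGroup (Fin n) 𝕜) : Prop :=
  ∃ S : Finset Γ, Subgroup.closure (S : Set Γ) = ⊤ ∧
    ∃ c ε : ℝ, 0 < c ∧ 0 < ε ∧
      ∀ γ : Γ, c * Real.exp (ε * wordLength S γ) ≤ sigma j (ρ γ) / sigma (j + 1) (ρ γ)

/-- The topology of pointwise convergence on `Hom(Γ, GL_n(𝕜))`, where `GL_n(𝕜)` carries its usual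
topology. -/
instance homTopology {Γ : Type*} [Group Γ] {𝕜 : Type*} [RCLike 𝕜] {n : ℕ} :
    TopologicalSpace (Γ →* Matrix.GeneralLinearGroup (Fin n) 𝕜) :=
  TopologicalSpace.induced
    (fun (ρ : Γ →* Matrix.GeneralLinearGroup (Fin n) 𝕜) (γ : Γ) => ρ γ) Pi.topologicalSpace

/-- `ρ` is locally rigid: all representations in some neighbourhood of `ρ` in `Hom(Γ, GL_n(𝕜))` are
conjugate to `ρ` by elements of `GL_n(𝕜)`. -/
def IsLocallyRigid {Γ : Type*} [Group Γ] {𝕜 : Type*} [RCLike 𝕜] {n : ℕ}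
    (ρ : Γ →* Matrix.GeneralLinearGroup (Fin n) 𝕜) : Prop :=
  ∃ U : Set (Γ →* Matrix.GeneralLinearGroup (Fin n) 𝕜), IsOpen U ∧ ρ ∈ U ∧
    ∀ ρ' ∈ U, ∃ g : Matrix.GeneralLinearGroup (Fin n) 𝕜, ∀ γ : Γ, ρ' γ = g * ρ γ * g⁻¹

/-- The inclusion of `Hom(Γ, GL_n(ℝ))` in `Hom(Γ, GL_n(ℂ))`. -/
noncomputable def complexify {Γ : Type*} [Group Γ] {n : ℕ}
    (ρ : Γ →* Matrix.GeneralLinearGroup (Fin n) ℝ) :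
    Γ →* Matrix.GeneralLinearGroup (Fin n) ℂ :=
  (Matrix.GeneralLinearGroup.map Complex.ofRealHom).comp ρ

/-! ### Word length and homomorphisms to `ℤ`. -/

section WordLength

variable {Γ : Type*} [Group Γ]

/-! Take `m = 1` and let `F` be the group of signed permutation matrices of size `d`, acting on the
first `d` of `n` coordinates. The generator `t` of `ℤ` goes to `stdMat`: a large scalar `lam` on
these `d` coordinates, right-angle rotations on `b` planes, `1/2` on `s ≤ 1` lines, and `lam⁻¹` on
the last line. The free generator `a` goes to a conjugate of a matrix of the same shape whose first
block is a single line, with a large scalar `L`.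

Gaps. An exponential gap at index `j` along the powers of an element forces a gap at index `j`
between the moduli of its eigenvalues (`exists_countGe_eq_of_gap`); the powers of the inverse give a
gap at index `n - j`. Both apply to `t` and `a`, whose powers have linearly growing word length
because a homomorphism to `ℤ` detects them.

Near the model, the restriction to the finite group `F` is conjugate to the original one by a matrix
close to `1` (`exists_intertwiner`). Since `t` commutes with `F`, Schur's lemma keeps it scalar on a
`d`-dimensional block (`SignedPerm.eq_fromBlocks_of_commute`), and this scalar still dominates the
rest of the spectrum. So the top `d` moduli coincide for all nearby complex representations, which
excludes indices `1, …, d - 1`.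

For a real representation near the model, the `2b` middle eigenvalues of `t` stay non-real, hence
come in conjugate pairs. A gap strictly inside this range must therefore have the parity of `d`,
which is even; the same argument for `a` gives odd indices (`even_countGe_sub_of_near`). With the
choice of `s` and `s'` according to the parity of `n`, the constraints at `r` and `n - r` leave no
index (`parity_contradiction`).

Growth. A ping-pong argument on vectors (`exists_norm_ge_of_pingPong`) shows that every `γ` expands
some vector exponentially in its word length. Nonzero powers of `a` send everything away from two
hyperplanes into thin cones around two lines; nontrivial elements of `ℤ × F` send these cones away
from the hyperplanes, by a generic choice of a vector and two linear forms
(`SignedPerm.exists_forms`). All estimates tolerate perturbation (`exists_model`), so an open set of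
representations is quasi-isometrically embedded.

Local rigidity fails everywhere: twisting by a scalar character changes the determinant of `t`.
Virtual freeness comes from identifying the group with a semidirect product of a free group of rank
`|F| + 1` by `F`. -/

lemma exists_word_of_closure_eq_top {S : Finset Γ}
    (hS : Subgroup.closure (S : Set Γ) = ⊤) (γ : Γ) :
    ∃ l : List Γ, (∀ x ∈ l, x ∈ S ∨ x⁻¹ ∈ S) ∧ l.prod = γ := by
  have h : γ ∈ Subgroup.closure (S : Set Γ) := hS ▸ Subgroup.mem_top γ
  rw [← Subgroup.mem_toSubmonoid, Subgroup.closure_toSubmonoid] at h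
  obtain ⟨l, hl, rfl⟩ := Submonoid.exists_list_of_mem_closure h
  refine ⟨l, fun x hx => ?_, rfl⟩
  rcases hl x hx with h | h
  · exact Or.inl h
  · exact Or.inr h

lemma wordLength_le_length {S : Finset Γ} (l : List Γ) (hl : ∀ x ∈ l, x ∈ S ∨ x⁻¹ ∈ S) :
    wordLength S l.prod ≤ l.length :=
  Nat.sInf_le ⟨l, rfl, hl, rfl⟩

lemma exists_word_length_eq_wordLength {S : Finset Γ}
    (hS : Subgroup.closure (S : Set Γ) = ⊤) (γ : Γ) :
    ∃ l : List Γ, l.length = wordLength S γ ∧ (∀ x ∈ l, x ∈ S ∨ x⁻¹ ∈ S) ∧ l.prod = γ := by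
  obtain ⟨l, hl, h⟩ := exists_word_of_closure_eq_top hS γ
  exact Nat.sInf_mem (s := {k : ℕ | ∃ l : List Γ, l.length = k ∧
    (∀ x ∈ l, x ∈ S ∨ x⁻¹ ∈ S) ∧ l.prod = γ}) ⟨l.length, l, rfl, hl, h⟩

/-- Each letter changes the value of the homomorphism by a bounded amount. This bounds word length
from below on powers of an element that the homomorphism detects. -/
lemma exists_abs_hom_le_mul_wordLength {S : Finset Γ}
    (hS : Subgroup.closure (S : Set Γ) = ⊤) (h : Γ →* Multiplicative ℤ) :
    ∃ K : ℝ, 0 < K ∧ ∀ γ, |((h γ).toAdd : ℝ)| ≤ K * wordLength S γ := by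
  -- The summand `1` only serves to make the constant positive.
  refine ⟨1 + ∑ s ∈ S, |((h s).toAdd : ℝ)|, by positivity, fun γ => ?_⟩
  obtain ⟨l, hlen, hl, rfl⟩ := exists_word_length_eq_wordLength hS γ
  rw [← hlen]
  clear hlen
  induction l with
  | nil => simp
  | cons x l ih =>
    have h1 := ih fun y hy => hl y (List.mem_cons_of_mem _ hy)
    have h2 : |((h x).toAdd : ℝ)| ≤ 1 + ∑ s ∈ S, |((h s).toAdd : ℝ)| := by
      have key : ∀ y ∈ S, |((h y).toAdd : ℝ)| ≤ ∑ s ∈ S, |((h s).toAdd : ℝ)| := fun y hy =>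
        Finset.single_le_sum (f := fun s => |((h s).toAdd : ℝ)|) (fun _ _ => abs_nonneg _) hy
      rcases hl x List.mem_cons_self with hx | hx
      · linarith [key x hx]
      · have := key _ hx
        simp only [map_inv, toAdd_inv, Int.cast_neg, abs_neg] at this
        linarith
    simp only [List.prod_cons, map_mul, toAdd_mul, Int.cast_add, List.length_cons, Nat.cast_add,
      Nat.cast_one]
    calc _ ≤ |((h x).toAdd : ℝ)| + |((h l.prod).toAdd : ℝ)| := abs_add_le _ _
      _ ≤ _ := by rw [mul_add, mul_one]; linarith

/-- Along the powers of an element of infinite order detected by a homomorphism to `ℤ`, an Anosov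
representation has an exponential singular value gap. -/
lemma IsAnosov.exists_gap_pow {𝕜 : Type*} [RCLike 𝕜] {n j : ℕ}
    {ρ : Γ →* Matrix.GeneralLinearGroup (Fin n) 𝕜} (hρ : IsAnosov j ρ)
    (h : Γ →* Multiplicative ℤ) (γ : Γ) (hγ : |(h γ).toAdd| = 1) :
    ∃ c ε : ℝ, 0 < c ∧ 0 < ε ∧ ∀ k : ℕ,
      c * Real.exp (ε * k) ≤ sigma j (ρ γ ^ k) / sigma (j + 1) (ρ γ ^ k) := by
  obtain ⟨S, hS, c, ε, hc, hε, H⟩ := hρ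
  obtain ⟨K, hK, hKS⟩ := exists_abs_hom_le_mul_wordLength hS h
  refine ⟨c, ε / K, hc, by positivity, fun k => ?_⟩
  refine le_trans ?_ (by simpa using H (γ ^ k))
  have h1 := hKS (γ ^ k)
  have hγ' : |((h γ).toAdd : ℝ)| = 1 := by exact_mod_cast hγ
  simp only [map_pow, toAdd_pow, nsmul_eq_mul, Int.cast_mul, Int.cast_natCast, abs_mul,
    hγ', Nat.abs_cast, mul_one] at h1
  have h2 : ε / K * k ≤ ε * wordLength S (γ ^ k) := by
    rw [div_mul_eq_mul_div, div_le_iff₀ hK, mul_assoc]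
    gcongr
    linarith
  gcongr

end WordLength

/-! ### Failure of local rigidity by scalar twists. -/

section LocalRigidity

/-- The twist of a representation by a scalar character. -/
noncomputable def twist {Γ : Type*} [Group Γ] {n : ℕ} (χ : Γ →* ℂˣ)
    (ρ : Γ →* Matrix.GeneralLinearGroup (Fin n) ℂ) :
    Γ →* Matrix.GeneralLinearGroup (Fin n) ℂ where
  toFun γ := Units.map (algebraMap ℂ (Matrix (Fin n) (Fin n) ℂ)).toMonoidHom (χ γ) * ρ γ
  map_one' := by simp
  map_mul' x y := by
    ext1
    simp only [map_mul, Units.val_mul, Units.coe_map, RingHom.toMonoidHom_eq_coe,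
      MonoidHom.coe_coe]
    rw [mul_assoc, mul_assoc]
    congr 1
    rw [← mul_assoc, ← mul_assoc, Algebra.commutes]

lemma continuous_of_eval {X Γ : Type*} [TopologicalSpace X] [Group Γ] {𝕜 : Type*} [RCLike 𝕜]
    {n : ℕ} {f : X → (Γ →* Matrix.GeneralLinearGroup (Fin n) 𝕜)}
    (hf : ∀ γ, Continuous fun x => f x γ) : Continuous f :=
  continuous_induced_rng.2 (continuous_pi hf)

lemma continuous_eval {Γ : Type*} [Group Γ] {𝕜 : Type*} [RCLike 𝕜] {n : ℕ} (γ : Γ) :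
    Continuous fun ρ : Γ →* Matrix.GeneralLinearGroup (Fin n) 𝕜 => ρ γ :=
  (continuous_apply γ).comp continuous_induced_dom

/-- Twisting by the character `z ^ h` deforms `ρ` continuously and multiplies the determinant at `γ`
by `z ^ n`, whereas conjugation preserves the determinant. -/
lemma not_isLocallyRigid_of_hom {Γ : Type*} [Group Γ] {n : ℕ} (hn : n ≠ 0)
    (h : Γ →* Multiplicative ℤ) (γ : Γ) (hγ : h γ = Multiplicative.ofAdd 1)
    (ρ : Γ →* Matrix.GeneralLinearGroup (Fin n) ℂ) : ¬ IsLocallyRigid ρ := by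
  rintro ⟨U, hU, hρU, H⟩
  let χ : ℂˣ → Γ →* ℂˣ := fun z => (zpowersHom ℂˣ z).comp h
  have hcont : Continuous fun z : ℂˣ => twist (χ z) ρ := by
    apply continuous_of_eval
    intro γ
    simp only [twist, χ, MonoidHom.coe_mk, OneHom.coe_mk, MonoidHom.comp_apply,
      zpowersHom_apply]
    have : Continuous fun z : ℂˣ => z ^ (h γ).toAdd := continuous_zpow _
    exact (Continuous.units_map _ (by
      exact continuous_algebraMap ℂ (Matrix (Fin n) (Fin n) ℂ))|>.comp this).mul continuous_const
  have h1 : twist (χ 1) ρ = ρ := by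
    ext γ : 1
    simp [twist, χ]
  have hmem : ∀ᶠ z in nhds (1 : ℂˣ), twist (χ z) ρ ∈ U :=
    hcont.continuousAt.eventually_mem (by rw [h1]; exact hU.mem_nhds hρU)
  -- Real parameters greater than `1` that tend to `1`: none of them is a root of unity.
  let u : ℕ → ℂˣ := fun k => Units.mk0 (1 + 1 / ((k : ℂ) + 1)) (by
    have : (1 + 1 / ((k : ℂ) + 1)) = ((1 + 1 / ((k : ℝ) + 1) : ℝ) : ℂ) := by push_cast; rfl
    rw [this, Complex.ofReal_ne_zero]
    positivity)
  have hu : Filter.Tendsto u Filter.atTop (nhds 1) := by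
    rw [Units.isEmbedding_val₀.tendsto_nhds_iff]
    simpa [u, Function.comp_def] using
      (tendsto_const_nhds (x := (1 : ℂ))).add (tendsto_one_div_add_atTop_nhds_zero_nat (𝕜 := ℂ))
  obtain ⟨k, hk⟩ := (hu.eventually hmem).exists
  obtain ⟨g, hg⟩ := H _ hk
  have h2 := congrArg (fun x : Matrix.GeneralLinearGroup (Fin n) ℂ =>
    (x : Matrix (Fin n) (Fin n) ℂ).det) (hg γ)
  have hd : ((ρ γ : Matrix.GeneralLinearGroup (Fin n) ℂ) : Matrix (Fin n) (Fin n) ℂ).det ≠ 0 :=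
    ((Matrix.isUnit_iff_isUnit_det _).1 (ρ γ).isUnit).ne_zero
  have hgd : (g : Matrix (Fin n) (Fin n) ℂ).det *
      ((g⁻¹ : Matrix.GeneralLinearGroup (Fin n) ℂ) : Matrix (Fin n) (Fin n) ℂ).det = 1 := by
    rw [← Matrix.det_mul, ← Units.val_mul, mul_inv_cancel, Units.val_one, Matrix.det_one]
  simp only [twist, χ, MonoidHom.coe_mk, OneHom.coe_mk, MonoidHom.comp_apply, hγ,
    zpowersHom_apply, toAdd_ofAdd, zpow_one, Units.coe_map, RingHom.toMonoidHom_eq_coe,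
    MonoidHom.coe_coe,
    Units.val_mul, Matrix.det_mul] at h2
  rw [Algebra.algebraMap_eq_smul_one, Matrix.det_smul, Fintype.card_fin, Matrix.det_one,
    mul_one] at h2
  have h3 : ((u k : ℂˣ) : ℂ) ^ n = 1 := by
    have : ((u k : ℂˣ) : ℂ) ^ n * (ρ γ : Matrix (Fin n) (Fin n) ℂ).det =
        1 * (ρ γ : Matrix (Fin n) (Fin n) ℂ).det := by
      rw [h2, mul_right_comm, hgd]
    exact mul_right_cancel₀ hd this
  have h4 := congrArg norm h3
  have hval : ((u k : ℂˣ) : ℂ) = ((1 + 1 / ((k : ℝ) + 1) : ℝ) : ℂ) := by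
    simp [u]
  rw [norm_pow, norm_one, hval, Complex.norm_real, Real.norm_of_nonneg (by positivity)] at h4
  have : 1 < 1 + 1 / ((k : ℝ) + 1) := by
    have : 0 < 1 / ((k : ℝ) + 1) := by positivity
    linarith
  exact absurd h4 (one_lt_pow₀ this hn).ne'

end LocalRigidity

/-! ### The semidirect product structure and virtual freeness. -/

section VirtuallyFree

variable {F : Type} [Group F]

/-- The generator of the factor `ℤ` of `(ℤ × F) * F_1`. -/
def genT (F : Type) [Group F] : FreeProdGroup F 1 :=
  Monoid.Coprod.inl (Multiplicative.ofAdd 1, 1)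

/-- The inclusion of `F` in `(ℤ × F) * F_1`. -/
def inF : F →* FreeProdGroup F 1 := Monoid.Coprod.inl.comp (MonoidHom.inr _ _)

/-- The generator of the free factor of `(ℤ × F) * F_1`. -/
def genA (F : Type) [Group F] : FreeProdGroup F 1 := Monoid.Coprod.inr (FreeGroup.of 0)

lemma genT_comm_inF (f : F) : genT F * inF f = inF f * genT F := by
  simp [genT, inF, ← map_mul]

lemma inl_eq_genT_zpow_mul_inF (z : Multiplicative ℤ × F) :
    (Monoid.Coprod.inl z : FreeProdGroup F 1) = genT F ^ z.1.toAdd * inF z.2 := by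
  simp only [genT, inF, ← map_zpow, MonoidHom.comp_apply, ← map_mul]
  congr 1
  ext <;> simp [← ofAdd_zsmul]

lemma inr_eq_genA_zpow (w : FreeGroup (Fin 1)) :
    ∃ k : ℤ, (Monoid.Coprod.inr w : FreeProdGroup F 1) = genA F ^ k := by
  have : w ∈ Subgroup.zpowers (FreeGroup.of (0 : Fin 1)) := by
    have h := FreeGroup.closure_range_of (Fin 1)
    rw [Set.range_unique, Fin.default_eq_zero, ← Subgroup.zpowers_eq_closure] at h
    rw [h]; trivial
  obtain ⟨k, rfl⟩ := this
  exact ⟨k, by simp [genA]⟩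

lemma freeProdGroup_hom_ext {M : Type*} [Group M] {φ₁ φ₂ : FreeProdGroup F 1 →* M}
    (ht : φ₁ (genT F) = φ₂ (genT F)) (hf : ∀ f, φ₁ (inF f) = φ₂ (inF f))
    (ha : φ₁ (genA F) = φ₂ (genA F)) : φ₁ = φ₂ := by
  apply Monoid.Coprod.hom_ext
  · ext z
    obtain ⟨k, f⟩ := z
    simp only [MonoidHom.comp_apply, inl_eq_genT_zpow_mul_inF, map_mul, map_zpow, ht, hf]
  · ext i
    obtain rfl : i = 0 := Subsingleton.elim _ _
    simpa [genA] using ha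

/-- A representation of `(ℤ × F) * F_1` from the images of its generators. -/
def liftHom {M : Type*} [Group M] (T A : M) (φ : F →* M) (h : ∀ f, Commute T (φ f)) :
    FreeProdGroup F 1 →* M :=
  Monoid.Coprod.lift
    (MonoidHom.noncommCoprod (zpowersHom M T) φ fun m f => by
      simpa using (h f).zpow_left _)
    (FreeGroup.lift fun _ => A)

section

variable {M : Type*} [Group M] (T A : M) (φ : F →* M) (h : ∀ f, Commute T (φ f))

@[simp] lemma liftHom_genT : liftHom T A φ h (genT F) = T := by simp [liftHom, genT]

@[simp] lemma liftHom_inF (f : F) : liftHom T A φ h (inF f) = φ f := by simp [liftHom, inF]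

@[simp] lemma liftHom_genA : liftHom T A φ h (genA F) = A := by simp [liftHom, genA]

end

/-- The permutation action of `F` on the free group on `Option F`. -/
def optionAction (F : Type) [Group F] : F →* MulAut (FreeGroup (Option F)) where
  toFun f := FreeGroup.freeGroupCongr (Equiv.optionCongr (Equiv.mulLeft f))
  map_one' := by
    ext x
    rcases x with _ | x
    · simp
  map_mul' f g := by
    apply MulEquiv.toMonoidHom_injective
    ext x
    rcases x with _ | x <;> simp [mul_assoc]

@[simp] lemma optionAction_of_none (f : F) :
    optionAction F f (FreeGroup.of none) = FreeGroup.of none := by simp [optionAction]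

@[simp] lemma optionAction_of_some (f g : F) :
    optionAction F f (FreeGroup.of (some g)) = FreeGroup.of (some (f * g)) := by
  simp [optionAction]

/-- The homomorphism from the free group on `Option F` to `(ℤ × F) * F_1` that sends `none` to the
generator of `ℤ` and `some f` to the conjugate by `f` of the free generator. -/
def freeToProd (F : Type) [Group F] : FreeGroup (Option F) →* FreeProdGroup F 1 :=
  FreeGroup.lift fun o => o.elim (genT F) fun f => inF f * genA F * (inF f)⁻¹

/-- `(ℤ × F) * F_1` maps to the semidirect product of a free group and `F`. -/
def prodToSemi (F : Type) [Group F] :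
    FreeProdGroup F 1 →* FreeGroup (Option F) ⋊[optionAction F] F :=
  liftHom (SemidirectProduct.inl (FreeGroup.of none))
    (SemidirectProduct.inl (FreeGroup.of (some 1)))
    SemidirectProduct.inr fun f => by
      ext
      · rw [SemidirectProduct.mul_left, SemidirectProduct.mul_left]
        simp [optionAction_of_none]
      · rw [SemidirectProduct.mul_right, SemidirectProduct.mul_right]
        simp

@[simp] lemma prodToSemi_genT :
    prodToSemi F (genT F) = SemidirectProduct.inl (FreeGroup.of none) := liftHom_genT _ _ _ _

@[simp] lemma prodToSemi_inF (f : F) :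
    prodToSemi F (inF f) = SemidirectProduct.inr f := liftHom_inF _ _ _ _ _

@[simp] lemma prodToSemi_genA :
    prodToSemi F (genA F) = SemidirectProduct.inl (FreeGroup.of (some 1)) := liftHom_genA _ _ _ _

/-- This left inverse, up to the inclusion of the free group, makes `freeToProd` injective without
any normal form in the free product. -/
lemma prodToSemi_freeToProd (x : FreeGroup (Option F)) :
    prodToSemi F (freeToProd F x) = SemidirectProduct.inl x := by
  have : (prodToSemi F).comp (freeToProd F) = SemidirectProduct.inl := by
    ext o : 1
    rcases o with _ | f
    · simp [freeToProd]
    · simp only [freeToProd, MonoidHom.comp_apply, FreeGroup.lift_apply_of,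
        Option.elim_some, map_mul, prodToSemi_inF, prodToSemi_genA, map_inv]
      rw [← map_inv, ← SemidirectProduct.inl_aut]
      simp
  exact DFunLike.congr_fun this x

/-- The inverse of `prodToSemi`. -/
def semiToProd (F : Type) [Group F] :
    FreeGroup (Option F) ⋊[optionAction F] F →* FreeProdGroup F 1 :=
  SemidirectProduct.lift (freeToProd F) inF fun f => by
    ext o : 1
    rcases o with _ | g
    · simp [freeToProd, MulAut.conj_apply, ← genT_comm_inF]
    · simp [freeToProd, MulAut.conj_apply, mul_assoc]

lemma semiToProd_prodToSemi (x : FreeProdGroup F 1) : semiToProd F (prodToSemi F x) = x := by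
  have : (semiToProd F).comp (prodToSemi F) = MonoidHom.id _ := by
    apply freeProdGroup_hom_ext <;> simp [semiToProd, freeToProd]
  exact DFunLike.congr_fun this x

/-- The free subgroup is the kernel of the projection to `F`, which has finite index since `F` is
finite. It is generated by the central generator and the `F`-conjugates of the free generator. -/
theorem isVirtuallyFree_freeProdGroup (F : Type) [Group F] [Finite F] :
    IsVirtuallyFree (FreeProdGroup F 1) := by
  refine ⟨(freeToProd F).range, ?_, ?_⟩
  · have : (freeToProd F).range = (SemidirectProduct.rightHom.comp (prodToSemi F)).ker := by
      ext γ
      simp only [MonoidHom.mem_range, MonoidHom.mem_ker, MonoidHom.comp_apply]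
      constructor
      · rintro ⟨x, rfl⟩
        simp [prodToSemi_freeToProd]
      · intro h
        rw [← MonoidHom.mem_ker, ← SemidirectProduct.range_inl_eq_ker_rightHom] at h
        obtain ⟨x, hx⟩ := h
        refine ⟨x, ?_⟩
        rw [← semiToProd_prodToSemi γ, ← hx]
        simp [semiToProd]
    rw [this]
    infer_instance
  · have hinj : Function.Injective (freeToProd F) := fun x y hxy => by
      have := congrArg (prodToSemi F) hxy
      rwa [prodToSemi_freeToProd, prodToSemi_freeToProd, SemidirectProduct.inl_inj] at this
    exact IsFreeGroup.ofMulEquiv (MonoidHom.ofInjective hinj)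

end VirtuallyFree

/-! ### Min-max bounds for singular values, and complexification. -/

section SingularValues

open Module

variable {𝕜 : Type*} [RCLike 𝕜] {E : Type*} [NormedAddCommGroup E] [InnerProductSpace 𝕜 E]

lemma Submodule.exists_mem_mem_ne_zero_of_finrank_lt {K V : Type*} [Field K] [AddCommGroup V]
    [Module K V] [FiniteDimensional K V] {U W : Submodule K V}
    (h : finrank K V < finrank K U + finrank K W) : ∃ x ∈ U, x ∈ W ∧ x ≠ 0 := by
  by_contra! hc
  have hd : Disjoint U W := Submodule.disjoint_def.2 hc
  have := Submodule.finrank_add_finrank_le_of_disjoint hd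
  omega

lemma OrthonormalBasis.finrank_span_image {ι : Type*} [Fintype ι] [DecidableEq ι]
    (u : OrthonormalBasis ι 𝕜 E) (s : Finset ι) :
    finrank 𝕜 (Submodule.span 𝕜 (u '' s)) = s.card := by
  have h : LinearIndependent 𝕜 (fun i : s => u i) :=
    u.orthonormal.linearIndependent.comp _ Subtype.val_injective
  have := finrank_span_eq_card h
  rw [Fintype.card_coe] at this
  rw [← this, show (u '' s) = Set.range (fun i : s => u i) by ext x; simp]

lemma OrthonormalBasis.inner_eq_zero_of_mem_span_image {ι : Type*} [Fintype ι]
    (u : OrthonormalBasis ι 𝕜 E) {s : Set ι} {x : E} (hx : x ∈ Submodule.span 𝕜 (u '' s))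
    {i : ι} (hi : i ∉ s) : inner 𝕜 (u i) x = 0 := by
  induction hx using Submodule.span_induction with
  | mem x h =>
    obtain ⟨j, hj, rfl⟩ := h
    exact u.orthonormal.inner_eq_zero fun hij => hi (hij ▸ hj)
  | zero => simp
  | add x y _ _ hx hy => rw [inner_add_right, hx, hy, add_zero]
  | smul c x _ hx => rw [inner_smul_right, hx, mul_zero]

variable [FiniteDimensional 𝕜 E]

lemma LinearMap.norm_sq_apply_eq_sum_singularValues (T : E →ₗ[𝕜] E) {n : ℕ}
    (hn : finrank 𝕜 E = n) (x : E) :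
    ‖T x‖ ^ 2 = ∑ i : Fin n, T.singularValues i ^ 2 *
      ‖inner 𝕜 (T.isSymmetric_adjoint_comp_self.eigenvectorBasis hn i) x‖ ^ 2 := by
  set hT := T.isSymmetric_adjoint_comp_self
  set u := hT.eigenvectorBasis hn
  have h1 : inner 𝕜 x ((adjoint T ∘ₗ T) x) = ((‖T x‖ ^ 2 : ℝ) : 𝕜) := by
    rw [LinearMap.comp_apply, LinearMap.adjoint_inner_right, inner_self_eq_norm_sq_to_K]
    norm_cast
  rw [← u.sum_inner_mul_inner] at h1
  have h2 : ∀ i, inner 𝕜 x (u i) * inner 𝕜 (u i) ((adjoint T ∘ₗ T) x) =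
      ((T.singularValues i ^ 2 * ‖inner 𝕜 (u i) x‖ ^ 2 : ℝ) : 𝕜) := by
    intro i
    rw [← hT (u i) x, hT.apply_eigenvectorBasis hn i, inner_smul_left,
      T.sq_singularValues_fin hn i, RCLike.conj_ofReal, ← inner_conj_symm x (u i)]
    rw [mul_left_comm, RCLike.conj_mul]
    push_cast
    rfl
  simp_rw [h2] at h1
  exact_mod_cast h1.symm

/-- One half of the Courant–Fischer principle; `singularValues_le_of_norm_le` is the other half.
Indices start at `0`, hence the dimension `r + 1`. -/
lemma LinearMap.le_singularValues_of_le_norm (T : E →ₗ[𝕜] E) {r : ℕ} {s : ℝ} (hs : 0 ≤ s)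
    (W : Submodule 𝕜 E) (hW : r + 1 ≤ finrank 𝕜 W) (h : ∀ w ∈ W, s * ‖w‖ ≤ ‖T w‖) :
    s ≤ T.singularValues r := by
  obtain ⟨n, hn⟩ : ∃ n, finrank 𝕜 E = n := ⟨_, rfl⟩
  set u := T.isSymmetric_adjoint_comp_self.eigenvectorBasis hn
  have hrn : r < n := by
    have := Submodule.finrank_le W
    omega
  -- The singular vectors of index at least `r` span a space of dimension `n - r`, on which `T` has
  -- norm at most the `r`-th singular value; it must meet `W`.
  obtain ⟨x, hxU, hxW, hx0⟩ := Submodule.exists_mem_mem_ne_zero_of_finrank_lt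
    (U := Submodule.span 𝕜 (u '' (Finset.Ici (⟨r, hrn⟩ : Fin n)))) (W := W) (by
      rw [u.finrank_span_image, Fin.card_Ici]
      simp only [hn]
      omega)
  have h1 := h x hxW
  have h2 := T.norm_sq_apply_eq_sum_singularValues hn x
  have h3 : ∑ i : Fin n, T.singularValues i ^ 2 * ‖inner 𝕜 (u i) x‖ ^ 2 ≤
      T.singularValues r ^ 2 * ‖x‖ ^ 2 := by
    rw [← u.sum_sq_norm_inner_right x, Finset.mul_sum]
    refine Finset.sum_le_sum fun i _ => ?_
    by_cases hi : i ∈ (Finset.Ici (⟨r, hrn⟩ : Fin n))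
    · have : T.singularValues i ≤ T.singularValues r :=
        T.singularValues_antitone (by simpa [Fin.le_def] using hi)
      gcongr
      exact T.singularValues_nonneg _
    · rw [u.inner_eq_zero_of_mem_span_image hxU (by simpa using hi)]
      simp
  have h4 : (s * ‖x‖) ^ 2 ≤ (T.singularValues r * ‖x‖) ^ 2 := by
    rw [mul_pow (T.singularValues r)]
    calc (s * ‖x‖) ^ 2 ≤ ‖T x‖ ^ 2 := by gcongr
      _ ≤ _ := h2.trans_le h3
  have h5 := le_of_sq_le_sq h4 (mul_nonneg (T.singularValues_nonneg _) (norm_nonneg _))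
  exact le_of_mul_le_mul_right h5 (norm_pos_iff.2 hx0)

lemma LinearMap.singularValues_le_of_norm_le (T : E →ₗ[𝕜] E) {r : ℕ} {s : ℝ} (hs : 0 ≤ s)
    (hr : r < finrank 𝕜 E)
    (W : Submodule 𝕜 E) (hW : finrank 𝕜 E ≤ r + finrank 𝕜 W) (h : ∀ w ∈ W, ‖T w‖ ≤ s * ‖w‖) :
    T.singularValues r ≤ s := by
  obtain ⟨n, hn⟩ : ∃ n, finrank 𝕜 E = n := ⟨_, rfl⟩
  set u := T.isSymmetric_adjoint_comp_self.eigenvectorBasis hn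
  have hrn : r < n := hn ▸ hr
  obtain ⟨x, hxU, hxW, hx0⟩ := Submodule.exists_mem_mem_ne_zero_of_finrank_lt
    (U := Submodule.span 𝕜 (u '' (Finset.Iic (⟨r, hrn⟩ : Fin n)))) (W := W) (by
      rw [u.finrank_span_image, Fin.card_Iic]
      simp only [hn]
      omega)
  have h1 := h x hxW
  have h2 := T.norm_sq_apply_eq_sum_singularValues hn x
  have h3 : T.singularValues r ^ 2 * ‖x‖ ^ 2 ≤
      ∑ i : Fin n, T.singularValues i ^ 2 * ‖inner 𝕜 (u i) x‖ ^ 2 := by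
    rw [← u.sum_sq_norm_inner_right x, Finset.mul_sum]
    refine Finset.sum_le_sum fun i _ => ?_
    by_cases hi : i ∈ (Finset.Iic (⟨r, hrn⟩ : Fin n))
    · have : T.singularValues r ≤ T.singularValues i :=
        T.singularValues_antitone (by simpa [Fin.le_def] using hi)
      gcongr
      exact T.singularValues_nonneg _
    · rw [u.inner_eq_zero_of_mem_span_image hxU (by simpa using hi)]
      simp
  have h4 : (T.singularValues r * ‖x‖) ^ 2 ≤ (s * ‖x‖) ^ 2 := by
    rw [mul_pow (T.singularValues r)]
    calc _ ≤ ‖T x‖ ^ 2 := h2 ▸ h3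
      _ ≤ _ := by gcongr
  have h5 := le_of_sq_le_sq h4 (by positivity)
  exact le_of_mul_le_mul_right h5 (norm_pos_iff.2 hx0)

lemma Matrix.charpoly_toEuclideanLin {n : ℕ} (A : Matrix (Fin n) (Fin n) 𝕜) :
    (Matrix.toEuclideanLin A).charpoly = A.charpoly := by
  change (Matrix.toLpLin 2 2 A).charpoly = _
  rw [Matrix.toLpLin_eq_toLin, Matrix.charpoly_toLin]

lemma Matrix.charpoly_adjoint_comp_toEuclideanLin {n : ℕ} (A : Matrix (Fin n) (Fin n) 𝕜) :
    (LinearMap.adjoint (Matrix.toEuclideanLin A) ∘ₗ Matrix.toEuclideanLin A).charpoly =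
      (A.conjTranspose * A).charpoly := by
  rw [← Matrix.charpoly_toEuclideanLin, ← Matrix.toEuclideanLin_conjTranspose_eq_adjoint]
  congr 1
  ext x : 1
  simp [Matrix.toLpLin_apply]

/-- The squares of the singular values are the roots of the characteristic polynomial of `A* A`. For
real `A` this polynomial already splits over `ℝ`, so complexification adds no roots. -/
lemma singularValues_toEuclideanLin_map_ofReal {n : ℕ} (A : Matrix (Fin n) (Fin n) ℝ) (i : ℕ) :
    (Matrix.toEuclideanLin (A.map Complex.ofReal)).singularValues i =
      (Matrix.toEuclideanLin A).singularValues i := by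
  by_cases hi : i < n
  · set TR := Matrix.toEuclideanLin A
    set TC := Matrix.toEuclideanLin (A.map Complex.ofReal)
    rw [TR.singularValues_of_lt (finrank_euclideanSpace_fin) hi,
      TC.singularValues_of_lt (finrank_euclideanSpace_fin) hi]
    have h1 := TR.isSymmetric_adjoint_comp_self.sort_roots_charpoly_eq_eigenvalues
      (finrank_euclideanSpace_fin (n := n))
    have h2 := TC.isSymmetric_adjoint_comp_self.sort_roots_charpoly_eq_eigenvalues
      (finrank_euclideanSpace_fin (n := n))
    have h3 : (LinearMap.adjoint TC ∘ₗ TC).charpoly =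
        (LinearMap.adjoint TR ∘ₗ TR).charpoly.map Complex.ofRealHom := by
      rw [Matrix.charpoly_adjoint_comp_toEuclideanLin, Matrix.charpoly_adjoint_comp_toEuclideanLin,
        ← Matrix.charpoly_map]
      congr 1
      ext a b
      simp [Matrix.mul_apply]
    have h4 : (LinearMap.adjoint TC ∘ₗ TC).charpoly.roots.map RCLike.re =
        (LinearMap.adjoint TR ∘ₗ TR).charpoly.roots.map RCLike.re := by
      rw [h3, TR.isSymmetric_adjoint_comp_self.splits_charpoly.roots_map, Multiset.map_map]
      congr 1
    rw [h4, h1, List.ofFn_inj] at h2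
    rw [h2]
  · push Not at hi
    rw [LinearMap.singularValues_of_finrank_le _ (by simpa using hi),
      LinearMap.singularValues_of_finrank_le _ (by simpa using hi)]

lemma sigma_complexify {Γ : Type*} [Group Γ] {n : ℕ} (j : ℕ)
    (ρ : Γ →* Matrix.GeneralLinearGroup (Fin n) ℝ) (γ : Γ) :
    sigma j (complexify ρ γ) = sigma j (ρ γ) :=
  singularValues_toEuclideanLin_map_ofReal _ _

lemma IsAnosov.complexify {Γ : Type*} [Group Γ] {n j : ℕ}
    {ρ : Γ →* Matrix.GeneralLinearGroup (Fin n) ℝ} (h : IsAnosov j ρ) :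
    IsAnosov j (complexify ρ) := by
  obtain ⟨S, hS, c, ε, hc, hε, H⟩ := h
  exact ⟨S, hS, c, ε, hc, hε, fun γ => by simpa only [sigma_complexify] using H γ⟩

end SingularValues

/-! ### Growth of powers on sums of generalized eigenspaces. -/

section SpectralGrowth

open Module

variable {E : Type*} [NormedAddCommGroup E] [NormedSpace ℂ E]

/-- The sum of the generalized eigenspaces of `T` for the eigenvalues in `s`. -/
noncomputable def specSub (T : End ℂ E) (s : Set ℂ) : Submodule ℂ E :=
  ⨆ μ ∈ s, T.maxGenEigenspace μ

lemma specSub_invariant (T : End ℂ E) (s : Set ℂ) {w : E} (hw : w ∈ specSub T s) :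
    T w ∈ specSub T s := by
  have : specSub T s ≤ (specSub T s).comap T := by
    refine iSup₂_le fun μ hμ x hx => ?_
    have h : T x ∈ T.maxGenEigenspace μ := T.mapsTo_maxGenEigenspace_of_comm rfl μ hx
    exact (le_iSup₂_of_le (f := fun μ (_ : μ ∈ s) => T.maxGenEigenspace μ) μ hμ le_rfl) h
  exact this hw

/-- Generalized eigenspaces are independent, so an eigenvector for a value outside `s` meets their
sum over `s` only in `0`. -/
lemma mem_of_eigenvector_mem_specSub (T : End ℂ E) (s : Set ℂ) {w : E} (hw : w ∈ specSub T s)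
    (hw0 : w ≠ 0) {μ : ℂ} (hμ : T w = μ • w) : μ ∈ s := by
  by_contra h
  have hd : Disjoint (T.maxGenEigenspace μ) (⨆ ν ∈ s, T.maxGenEigenspace ν) :=
    T.independent_maxGenEigenspace.disjoint_biSup h
  have h1 : w ∈ T.maxGenEigenspace μ :=
    T.mem_maxGenEigenspace μ w |>.2 ⟨1, by simp [hμ]⟩
  exact hw0 (Submodule.disjoint_def.1 hd w h1 hw)

lemma inverse_pow_apply {T S : End ℂ E} (hST : S * T = 1) (k : ℕ) (w : E) :
    (S ^ k) ((T ^ k) w) = w := by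
  have : S ^ k * T ^ k = 1 := by
    induction k with
    | zero => simp
    | succ k ih => rw [pow_succ, pow_succ', mul_assoc, ← mul_assoc S, hST, one_mul, ih]
  exact LinearMap.congr_fun this w

variable [FiniteDimensional ℂ E]

lemma finrank_biSup_maxGenEigenspace (T : End ℂ E) (s : Finset ℂ) :
    finrank ℂ (⨆ μ ∈ s, T.maxGenEigenspace μ : Submodule ℂ E) =
      ∑ μ ∈ s, T.charpoly.rootMultiplicity μ := by
  induction s using Finset.induction_on with
  | empty => simp
  | insert a s ha ih =>
    rw [Finset.iSup_insert, Finset.sum_insert ha, ← ih, ← T.finrank_maxGenEigenspace_eq a]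
    have hd : Disjoint (T.maxGenEigenspace a) (⨆ μ ∈ s, T.maxGenEigenspace μ) :=
      T.independent_maxGenEigenspace.disjoint_biSup (y := (s : Set ℂ)) ha
    have := Submodule.finrank_sup_add_finrank_inf_eq (T.maxGenEigenspace a)
      (⨆ μ ∈ s, T.maxGenEigenspace μ)
    rwa [hd.eq_bot, finrank_bot, add_zero] at this

open Classical in
lemma finrank_specSub (T : End ℂ E) (s : Set ℂ) :
    finrank ℂ (specSub T s) = (T.charpoly.roots.filter (· ∈ s)).card := by
  have h1 : specSub T s =
      ⨆ μ ∈ (T.charpoly.roots.filter (· ∈ s)).toFinset, T.maxGenEigenspace μ := by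
    apply le_antisymm
    · refine iSup₂_le fun μ hμ => ?_
      by_cases h : μ ∈ T.charpoly.roots
      · exact le_iSup₂_of_le μ (by simp [h, hμ]) le_rfl
      · have : finrank ℂ (T.maxGenEigenspace μ) = 0 := by
          rw [T.finrank_maxGenEigenspace_eq, ← Polynomial.count_roots]
          exact Multiset.count_eq_zero.2 h
        rw [Submodule.finrank_eq_zero.1 this]
        exact bot_le
    · refine iSup₂_le fun μ hμ => ?_
      exact le_iSup₂_of_le (f := fun μ (_ : μ ∈ s) => T.maxGenEigenspace μ) μ
        (by simp only [Multiset.mem_toFinset, Multiset.mem_filter] at hμ; exact hμ.2) le_rfl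
  rw [h1, finrank_biSup_maxGenEigenspace, ← Multiset.toFinset_sum_count_eq]
  refine Finset.sum_congr rfl fun μ hμ => ?_
  simp only [Multiset.mem_toFinset, Multiset.mem_filter] at hμ
  rw [Multiset.count_filter_of_pos hμ.2, Polynomial.count_roots]

/-- `T` is injective on this finite-dimensional invariant subspace, hence surjective onto it. -/
lemma inverse_mem_specSub {T S : End ℂ E} (hST : S * T = 1) (s : Set ℂ) {w : E}
    (hw : w ∈ specSub T s) : S w ∈ specSub T s := by
  have hinj : Function.Injective (T.restrict (fun w hw => specSub_invariant T s hw)) := by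
    intro x y hxy
    have h1 : T x = T y := congrArg Subtype.val hxy
    have h2 : S (T x) = S (T y) := by rw [h1]
    have h3 : ∀ z, S (T z) = z := fun z => LinearMap.congr_fun hST z
    rw [h3, h3] at h2
    exact Subtype.ext h2
  obtain ⟨y, hy⟩ := LinearMap.surjective_of_injective hinj ⟨w, hw⟩
  have h1 : T y = w := congrArg Subtype.val hy
  have h3 : S (T y) = y := LinearMap.congr_fun hST y
  rw [← h1, h3]
  exact y.2

/-- Powers of an operator grow on an invariant subspace at most as fast as the moduli of its
eigenvalues there. -/
lemma exists_norm_pow_apply_le (T : End ℂ E) (W : Submodule ℂ E) (hW : ∀ w ∈ W, T w ∈ W) {r r' : ℝ}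
    (hr : 0 ≤ r) (hrr' : r < r')
    (h : ∀ w ∈ W, w ≠ 0 → ∀ μ : ℂ, T w = μ • w → ‖μ‖ ≤ r) :
    ∃ C : ℝ, 0 < C ∧ ∀ (k : ℕ), ∀ w ∈ W, ‖(T ^ k) w‖ ≤ C * r' ^ k * ‖w‖ := by
  set R : W →L[ℂ] W := Module.End.toContinuousLinearMap W (T.restrict hW)
  have hspec : ∀ μ ∈ spectrum ℂ R, ‖μ‖ ≤ r := by
    intro μ hμ
    rw [AlgEquiv.spectrum_eq, ← Module.End.hasEigenvalue_iff_mem_spectrum] at hμ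
    obtain ⟨w, hw⟩ := hμ.exists_hasEigenvector
    exact h w w.2 (by simpa using hw.2) μ (congrArg Subtype.val hw.apply_eq_smul)
  have hrad : spectralRadius ℂ R ≤ ENNReal.ofReal r := by
    refine iSup₂_le fun μ hμ => ?_
    rw [← enorm_eq_nnnorm, ← ofReal_norm]
    exact ENNReal.ofReal_le_ofReal (hspec μ hμ)
  have hr' : 0 < r' := hr.trans_lt hrr'
  -- Gelfand's formula: the spectral radius of the restriction is at most `r < r'`.
  have hev : ∀ᶠ k : ℕ in Filter.atTop, ‖R ^ k‖ ≤ r' ^ k := by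
    have hlt : spectralRadius ℂ R < ENNReal.ofReal r' :=
      hrad.trans_lt ((ENNReal.ofReal_lt_ofReal_iff hr').2 hrr')
    filter_upwards [
      (spectrum.pow_nnnorm_pow_one_div_tendsto_nhds_spectralRadius R).eventually_lt_const hlt,
      Filter.eventually_gt_atTop 0] with k hk hk0
    have hk' : (0 : ℝ) < k := by exact_mod_cast hk0
    have := ENNReal.rpow_le_rpow hk.le hk'.le
    rw [← ENNReal.rpow_mul, one_div, inv_mul_cancel₀ hk'.ne', ENNReal.rpow_one,
      ENNReal.rpow_natCast, ← ENNReal.ofReal_pow hr'.le, ← enorm_eq_nnnorm, ← ofReal_norm] at this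
    exact (ENNReal.ofReal_le_ofReal_iff (by positivity)).1 this
  obtain ⟨N, hN⟩ := Filter.eventually_atTop.1 hev
  -- The sum absorbs the finitely many powers not covered by the asymptotic bound.
  refine ⟨1 + ∑ k ∈ Finset.range N, ‖R ^ k‖ / r' ^ k, by positivity, fun k w hw => ?_⟩
  have hRk : ‖R ^ k‖ ≤ (1 + ∑ k ∈ Finset.range N, ‖R ^ k‖ / r' ^ k) * r' ^ k := by
    by_cases hk : N ≤ k
    · refine (hN k hk).trans (le_mul_of_one_le_left (by positivity) ?_)
      have : 0 ≤ ∑ k ∈ Finset.range N, ‖R ^ k‖ / r' ^ k := by positivity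
      linarith
    · rw [← div_le_iff₀ (by positivity)]
      have : ‖R ^ k‖ / r' ^ k ≤ ∑ k ∈ Finset.range N, ‖R ^ k‖ / r' ^ k :=
        Finset.single_le_sum (f := fun k => ‖R ^ k‖ / r' ^ k) (fun _ _ => by positivity)
          (Finset.mem_range.2 (not_le.1 hk))
      linarith
  have hpow : ∀ (k : ℕ) (x : W), ((R ^ k) x : E) = (T ^ k) x := by
    intro k
    induction k with
    | zero => intro x; simp
    | succ k ih =>
      intro x
      rw [pow_succ, pow_succ]
      exact ih (R x)
  rw [← hpow k ⟨w, hw⟩]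
  exact ((R ^ k).le_opNorm _).trans (mul_le_mul_of_nonneg_right hRk (norm_nonneg _))

lemma exists_norm_pow_apply_le_specSub (T : End ℂ E) {s : Set ℂ} {r r' : ℝ}
    (hr : 0 ≤ r) (hrr' : r < r') (hs : ∀ μ ∈ s, ‖μ‖ ≤ r) :
    ∃ C : ℝ, 0 < C ∧ ∀ (k : ℕ), ∀ w ∈ specSub T s, ‖(T ^ k) w‖ ≤ C * r' ^ k * ‖w‖ :=
  exists_norm_pow_apply_le T _ (fun _ hw => specSub_invariant T s hw) hr hrr'
    fun _ hw hw0 _ hμ => hs _ (mem_of_eigenvector_mem_specSub T s hw hw0 hμ)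

/-- The eigenvalues of the inverse on this subspace are the reciprocals of those of `T`. Read
backwards, the bound says that `T ^ k` expands there at nearly the rate `r ^ k`. -/
lemma exists_norm_inverse_pow_apply_le_specSub {T S : End ℂ E} (hST : S * T = 1) (hTS : T * S = 1)
    {s : Set ℂ} {r r' : ℝ} (hr : 0 < r) (hrr' : r⁻¹ < r') (hs : ∀ μ ∈ s, r ≤ ‖μ‖) :
    ∃ C : ℝ, 0 < C ∧ ∀ (k : ℕ), ∀ w ∈ specSub T s, ‖(S ^ k) w‖ ≤ C * r' ^ k * ‖w‖ := by
  refine exists_norm_pow_apply_le S _ (fun _ hw => inverse_mem_specSub hST s hw)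
    (inv_nonneg.2 hr.le) hrr' fun w hw hw0 μ hμ => ?_
  have h1 : T (S w) = w := LinearMap.congr_fun hTS w
  rw [hμ, map_smul] at h1
  have hμ0 : μ ≠ 0 := by
    rintro rfl
    rw [zero_smul] at h1
    exact hw0 h1.symm
  have h2 : T w = μ⁻¹ • w := by
    nth_rewrite 2 [← h1]
    rw [inv_smul_smul₀ hμ0]
  have h3 := hs _ (mem_of_eigenvector_mem_specSub T s hw hw0 h2)
  rw [norm_inv] at h3
  exact (le_inv_comm₀ (norm_pos_iff.2 hμ0) hr).2 h3

end SpectralGrowth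

/-! ### Counting eigenvalues by modulus. -/

section Counting

/-- The number of elements of `M` of modulus at least `r`. -/
noncomputable def countGe (M : Multiset ℂ) (r : ℝ) : ℕ := (M.filter (r ≤ ‖·‖)).card

/-- The number of elements of `M` of modulus at most `r`. -/
noncomputable def countLe (M : Multiset ℂ) (r : ℝ) : ℕ := (M.filter (‖·‖ ≤ r)).card

lemma countGe_anti (M : Multiset ℂ) {r s : ℝ} (h : r ≤ s) : countGe M s ≤ countGe M r :=
  Multiset.card_le_card (Multiset.monotone_filter_right M fun _ hx => h.trans hx)

lemma countLe_add_card_filter_lt (M : Multiset ℂ) (r : ℝ) :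
    countLe M r + (M.filter (r < ‖·‖)).card = M.card := by
  rw [countLe, ← Multiset.card_add]
  conv_rhs => rw [← Multiset.filter_add_not (fun z : ℂ => ‖z‖ ≤ r) M]
  simp only [not_le]

/-- The hypothesis says that no circle contains both the `r`-th and the `(r + 1)`-st largest
elements. The witness is the modulus of the `r`-th one. -/
lemma exists_countGe_eq {M : Multiset ℂ} (h0 : ∀ z ∈ M, z ≠ 0) {r : ℕ} (hr : 1 ≤ r)
    (hrM : r ≤ M.card)
    (h : ∀ x : ℝ, 0 < x → countGe M x ≤ r ∨ countLe M x ≤ M.card - r) :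
    ∃ x : ℝ, countGe M x = r := by
  classical
  -- Its maximum `x` is the required level. If more than `r` elements had modulus at least `x`, the
  -- hypothesis would give at least `r` of modulus greater than `x`, and the least such modulus
  -- would be a larger member of `R`.
  set R := (M.map norm).toFinset.filter fun x => r ≤ countGe M x
  have hmemR : ∀ x, x ∈ R ↔ (∃ z ∈ M, ‖z‖ = x) ∧ r ≤ countGe M x := by
    intro x
    simp [R]
  have hne : R.Nonempty := by
    have hM : (M.map norm).toFinset.Nonempty := by
      rw [Multiset.toFinset_nonempty]
      intro hM
      rw [Multiset.map_eq_zero] at hM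
      rw [hM] at hrM
      simp at hrM
      omega
    refine ⟨(M.map norm).toFinset.min' hM, (hmemR _).2 ⟨by simpa using Finset.min'_mem _ hM, ?_⟩⟩
    rw [countGe, Multiset.filter_eq_self.2]
    · exact hrM
    · intro z hz
      exact Finset.min'_le _ _ (by simpa using ⟨z, hz, rfl⟩)
  set x := R.max' hne
  obtain ⟨⟨z, hz, hzx⟩, hrx⟩ := (hmemR x).1 (R.max'_mem hne)
  refine ⟨x, le_antisymm ?_ hrx⟩
  have hx0 : 0 < x := hzx ▸ norm_pos_iff.2 (h0 z hz)
  refine (h x hx0).resolve_right fun hle => ?_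
  have h1 := countLe_add_card_filter_lt M x
  set Q := (M.filter (x < ‖·‖))
  have hQ : (Q.map norm).toFinset.Nonempty := by
    rw [Multiset.toFinset_nonempty]
    intro hM
    rw [Multiset.map_eq_zero] at hM
    rw [hM] at h1
    simp at h1
    omega
  set y := (Q.map norm).toFinset.min' hQ
  have hy : ∃ z ∈ Q, ‖z‖ = y := by
    have := Finset.min'_mem _ hQ
    simpa only [Multiset.mem_toFinset, Multiset.mem_map] using this
  obtain ⟨w, hwQ, hwy⟩ := hy
  obtain ⟨hwM, hxw⟩ := Multiset.mem_filter.1 hwQ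
  have hyR : y ∈ R := by
    refine (hmemR y).2 ⟨⟨w, hwM, hwy⟩, ?_⟩
    have : Q ≤ M.filter (y ≤ ‖·‖) := by
      refine Multiset.le_filter.2 ⟨Multiset.filter_le _ _, fun z hz => ?_⟩
      exact Finset.min'_le _ _ (by
        simp only [Multiset.mem_toFinset, Multiset.mem_map]; exact ⟨z, hz, rfl⟩)
    have := Multiset.card_le_card this
    rw [countGe]
    omega
  have hyx : y ≤ x := R.le_max' y hyR
  exact absurd hxw (not_lt.2 (hwy ▸ hyx))

end Counting

/-! ### From gaps of singular values to gaps of eigenvalue moduli. -/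

section SingularGap

open Module

lemma finrank_specSub_setOf_le_norm {E : Type*} [NormedAddCommGroup E] [NormedSpace ℂ E]
    [FiniteDimensional ℂ E] (T : End ℂ E) (x : ℝ) :
    finrank ℂ (specSub T {z | x ≤ ‖z‖}) = countGe T.charpoly.roots x := by
  rw [finrank_specSub, countGe]
  congr

lemma finrank_specSub_setOf_norm_le {E : Type*} [NormedAddCommGroup E] [NormedSpace ℂ E]
    [FiniteDimensional ℂ E] (T : End ℂ E) (x : ℝ) :
    finrank ℂ (specSub T {z | ‖z‖ ≤ x}) = countLe T.charpoly.roots x := by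
  rw [finrank_specSub, countLe]
  congr

lemma not_exp_le_const {c C ε : ℝ} (hc : 0 < c) (hε : 0 < ε)
    (h : ∀ k : ℕ, c * Real.exp (ε * k) ≤ C * Real.exp (ε / 2 * k)) : False := by
  have h1 : ∀ k : ℕ, Real.exp (ε / 2) ^ k ≤ C / c := by
    intro k
    rw [le_div_iff₀ hc, ← Real.exp_nat_mul]
    have h2 := h k
    have h3 : ε * k = ε / 2 * k + k * (ε / 2) := by ring
    rw [h3, Real.exp_add, ← mul_assoc, mul_right_comm] at h2
    have := le_of_mul_le_mul_right h2 (Real.exp_pos _)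
    linarith
  obtain ⟨k, hk⟩ := pow_unbounded_of_one_lt (C / c) (Real.one_lt_exp_iff.2 (half_pos hε))
  exact absurd (h1 k) (not_le.2 hk)

variable {E : Type*} [NormedAddCommGroup E] [InnerProductSpace ℂ E] [FiniteDimensional ℂ E]

/-- An exponential gap between consecutive singular values of the powers of `T` is impossible if the
powers grow slowly on a large subspace and fast on another one. -/
lemma not_gap_of_growth {T S : End ℂ E} (hST : S * T = 1) {r : ℕ} (hr : 1 ≤ r)
    (U W : Submodule ℂ E)
    (hU : finrank ℂ E + 1 ≤ r + finrank ℂ U) (hW : r + 1 ≤ finrank ℂ W)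
    {a b C D ε c : ℝ} (ha : 0 < a) (hb : 0 < b) (hC : 0 < C) (hD : 0 < D) (hε : 0 < ε) (hc : 0 < c)
    (hab : a * b ≤ Real.exp (ε / 2))
    (hTU : ∀ k : ℕ, ∀ w ∈ U, ‖(T ^ k) w‖ ≤ C * a ^ k * ‖w‖)
    (hWT : ∀ w ∈ W, T w ∈ W)
    (hSW : ∀ k : ℕ, ∀ w ∈ W, ‖(S ^ k) w‖ ≤ D * b ^ k * ‖w‖)
    (h : ∀ k : ℕ, c * Real.exp (ε * k) ≤
      LinearMap.singularValues (T ^ k) (r - 1) / LinearMap.singularValues (T ^ k) r) : False := by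
  refine not_exp_le_const (C := C * D) hc hε fun k => (h k).trans ?_
  have hrE : r < finrank ℂ E := lt_of_lt_of_le hW (Submodule.finrank_le W)
  have h1 : LinearMap.singularValues (T ^ k) (r - 1) ≤ C * a ^ k :=
    LinearMap.singularValues_le_of_norm_le _ (by positivity) (by omega) U (by omega) (hTU k)
  have hinv : ∀ k : ℕ, ∀ w ∈ W, (T ^ k) w ∈ W := by
    intro k
    induction k with
    | zero => intro w hw; simpa using hw
    | succ k ih => intro w hw; rw [pow_succ]; exact ih _ (hWT w hw)
  have h2 : (D * b ^ k)⁻¹ ≤ LinearMap.singularValues (T ^ k) r := by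
    refine LinearMap.le_singularValues_of_le_norm _ (by positivity) W hW fun w hw => ?_
    rw [inv_mul_le_iff₀ (by positivity)]
    simpa only [inverse_pow_apply hST] using hSW k _ (hinv k w hw)
  calc _ ≤ (C * a ^ k) / (D * b ^ k)⁻¹ := by gcongr
    _ = C * D * (a * b) ^ k := by rw [div_inv_eq_mul, mul_pow]; ring
    _ ≤ C * D * (Real.exp (ε / 2)) ^ k := by gcongr
    _ = _ := by rw [← Real.exp_nat_mul, mul_comm (k : ℝ)]

/-- If both counts were too large, the spectral subspaces for moduli at most `x` and at least `x`
would be large enough to bound the `r`-th singular value of `T ^ k` above and the next one below,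
both at rates close to `x ^ k`. The ratio would then grow too slowly. -/
lemma specSub_alternative {T S : End ℂ E} (hST : S * T = 1) (hTS : T * S = 1) {r : ℕ} (hr : 1 ≤ r)
    {ε c : ℝ} (hε : 0 < ε) (hc : 0 < c)
    (h : ∀ k : ℕ, c * Real.exp (ε * k) ≤
      LinearMap.singularValues (T ^ k) (r - 1) / LinearMap.singularValues (T ^ k) r)
    {x : ℝ} (hx : 0 < x) :
    countGe T.charpoly.roots x ≤ r ∨
      countLe T.charpoly.roots x ≤ finrank ℂ E - r := by
  classical
  by_contra! hcon
  -- Each of the two growth bounds loses `e^{ε/4}` per step, so the ratio grows at most like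
  -- `e^{εk/2}`, slower than the assumed gap.
  have he : 1 < Real.exp (ε / 4) := Real.one_lt_exp_iff.2 (by positivity)
  obtain ⟨C, hC, hCU⟩ := exists_norm_pow_apply_le_specSub T (s := {z | ‖z‖ ≤ x})
    (r' := x * Real.exp (ε / 4)) hx.le (lt_mul_of_one_lt_right hx he) fun μ hμ => hμ
  obtain ⟨D, hD, hDW⟩ := exists_norm_inverse_pow_apply_le_specSub hST hTS (s := {z | x ≤ ‖z‖})
    (r' := x⁻¹ * Real.exp (ε / 4)) hx (lt_mul_of_one_lt_right (inv_pos.2 hx) he) fun μ hμ => hμ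
  refine not_gap_of_growth hST hr _ _ ?_ ?_ (by positivity) (by positivity) hC hD hε hc ?_ hCU
    (fun w hw => specSub_invariant T _ hw) hDW h
  · rw [finrank_specSub_setOf_norm_le]
    omega
  · rw [finrank_specSub_setOf_le_norm]
    omega
  · rw [mul_mul_mul_comm, mul_inv_cancel₀ hx.ne', one_mul, ← Real.exp_add]
    apply le_of_eq
    congr 1
    ring

lemma specSub_alternative_inverse {T S : End ℂ E} (hST : S * T = 1) (hTS : T * S = 1) {r : ℕ}
    (hr : 1 ≤ r) {ε c : ℝ} (hε : 0 < ε) (hc : 0 < c)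
    (h : ∀ k : ℕ, c * Real.exp (ε * k) ≤
      LinearMap.singularValues (S ^ k) (r - 1) / LinearMap.singularValues (S ^ k) r)
    {x : ℝ} (hx : 0 < x) :
    countLe T.charpoly.roots x ≤ r ∨
      countGe T.charpoly.roots x ≤ finrank ℂ E - r := by
  classical
  by_contra! hcon
  have he : 1 < Real.exp (ε / 4) := Real.one_lt_exp_iff.2 (by positivity)
  obtain ⟨C, hC, hCU⟩ := exists_norm_pow_apply_le_specSub T (s := {z | ‖z‖ ≤ x})
    (r' := x * Real.exp (ε / 4)) hx.le (lt_mul_of_one_lt_right hx he) fun μ hμ => hμ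
  obtain ⟨D, hD, hDW⟩ := exists_norm_inverse_pow_apply_le_specSub hST hTS (s := {z | x ≤ ‖z‖})
    (r' := x⁻¹ * Real.exp (ε / 4)) hx (lt_mul_of_one_lt_right (inv_pos.2 hx) he) fun μ hμ => hμ
  refine not_gap_of_growth hTS hr _ _ ?_ ?_ (by positivity) (by positivity) hD hC hε hc ?_ hDW
    (fun w hw => inverse_mem_specSub hST _ hw) hCU h
  · rw [finrank_specSub_setOf_le_norm]
    omega
  · rw [finrank_specSub_setOf_norm_le]
    omega
  · rw [mul_mul_mul_comm, inv_mul_cancel₀ hx.ne', one_mul, ← Real.exp_add]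
    apply le_of_eq
    congr 1
    ring

lemma Matrix.roots_charpoly_ne_zero {n : ℕ} (g : Matrix.GeneralLinearGroup (Fin n) ℂ) :
    ∀ z ∈ (g : Matrix (Fin n) (Fin n) ℂ).charpoly.roots, z ≠ 0 := by
  rintro z hz rfl
  have h1 := Polynomial.isRoot_of_mem_roots hz
  have h2 : IsUnit (g : Matrix (Fin n) (Fin n) ℂ).det :=
    (Matrix.isUnit_iff_isUnit_det _).1 g.isUnit
  rw [Matrix.det_eq_sign_charpoly_coeff, Polynomial.coeff_zero_eq_eval_zero, h1.eq_zero,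
    mul_zero] at h2
  exact not_isUnit_zero h2

lemma Matrix.card_roots_charpoly {n : ℕ} (A : Matrix (Fin n) (Fin n) ℂ) :
    A.charpoly.roots.card = n := by
  rw [← (IsAlgClosed.splits A.charpoly).natDegree_eq_card_roots, Matrix.charpoly_natDegree_eq_dim,
    Fintype.card_fin]

lemma toEuclideanLin_mul {n : ℕ} (A B : Matrix (Fin n) (Fin n) ℂ) :
    Matrix.toEuclideanLin (A * B) =
      (Matrix.toEuclideanLin A * Matrix.toEuclideanLin B : End ℂ (EuclideanSpace ℂ (Fin n))) := by
  ext x : 1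
  simp [Matrix.toLpLin_apply]

lemma toEuclideanLin_one {n : ℕ} :
    Matrix.toEuclideanLin (1 : Matrix (Fin n) (Fin n) ℂ) =
      (1 : End ℂ (EuclideanSpace ℂ (Fin n))) := by
  ext x : 1
  simp

lemma toEuclideanLin_pow {n : ℕ} (A : Matrix (Fin n) (Fin n) ℂ) (k : ℕ) :
    Matrix.toEuclideanLin (A ^ k) =
      (Matrix.toEuclideanLin A ^ k : End ℂ (EuclideanSpace ℂ (Fin n))) := by
  induction k with
  | zero => simpa using toEuclideanLin_one
  | succ k ih => rw [pow_succ, pow_succ, toEuclideanLin_mul, ih]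

/-- An exponential singular value gap of the powers of `g` comes from a gap of eigenvalue moduli. -/
lemma exists_countGe_eq_of_gap {n j : ℕ} (g : Matrix.GeneralLinearGroup (Fin n) ℂ) (hj : 1 ≤ j)
    (hjn : j ≤ n - 1) {c ε : ℝ} (hc : 0 < c) (hε : 0 < ε)
    (h : ∀ k : ℕ, c * Real.exp (ε * k) ≤ sigma j (g ^ k) / sigma (j + 1) (g ^ k)) :
    ∃ x, countGe (g : Matrix (Fin n) (Fin n) ℂ).charpoly.roots x = j := by
  refine exists_countGe_eq (Matrix.roots_charpoly_ne_zero g) hj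
    (by rw [Matrix.card_roots_charpoly]; omega) fun x hx => ?_
  have := specSub_alternative
    (T := Matrix.toEuclideanLin (g : Matrix (Fin n) (Fin n) ℂ))
    (S := Matrix.toEuclideanLin (g⁻¹ : Matrix.GeneralLinearGroup (Fin n) ℂ).1)
    (by rw [← toEuclideanLin_mul, Units.inv_mul, toEuclideanLin_one])
    (by rw [← toEuclideanLin_mul, Units.mul_inv, toEuclideanLin_one]) hj hε hc
    (fun k => by simpa [sigma, toEuclideanLin_pow] using h k) hx
  rw [Matrix.charpoly_toEuclideanLin, finrank_euclideanSpace_fin] at this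
  rwa [Matrix.card_roots_charpoly]

/-- Inversion reverses the order of the moduli, so a gap of `g⁻¹` at `j` is one of `g` at `n - j`.
-/
lemma exists_countGe_eq_of_gap_inverse {n j : ℕ} (g : Matrix.GeneralLinearGroup (Fin n) ℂ)
    (hj : 1 ≤ j) (hjn : j ≤ n - 1) {c ε : ℝ} (hc : 0 < c) (hε : 0 < ε)
    (h : ∀ k : ℕ, c * Real.exp (ε * k) ≤ sigma j (g⁻¹ ^ k) / sigma (j + 1) (g⁻¹ ^ k)) :
    ∃ x, countGe (g : Matrix (Fin n) (Fin n) ℂ).charpoly.roots x = n - j := by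
  refine exists_countGe_eq (Matrix.roots_charpoly_ne_zero g) (by omega)
    (by rw [Matrix.card_roots_charpoly]; omega) fun x hx => ?_
  have := specSub_alternative_inverse
    (T := Matrix.toEuclideanLin (g : Matrix (Fin n) (Fin n) ℂ))
    (S := Matrix.toEuclideanLin (g⁻¹ : Matrix.GeneralLinearGroup (Fin n) ℂ).1)
    (by rw [← toEuclideanLin_mul, Units.inv_mul, toEuclideanLin_one])
    (by rw [← toEuclideanLin_mul, Units.mul_inv, toEuclideanLin_one]) hj hε hc
    (fun k => by simpa only [sigma, Units.val_pow_eq_pow_val, toEuclideanLin_pow,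
      Nat.add_sub_cancel] using h k) hx
  rw [Matrix.charpoly_toEuclideanLin, finrank_euclideanSpace_fin] at this
  rw [Matrix.card_roots_charpoly]
  have h2 : n - (n - j) = j := by omega
  rw [h2]
  exact this.symm

end SingularGap

/-! ### Invariant cones for perturbed block maps. -/

section Cone

open Module

/-- Restriction of a vector to the coordinates in `s`. -/
noncomputable def coordProj {ι : Type*} (s : Set ι) : (ι → ℂ) →ₗ[ℂ] (ι → ℂ) := by
  classical exact
  { toFun := fun x i => if i ∈ s then x i else 0
    map_add' := fun x y => by ext i; by_cases h : i ∈ s <;> simp [h]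
    map_smul' := fun c x => by ext i; by_cases h : i ∈ s <;> simp [h] }

lemma coordProj_apply_of_mem {ι : Type*} {s : Set ι} (x : ι → ℂ) {i : ι} (h : i ∈ s) :
    coordProj s x i = x i := by simp [coordProj, h]

lemma coordProj_apply_of_notMem {ι : Type*} {s : Set ι} (x : ι → ℂ) {i : ι} (h : i ∉ s) :
    coordProj s x i = 0 := by simp [coordProj, h]

lemma coordProj_add_compl {ι : Type*} (s : Set ι) (x : ι → ℂ) :
    coordProj s x + coordProj sᶜ x = x := by
  ext i
  by_cases h : i ∈ s
  · simp [coordProj, h]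
  · simp [coordProj, h]

variable {ι : Type*} [Fintype ι]

lemma norm_coordProj_le (s : Set ι) (x : ι → ℂ) : ‖coordProj s x‖ ≤ ‖x‖ := by
  refine (pi_norm_le_iff_of_nonneg (norm_nonneg _)).2 fun i => ?_
  by_cases h : i ∈ s
  · rw [coordProj_apply_of_mem x h]; exact norm_le_pi_norm x i
  · rw [coordProj_apply_of_notMem x h]; simp

lemma finrank_le_of_vanishing (s : Finset ι) (W : Submodule ℂ (ι → ℂ))
    (h : ∀ w ∈ W, (∀ i ∈ s, w i = 0) → w = 0) : finrank ℂ W ≤ s.card := by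
  let f : W →ₗ[ℂ] (s → ℂ) := (LinearMap.funLeft ℂ ℂ (Subtype.val : s → ι)).comp W.subtype
  have hf : Function.Injective f := by
    rw [← LinearMap.ker_eq_bot, LinearMap.ker_eq_bot']
    intro w hw
    exact Subtype.ext (h w w.2 fun i hi => congrFun hw ⟨i, hi⟩)
  have := LinearMap.finrank_le_finrank_of_injective hf
  simpa using this

/-- A perturbation of a map that expands the coordinates in `s` more than the others expands
the vectors supported on `s` under iteration. -/
lemma norm_pow_ge_of_cone {T T₀ : End ℂ (ι → ℂ)} {s : Set ι} {α β δ : ℝ}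
    (hδ : ∀ x, ‖T x - T₀ x‖ ≤ δ * ‖x‖)
    (hcomm : ∀ x, coordProj s (T₀ x) = T₀ (coordProj s x))
    (hcomm' : ∀ x, coordProj sᶜ (T₀ x) = T₀ (coordProj sᶜ x))
    (hα : ∀ x, α * ‖coordProj s x‖ ≤ ‖T₀ (coordProj s x)‖)
    (hβ : ∀ x, ‖T₀ (coordProj sᶜ x)‖ ≤ β * ‖coordProj sᶜ x‖)
    (hβ0 : 0 ≤ β) (hδ0 : 0 ≤ δ) (hαβ : β + 4 * δ ≤ α) (x : ι → ℂ) (hx : coordProj sᶜ x = 0)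
    (k : ℕ) : (α - 2 * δ) ^ k * ‖x‖ ≤ ‖(T ^ k) x‖ := by
  -- The cone of vectors dominated by their `s`-part is invariant: the complementary part grows by
  -- at most `β + 2δ`, the `s`-part by at least `α - 2δ`, and `β + 4δ ≤ α`.
  have step : ∀ y, ‖coordProj sᶜ y‖ ≤ ‖coordProj s y‖ →
      ‖coordProj sᶜ (T y)‖ ≤ ‖coordProj s (T y)‖ ∧
        (α - 2 * δ) * ‖coordProj s y‖ ≤ ‖coordProj s (T y)‖ := by
    intro y hy
    have hny : ‖y‖ ≤ 2 * ‖coordProj s y‖ := by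
      calc ‖y‖ = ‖coordProj s y + coordProj sᶜ y‖ := by rw [coordProj_add_compl]
        _ ≤ ‖coordProj s y‖ + ‖coordProj sᶜ y‖ := norm_add_le _ _
        _ ≤ _ := by linarith
    have hd : ‖T y - T₀ y‖ ≤ 2 * δ * ‖coordProj s y‖ := by
      calc _ ≤ δ * ‖y‖ := hδ y
        _ ≤ δ * (2 * ‖coordProj s y‖) := by gcongr
        _ = _ := by ring
    have hT : T y = T₀ y + (T y - T₀ y) := by abel
    have h1 : (α - 2 * δ) * ‖coordProj s y‖ ≤ ‖coordProj s (T y)‖ := by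
      have e : coordProj s (T y) = T₀ (coordProj s y) - (-coordProj s (T y - T₀ y)) := by
        rw [map_sub, hcomm]; abel
      rw [e]
      have e1 := norm_sub_norm_le (T₀ (coordProj s y)) (-coordProj s (T y - T₀ y))
      rw [norm_neg] at e1
      have e2 := (norm_coordProj_le s (T y - T₀ y)).trans hd
      have e3 := hα y
      linarith
    refine ⟨?_, h1⟩
    have e : coordProj sᶜ (T y) = T₀ (coordProj sᶜ y) + coordProj sᶜ (T y - T₀ y) := by
      rw [map_sub, hcomm']; abel
    have h2 : ‖coordProj sᶜ (T y)‖ ≤ (β + 2 * δ) * ‖coordProj s y‖ := by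
      rw [e]
      calc _ ≤ ‖T₀ (coordProj sᶜ y)‖ + ‖coordProj sᶜ (T y - T₀ y)‖ := norm_add_le _ _
        _ ≤ β * ‖coordProj s y‖ + 2 * δ * ‖coordProj s y‖ := by
          refine add_le_add ((hβ y).trans ?_) ((norm_coordProj_le _ _).trans hd)
          gcongr
        _ = _ := by ring
    refine h2.trans (le_trans ?_ h1)
    gcongr
    linarith
  have hxs : coordProj s x = x := by
    have := coordProj_add_compl s x
    rwa [hx, add_zero] at this
  have main : ∀ k : ℕ, ‖coordProj sᶜ ((T ^ k) x)‖ ≤ ‖coordProj s ((T ^ k) x)‖ ∧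
      (α - 2 * δ) ^ k * ‖x‖ ≤ ‖coordProj s ((T ^ k) x)‖ := by
    intro k
    induction k with
    | zero => simp [hx, hxs]
    | succ k ih =>
      have := step _ ih.1
      rw [pow_succ', pow_succ']
      refine ⟨this.1, ?_⟩
      calc _ = (α - 2 * δ) * ((α - 2 * δ) ^ k * ‖x‖) := by ring
        _ ≤ (α - 2 * δ) * ‖coordProj s ((T ^ k) x)‖ := by
          refine mul_le_mul_of_nonneg_left ih.2 (by linarith)
        _ ≤ _ := this.2
  exact (main k).2.trans (norm_coordProj_le _ _)

lemma eq_zero_of_pow_le {a b C x : ℝ} (hb : 0 < b) (hba : b < a) (hx : 0 ≤ x)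
    (h : ∀ k : ℕ, a ^ k * x ≤ C * b ^ k * x) : x = 0 := by
  by_contra hx0
  have hx' : 0 < x := lt_of_le_of_ne hx (Ne.symm hx0)
  obtain ⟨k, hk⟩ := pow_unbounded_of_one_lt C ((one_lt_div hb).2 hba)
  have h1 := le_of_mul_le_mul_right (h k) hx'
  rw [div_pow, lt_div_iff₀ (by positivity)] at hk
  linarith

/-- A subspace on which the powers grow slowly meets trivially the coordinate subspace on which they
grow fast. -/
lemma finrank_le_of_cone [DecidableEq ι] {T T₀ : End ℂ (ι → ℂ)} {s : Finset ι} {α β δ r C : ℝ}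
    (hδ : ∀ x, ‖T x - T₀ x‖ ≤ δ * ‖x‖)
    (hcomm : ∀ x, coordProj s (T₀ x) = T₀ (coordProj s x))
    (hα : ∀ x, (∀ i ∉ s, x i = 0) → α * ‖x‖ ≤ ‖T₀ x‖)
    (hβ : ∀ x, (∀ i ∈ s, x i = 0) → ‖T₀ x‖ ≤ β * ‖x‖)
    (hβ0 : 0 ≤ β) (hδ0 : 0 ≤ δ) (hαβ : β + 4 * δ ≤ α) (hr : 0 < r) (hrα : r < α - 2 * δ)
    (W : Submodule ℂ (ι → ℂ)) (hW : ∀ k : ℕ, ∀ w ∈ W, ‖(T ^ k) w‖ ≤ C * r ^ k * ‖w‖) :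
    finrank ℂ W ≤ (sᶜ).card := by
  refine finrank_le_of_vanishing _ _ fun w hw hs => ?_
  have hcomm' : ∀ x, coordProj (s : Set ι)ᶜ (T₀ x) = T₀ (coordProj (s : Set ι)ᶜ x) := by
    intro x
    have h1 := coordProj_add_compl (s : Set ι) (T₀ x)
    have h2 := congrArg T₀ (coordProj_add_compl (s : Set ι) x)
    rw [map_add, ← hcomm] at h2
    exact add_left_cancel (h1.trans h2.symm)
  refine norm_eq_zero.1 (eq_zero_of_pow_le hr hrα (norm_nonneg w) (C := C) fun k => ?_)
  refine (norm_pow_ge_of_cone (s := s) hδ hcomm hcomm' ?_ ?_ hβ0 hδ0 hαβ w ?_ k).trans (hW k w hw)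
  · intro x
    refine hα _ fun i hi => coordProj_apply_of_notMem x hi
  · intro x
    refine hβ _ fun i hi => coordProj_apply_of_notMem x (by simpa using hi)
  · ext i
    by_cases hi : i ∈ s
    · exact coordProj_apply_of_notMem w (by simpa using hi)
    · rw [coordProj_apply_of_mem w (by simpa using hi), hs i (by simpa using hi)]
      rfl

end Cone

/-! ### The model matrices and their action on coordinates. -/

section StdMatrix

/-- The coordinates of `ℝ^(d+m+1)`, split as `d + m + 1`. -/
abbrev BlockIdx (d : ℕ) (M : Type) : Type := Fin d ⊕ (M ⊕ Unit)

/-- The block diagonal matrix with blocks `α`, `N`, `β`. -/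
def blockMat {M : Type} [DecidableEq M] {R : Type*} [Ring R] (d : ℕ) (α : R)
    (N : Matrix M M R) (β : R) : Matrix (BlockIdx d M) (BlockIdx d M) R :=
  Matrix.fromBlocks (α • 1) 0 0 (Matrix.fromBlocks N 0 0 (β • 1))

/-- The coordinates of a space that is the sum of `b` planes and `s` lines. -/
abbrev RotIdx (b s : ℕ) : Type := (Fin b ⊕ Fin b) ⊕ Fin s

/-- The operator that is `ε` times a complex structure on `b` planes and the scalar `κ` on `s`
lines. -/
def rotMat (b s : ℕ) (ε κ : ℝ) : Matrix (RotIdx b s) (RotIdx b s) ℝ :=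
  Matrix.fromBlocks (Matrix.fromBlocks 0 (-ε • 1) (ε • 1) 0) 0 0 (κ • 1)

/-- The block diagonal matrix with a scalar block of size `e`, a rotation by a right angle in `b`
planes, a scalar `κ` of size `s`, and a last entry `β`. -/
noncomputable def stdMat (e b s : ℕ) (α ε κ β : ℝ) :
    Matrix (BlockIdx e (RotIdx b s)) (BlockIdx e (RotIdx b s)) ℝ :=
  blockMat e α (rotMat b s ε κ) β

variable {e b s : ℕ} (α ε κ β : ℝ) (x : BlockIdx e (RotIdx b s) → ℂ)

/-- The operator on `ℂ^n` of a real matrix. -/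
noncomputable def cLin {ι : Type*} [Fintype ι] (A : Matrix ι ι ℝ) :
    Module.End ℂ (ι → ℂ) := (A.map Complex.ofReal).mulVecLin

lemma cLin_stdMat_top (i : Fin e) :
    cLin (stdMat e b s α ε κ β) x (.inl i) = α * x (.inl i) := by
  simp [cLin, Matrix.mulVec, dotProduct, stdMat, blockMat, Matrix.one_apply, apply_ite Complex.ofReal]

lemma cLin_stdMat_rot_inl (i : Fin b) :
    cLin (stdMat e b s α ε κ β) x (.inr (.inl (.inl (.inl i)))) =
      -ε * x (.inr (.inl (.inl (.inr i)))) := by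
  simp [cLin, Matrix.mulVec, dotProduct, stdMat, blockMat, rotMat, Matrix.one_apply,
    apply_ite Complex.ofReal]

lemma cLin_stdMat_rot_inr (i : Fin b) :
    cLin (stdMat e b s α ε κ β) x (.inr (.inl (.inl (.inr i)))) =
      ε * x (.inr (.inl (.inl (.inl i)))) := by
  simp [cLin, Matrix.mulVec, dotProduct, stdMat, blockMat, rotMat, Matrix.one_apply,
    apply_ite Complex.ofReal]

lemma cLin_stdMat_mid (i : Fin s) :
    cLin (stdMat e b s α ε κ β) x (.inr (.inl (.inr i))) = κ * x (.inr (.inl (.inr i))) := by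
  simp [cLin, Matrix.mulVec, dotProduct, stdMat, blockMat, rotMat, Matrix.one_apply,
    apply_ite Complex.ofReal]

lemma cLin_stdMat_bot (i : Unit) :
    cLin (stdMat e b s α ε κ β) x (.inr (.inr i)) = β * x (.inr (.inr i)) := by
  simp [cLin, Matrix.mulVec, dotProduct, stdMat, blockMat]

lemma stdMat_mul_inv (hα : α ≠ 0) :
    stdMat e b s α 1 (1 / 2) α⁻¹ * stdMat e b s α⁻¹ (-1) 2 α = 1 := by
  simp [stdMat, blockMat, rotMat, Matrix.fromBlocks_multiply, hα, ← Matrix.fromBlocks_one]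

end StdMatrix

/-! ### Location of the spectrum near the model, and parity. -/

section NearStd

open Module

lemma BlockIdx.rot_cases {e b s : ℕ} {p : BlockIdx e (RotIdx b s) → Prop}
    (h1 : ∀ i, p (.inl i)) (h2 : ∀ i, p (.inr (.inl (.inl (.inl i)))))
    (h3 : ∀ i, p (.inr (.inl (.inl (.inr i))))) (h4 : ∀ i, p (.inr (.inl (.inr i))))
    (h5 : p (.inr (.inr ()))) : ∀ i, p i := by
  rintro (i | ((i | i) | i) | ⟨⟩)
  exacts [h1 i, h2 i, h3 i, h4 i, h5]

/-- The coordinates of the first block. -/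
def topSet (e b s : ℕ) : Finset (BlockIdx e (RotIdx b s)) := Finset.univ.disjSum ∅

/-- The coordinates of the last two blocks. -/
def tailSet (e b s : ℕ) : Finset (BlockIdx e (RotIdx b s)) :=
  Finset.disjSum ∅ ((Finset.disjSum ∅ Finset.univ).disjSum Finset.univ)

lemma card_topSet (e b s : ℕ) : (topSet e b s).card = e := by
  simp [topSet]

lemma card_tailSet (e b s : ℕ) : (tailSet e b s).card = s + 1 := by
  simp [tailSet]

lemma card_blockIdx_rotIdx (e b s : ℕ) :
    Fintype.card (BlockIdx e (RotIdx b s)) = e + 2 * b + s + 1 := by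
  simp
  ring

variable {e b s : ℕ}

lemma coordProj_topSet_comm (a ε κ β : ℝ) (x : BlockIdx e (RotIdx b s) → ℂ) :
    coordProj (topSet e b s) (cLin (stdMat e b s a ε κ β) x) =
      cLin (stdMat e b s a ε κ β) (coordProj (topSet e b s) x) := by
  funext i
  revert i
  apply BlockIdx.rot_cases <;> intros <;>
    simp [coordProj, topSet, cLin_stdMat_top, cLin_stdMat_rot_inl, cLin_stdMat_rot_inr,
      cLin_stdMat_mid, cLin_stdMat_bot]

lemma coordProj_tailSet_comm (a ε κ β : ℝ) (x : BlockIdx e (RotIdx b s) → ℂ) :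
    coordProj (tailSet e b s) (cLin (stdMat e b s a ε κ β) x) =
      cLin (stdMat e b s a ε κ β) (coordProj (tailSet e b s) x) := by
  funext i
  revert i
  apply BlockIdx.rot_cases <;> intros <;>
    simp [coordProj, tailSet, cLin_stdMat_top, cLin_stdMat_rot_inl, cLin_stdMat_rot_inr,
      cLin_stdMat_mid, cLin_stdMat_bot]

lemma coordProj_compl_comm {ι : Type*} [Fintype ι] [DecidableEq ι] {T : End ℂ (ι → ℂ)}
    {t : Finset ι} (h : ∀ x, coordProj t (T x) = T (coordProj t x)) (x : ι → ℂ) :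
    coordProj (tᶜ : Finset ι) (T x) = T (coordProj (tᶜ : Finset ι) x) := by
  have h1 := coordProj_add_compl (t : Set ι) (T x)
  have h2 := congrArg T (coordProj_add_compl (t : Set ι) x)
  rw [map_add, ← h] at h2
  rw [Finset.coe_compl]
  exact add_left_cancel (h1.trans h2.symm)

lemma norm_ge_of_forall_exists {ι : Type*} [Fintype ι] {x y : ι → ℂ} {c : ℝ} (hc : 0 < c)
    (h : ∀ i, ∃ j, c * ‖x i‖ ≤ ‖y j‖) : c * ‖x‖ ≤ ‖y‖ := by
  rw [mul_comm, ← le_div_iff₀ hc]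
  refine (pi_norm_le_iff_of_nonneg (by positivity)).2 fun i => ?_
  obtain ⟨j, hj⟩ := h i
  rw [le_div_iff₀ hc, mul_comm]
  exact hj.trans (norm_le_pi_norm y j)

lemma cLin_stdMat_norm_ge {a ε κ β c : ℝ} (hc : 0 < c) (hε : |ε| = 1)
    {x : BlockIdx e (RotIdx b s) → ℂ}
    (h1 : (∀ i, x (.inl i) = 0) ∨ c ≤ |a|)
    (h2 : (∀ i, x (.inr (.inl (.inl i))) = 0) ∨ c ≤ 1)
    (h3 : (∀ i, x (.inr (.inl (.inr i))) = 0) ∨ c ≤ |κ|)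
    (h4 : x (.inr (.inr ())) = 0 ∨ c ≤ |β|) :
    c * ‖x‖ ≤ ‖cLin (stdMat e b s a ε κ β) x‖ := by
  refine norm_ge_of_forall_exists hc (BlockIdx.rot_cases ?_ ?_ ?_ ?_ ?_)
  · intro i
    refine ⟨.inl i, ?_⟩
    rw [cLin_stdMat_top, norm_mul, Complex.norm_real, Real.norm_eq_abs]
    rcases h1 with h | h
    · simp [h]
    · gcongr
  · intro i
    refine ⟨.inr (.inl (.inl (.inr i))), ?_⟩
    rw [cLin_stdMat_rot_inr, norm_mul, Complex.norm_real, Real.norm_eq_abs, hε]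
    rcases h2 with h | h
    · simp [h]
    · gcongr
  · intro i
    refine ⟨.inr (.inl (.inl (.inl i))), ?_⟩
    rw [cLin_stdMat_rot_inl, norm_mul, norm_neg, Complex.norm_real, Real.norm_eq_abs, hε]
    rcases h2 with h | h
    · simp [h]
    · gcongr
  · intro i
    refine ⟨.inr (.inl (.inr i)), ?_⟩
    rw [cLin_stdMat_mid, norm_mul, Complex.norm_real, Real.norm_eq_abs]
    rcases h3 with h | h
    · simp [h]
    · gcongr
  · refine ⟨.inr (.inr ()), ?_⟩
    rw [cLin_stdMat_bot, norm_mul, Complex.norm_real, Real.norm_eq_abs]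
    rcases h4 with h | h
    · simp [h]
    · gcongr

lemma cLin_stdMat_norm_le {a ε κ β c : ℝ} (hc : 0 ≤ c) (hε : |ε| = 1)
    {x : BlockIdx e (RotIdx b s) → ℂ}
    (h1 : (∀ i, x (.inl i) = 0) ∨ |a| ≤ c)
    (h2 : (∀ i, x (.inr (.inl (.inl i))) = 0) ∨ 1 ≤ c)
    (h3 : (∀ i, x (.inr (.inl (.inr i))) = 0) ∨ |κ| ≤ c)
    (h4 : x (.inr (.inr ())) = 0 ∨ |β| ≤ c) :
    ‖cLin (stdMat e b s a ε κ β) x‖ ≤ c * ‖x‖ := by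
  have key : ∀ (r : ℝ) (i), x i = 0 ∨ |r| ≤ c → ‖(r : ℂ) * x i‖ ≤ c * ‖x‖ := by
    rintro r i (h | h)
    · rw [h]; simp; positivity
    · rw [norm_mul, Complex.norm_real, Real.norm_eq_abs]
      exact mul_le_mul h (norm_le_pi_norm x i) (norm_nonneg _) hc
  refine (pi_norm_le_iff_of_nonneg (by positivity)).2 (BlockIdx.rot_cases ?_ ?_ ?_ ?_ ?_)
  · intro i
    rw [cLin_stdMat_top]
    exact key _ _ (h1.imp_left fun h => h i)
  · intro i
    rw [cLin_stdMat_rot_inl, neg_mul, norm_neg]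
    exact key _ _ (by rw [hε]; exact h2.imp_left fun h => h _)
  · intro i
    rw [cLin_stdMat_rot_inr]
    exact key _ _ (by rw [hε]; exact h2.imp_left fun h => h _)
  · intro i
    rw [cLin_stdMat_mid]
    exact key _ _ (h3.imp_left fun h => h i)
  · rw [cLin_stdMat_bot]
    exact key _ _ h4

lemma vanish_of_notMem_topSet {x : BlockIdx e (RotIdx b s) → ℂ}
    (h : ∀ i ∉ topSet e b s, x i = 0) (i : RotIdx b s ⊕ Unit) : x (.inr i) = 0 :=
  h _ (by simp [topSet])

lemma vanish_of_mem_topSet {x : BlockIdx e (RotIdx b s) → ℂ}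
    (h : ∀ i ∈ topSet e b s, x i = 0) (i : Fin e) : x (.inl i) = 0 :=
  h _ (by simp [topSet])

/-- This and the next three lemmas together put exactly `e` eigenvalues outside the circle of radius
`2`, exactly `2b` between radii `7/10` and `2`, and the rest inside. Cone estimates for the map and
its inverse replace continuity of eigenvalues, so the tolerance `1/100` is explicit and does not
depend on `α`. -/
lemma countLe_two_of_near {T : End ℂ (BlockIdx e (RotIdx b s) → ℂ)} {α : ℝ} (hα : 4 ≤ α)
    (hT : ∀ x, ‖T x - cLin (stdMat e b s α 1 (1 / 2) α⁻¹) x‖ ≤ 1 / 100 * ‖x‖) :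
    countLe T.charpoly.roots 2 ≤ 2 * b + s + 1 := by
  have hα' : α⁻¹ ≤ 1 / 4 := by rw [one_div]; exact inv_anti₀ (by norm_num) hα
  have hα0 : 0 ≤ α⁻¹ := inv_nonneg.2 (by linarith)
  -- Any rate between `2` and the cone expansion `4 - 2/100` separates the two growth regimes; the
  -- rates in the next lemmas are chosen in the same way.
  obtain ⟨C, -, hC⟩ := exists_norm_pow_apply_le_specSub T (s := {z | ‖z‖ ≤ 2}) (r' := 5 / 2)
    (by norm_num) (by norm_num) fun μ hμ => hμ
  have := finrank_le_of_cone (s := topSet e b s) (α := 4) (β := 1) hT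
    (coordProj_topSet_comm α 1 (1 / 2) α⁻¹)
    (fun x hx => cLin_stdMat_norm_ge (by norm_num) (by simp) (Or.inr (hα.trans (le_abs_self _)))
      (Or.inl fun _ => vanish_of_notMem_topSet hx _) (Or.inl fun _ => vanish_of_notMem_topSet hx _)
      (Or.inl (vanish_of_notMem_topSet hx _)))
    (fun x hx => cLin_stdMat_norm_le (by norm_num) (by simp)
      (Or.inl fun _ => vanish_of_mem_topSet hx _)
      (Or.inr le_rfl) (Or.inr (by norm_num [abs_le])) (Or.inr (by rw [abs_of_nonneg hα0]; linarith)))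
    (by norm_num) (by norm_num) (by norm_num) (by norm_num) (by norm_num) _ hC
  rw [finrank_specSub_setOf_norm_le, Finset.card_compl, card_topSet, card_blockIdx_rotIdx] at this
  omega

lemma countGe_two_of_near {T S : End ℂ (BlockIdx e (RotIdx b s) → ℂ)} {α : ℝ} (hα : 4 ≤ α)
    (hST : S * T = 1) (hTS : T * S = 1)
    (hS : ∀ x, ‖S x - cLin (stdMat e b s α⁻¹ (-1) 2 α) x‖ ≤ 1 / 100 * ‖x‖) :
    countGe T.charpoly.roots 2 ≤ e := by
  have hα' : α⁻¹ ≤ 1 / 4 := by rw [one_div]; exact inv_anti₀ (by norm_num) hα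
  have hα0 : 0 ≤ α⁻¹ := inv_nonneg.2 (by linarith)
  obtain ⟨C, -, hC⟩ := exists_norm_inverse_pow_apply_le_specSub hST hTS (s := {z | 2 ≤ ‖z‖})
    (r' := 3 / 5) (by norm_num) (by norm_num) fun μ hμ => hμ
  have := finrank_le_of_cone (s := (topSet e b s)ᶜ) (α := 1) (β := 1 / 4) hS
    (coordProj_compl_comm (coordProj_topSet_comm α⁻¹ (-1) 2 α))
    (fun x hx => by
      simp only [Finset.mem_compl, not_not] at hx
      exact cLin_stdMat_norm_ge (by norm_num) (by simp) (Or.inl fun _ => vanish_of_mem_topSet hx _)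
        (Or.inr le_rfl) (Or.inr (by norm_num))
        (Or.inr (by rw [abs_of_nonneg (by linarith)]; linarith)))
    (fun x hx => by
      simp only [Finset.mem_compl] at hx
      exact cLin_stdMat_norm_le (by norm_num) (by simp)
        (Or.inr (by rwa [abs_of_nonneg hα0])) (Or.inl fun _ => vanish_of_notMem_topSet hx _)
        (Or.inl fun _ => vanish_of_notMem_topSet hx _)
        (Or.inl (vanish_of_notMem_topSet hx _)))
    (by norm_num) (by norm_num) (by norm_num) (by norm_num) (by norm_num) _ hC
  rwa [finrank_specSub_setOf_le_norm, compl_compl, card_topSet] at this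

lemma countGe_of_near {T S : End ℂ (BlockIdx e (RotIdx b s) → ℂ)} {α : ℝ} (hα : 4 ≤ α)
    (hST : S * T = 1) (hTS : T * S = 1)
    (hS : ∀ x, ‖S x - cLin (stdMat e b s α⁻¹ (-1) 2 α) x‖ ≤ 1 / 100 * ‖x‖) :
    countGe T.charpoly.roots (7 / 10) ≤ e + 2 * b := by
  have hα' : α⁻¹ ≤ 1 / 4 := by rw [one_div]; exact inv_anti₀ (by norm_num) hα
  have hα0 : 0 ≤ α⁻¹ := inv_nonneg.2 (by linarith)
  obtain ⟨C, -, hC⟩ := exists_norm_inverse_pow_apply_le_specSub hST hTS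
    (s := {z | (7 / 10 : ℝ) ≤ ‖z‖}) (r' := 3 / 2) (by norm_num) (by norm_num) fun μ hμ => hμ
  have := finrank_le_of_cone (s := tailSet e b s) (α := 2) (β := 1) hS
    (coordProj_tailSet_comm α⁻¹ (-1) 2 α)
    (fun x hx => cLin_stdMat_norm_ge (by norm_num) (by simp)
      (Or.inl fun _ => hx _ (by simp [tailSet])) (Or.inl fun _ => hx _ (by simp [tailSet]))
      (Or.inr (by norm_num)) (Or.inr (by rw [abs_of_nonneg (by linarith)]; linarith)))
    (fun x hx => cLin_stdMat_norm_le (by norm_num) (by simp)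
      (Or.inr (by rw [abs_of_nonneg hα0]; linarith)) (Or.inr le_rfl)
      (Or.inl fun _ => hx _ (by simp [tailSet])) (Or.inl (hx _ (by simp [tailSet]))))
    (by norm_num) (by norm_num) (by norm_num) (by norm_num) (by norm_num) _ hC
  rw [finrank_specSub_setOf_le_norm, Finset.card_compl, card_tailSet, card_blockIdx_rotIdx] at this
  omega

lemma countLe_of_near {T : End ℂ (BlockIdx e (RotIdx b s) → ℂ)} {α : ℝ} (hα : 4 ≤ α)
    (hT : ∀ x, ‖T x - cLin (stdMat e b s α 1 (1 / 2) α⁻¹) x‖ ≤ 1 / 100 * ‖x‖) :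
    countLe T.charpoly.roots (7 / 10) ≤ s + 1 := by
  have hα' : α⁻¹ ≤ 1 / 4 := by rw [one_div]; exact inv_anti₀ (by norm_num) hα
  have hα0 : 0 ≤ α⁻¹ := inv_nonneg.2 (by linarith)
  obtain ⟨C, -, hC⟩ := exists_norm_pow_apply_le_specSub T (s := {z | ‖z‖ ≤ 7 / 10}) (r' := 4 / 5)
    (by norm_num) (by norm_num) fun μ hμ => hμ
  have := finrank_le_of_cone (s := (tailSet e b s)ᶜ) (α := 1) (β := 1 / 2) hT
    (coordProj_compl_comm (coordProj_tailSet_comm α 1 (1 / 2) α⁻¹))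
    (fun x hx => by
      simp only [Finset.mem_compl, not_not] at hx
      exact cLin_stdMat_norm_ge (by norm_num) (by simp)
        (Or.inr (by rw [abs_of_nonneg (by linarith)]; linarith)) (Or.inr le_rfl)
        (Or.inl fun _ => hx _ (by simp [tailSet])) (Or.inl (hx _ (by simp [tailSet]))))
    (fun x hx => by
      simp only [Finset.mem_compl] at hx
      exact cLin_stdMat_norm_le (by norm_num) (by simp)
        (Or.inl fun _ => hx _ (by simp [tailSet])) (Or.inl fun _ => hx _ (by simp [tailSet]))
        (Or.inr (by norm_num [abs_le])) (Or.inr (by rw [abs_of_nonneg hα0]; linarith)))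
    (by norm_num) (by norm_num) (by norm_num) (by norm_num) (by norm_num) _ hC
  rwa [finrank_specSub_setOf_norm_le, compl_compl, card_tailSet] at this

/-- The rotation blocks of `stdMat` have no real eigenvalues, quantitatively. -/
lemma norm_stdMat_sub_real_ge {α μ : ℝ} (hα : 4 ≤ α) (hμ1 : 7 / 10 ≤ |μ|) (hμ2 : |μ| ≤ 2)
    (x : BlockIdx e (RotIdx b s) → ℂ) :
    1 / 10 * ‖x‖ ≤ ‖cLin (stdMat e b s α 1 (1 / 2) α⁻¹) x - (μ : ℂ) • x‖ := by
  have hα' : α⁻¹ ≤ 1 / 4 := by rw [one_div]; exact inv_anti₀ (by norm_num) hα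
  have hα0 : 0 ≤ α⁻¹ := inv_nonneg.2 (by linarith)
  set y := cLin (stdMat e b s α 1 (1 / 2) α⁻¹) x - (μ : ℂ) • x with hy
  -- The diagonal entries `α ≥ 4`, `1/2` and `α⁻¹ ≤ 1/4` all stay at distance at least `1/10` from
  -- `μ`.
  have hsc : ∀ (r : ℝ) (i), y i = r * x i - μ * x i → 1 / 10 ≤ |r - μ| → 1 / 10 * ‖x i‖ ≤ ‖y‖ := by
    intro r i h1 h2
    refine le_trans ?_ (norm_le_pi_norm y i)
    rw [h1, ← sub_mul, norm_mul, ← Complex.ofReal_sub, Complex.norm_real, Real.norm_eq_abs]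
    gcongr
  -- On a rotation plane, eliminating the other coordinate leaves the factor `1 + μ²`, which is at
  -- least `1` for real `μ`.
  have hrot : ∀ z p q : ℂ, (1 + (μ : ℂ) ^ 2) * z = q - μ * p → ‖p‖ ≤ ‖y‖ → ‖q‖ ≤ ‖y‖ →
      1 / 10 * ‖z‖ ≤ ‖y‖ := by
    intro z p q h hp hq
    have h1 : ‖(1 + (μ : ℂ) ^ 2) * z‖ = (1 + μ ^ 2) * ‖z‖ := by
      rw [norm_mul, ← Complex.ofReal_pow, ← Complex.ofReal_one, ← Complex.ofReal_add,
        Complex.norm_real, Real.norm_of_nonneg (by positivity)]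
    have h2 : ‖q - μ * p‖ ≤ ‖y‖ + 2 * ‖y‖ := by
      refine (norm_sub_le _ _).trans (add_le_add hq ?_)
      rw [norm_mul, Complex.norm_real, Real.norm_eq_abs]
      gcongr
    rw [← h, h1] at h2
    nlinarith [norm_nonneg z, norm_nonneg y, mul_nonneg (sq_nonneg μ) (norm_nonneg z)]
  rcases abs_cases μ with ⟨hab, h0⟩ | ⟨hab, h0⟩ <;> rw [hab] at hμ1 hμ2
  all_goals
    have hmain : ∀ i, 1 / 10 * ‖x i‖ ≤ ‖y‖ := by
      refine BlockIdx.rot_cases ?_ ?_ ?_ ?_ ?_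
      · exact fun i => hsc α _ (by simp only [hy, Pi.sub_apply, Pi.smul_apply, cLin_stdMat_top,
          smul_eq_mul]) (by rw [le_abs]; left; linarith)
      · intro i
        refine hrot _ (y (.inr (.inl (.inl (.inl i))))) (y (.inr (.inl (.inl (.inr i))))) ?_
          (norm_le_pi_norm y _) (norm_le_pi_norm y _)
        simp only [hy, Pi.sub_apply, Pi.smul_apply, cLin_stdMat_rot_inl, cLin_stdMat_rot_inr,
          smul_eq_mul]
        push_cast
        ring
      · intro i
        refine hrot _ (y (.inr (.inl (.inl (.inr i))))) (-y (.inr (.inl (.inl (.inl i))))) ?_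
          (norm_le_pi_norm y _) (by rw [norm_neg]; exact norm_le_pi_norm y _)
        simp only [hy, Pi.sub_apply, Pi.smul_apply, cLin_stdMat_rot_inl, cLin_stdMat_rot_inr,
          smul_eq_mul]
        push_cast
        ring
      · exact fun i => hsc (1 / 2) _ (by simp only [hy, Pi.sub_apply, Pi.smul_apply,
          cLin_stdMat_mid, smul_eq_mul]) (by rw [le_abs]; first | (left; linarith) | (right; linarith))
      · exact hsc α⁻¹ _ (by simp only [hy, Pi.sub_apply, Pi.smul_apply, cLin_stdMat_bot,
          smul_eq_mul]) (by rw [le_abs]; first | (left; linarith) | (right; linarith))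
    rw [mul_comm, ← le_div_iff₀ (by norm_num)]
    refine (pi_norm_le_iff_of_nonneg (by positivity)).2 fun i => ?_
    have := hmain i
    linarith

/-- Conjugation matches the selected elements in the lower half plane with those in the upper one,
and none is real. -/
lemma even_card_filter_of_conj {M : Multiset ℂ} (hM : M.map (starRingEnd ℂ) = M)
    (p : ℂ → Prop) [DecidablePred p] (hp : ∀ z, p (starRingEnd ℂ z) ↔ p z)
    (hreal : ∀ z ∈ M, p z → z.im ≠ 0) : Even (M.filter p).card := by
  classical
  have h1 : (M.filter fun z => p z ∧ z.im < 0).card = (M.filter fun z => p z ∧ 0 < z.im).card := by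
    conv_lhs => rw [← hM, Multiset.filter_map, Multiset.card_map]
    congr 1
    refine Multiset.filter_congr fun z _ => ?_
    simp [hp]
  have h2 : M.filter p = (M.filter fun z => p z ∧ z.im < 0) + M.filter fun z => p z ∧ 0 < z.im := by
    rw [Multiset.filter_add_filter, (Multiset.filter_eq_nil (s := M) (p := fun a =>
      (p a ∧ a.im < 0) ∧ p a ∧ 0 < a.im)).2]
    · rw [add_zero]
      refine Multiset.filter_congr fun z hz => ?_
      constructor
      · intro h
        rcases lt_or_gt_of_ne (hreal z hz h) with h' | h'
        · exact Or.inl ⟨h, h'⟩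
        · exact Or.inr ⟨h, h'⟩
      · rintro (h | h) <;> exact h.1
    · rintro z - ⟨⟨_, h⟩, _, h'⟩
      exact absurd h (not_lt.2 h'.le)
  rw [h2, Multiset.card_add, h1]
  exact ⟨_, rfl⟩

lemma map_conj_roots_charpoly {ι : Type*} [Fintype ι] [DecidableEq ι] (A : Matrix ι ι ℝ) :
    (A.map Complex.ofReal).charpoly.roots.map (starRingEnd ℂ) =
      (A.map Complex.ofReal).charpoly.roots := by
  have h : (A.map Complex.ofReal).charpoly = A.charpoly.map Complex.ofRealHom :=
    A.charpoly_map Complex.ofRealHom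
  rw [← (IsAlgClosed.splits (A.map Complex.ofReal).charpoly).roots_map, h, Polynomial.map_map]
  congr 2
  ext x
  simp

lemma countGe_eq_add (M : Multiset ℂ) {x y : ℝ} (h : x ≤ y) :
    countGe M x = countGe M y + (M.filter fun z => x ≤ ‖z‖ ∧ ‖z‖ < y).card := by
  rw [countGe, countGe, ← Multiset.card_add]
  congr 1
  rw [Multiset.filter_add_filter, (Multiset.filter_eq_nil (s := M) (p := fun a =>
      y ≤ ‖a‖ ∧ x ≤ ‖a‖ ∧ ‖a‖ < y)).2, add_zero]
  · refine Multiset.filter_congr fun z _ => ?_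
    constructor
    · intro hz
      rcases le_or_gt y ‖z‖ with h' | h'
      · exact Or.inl h'
      · exact Or.inr ⟨hz, h'⟩
    · rintro (h' | h')
      · exact h.trans h'
      · exact h'.1
  · rintro z - ⟨h1, -, h2⟩
    exact absurd h1 (not_le.2 h2)

/-- A parity obstruction to gaps of eigenvalue moduli of a real matrix near `stdMat`. -/
theorem even_countGe_sub_of_near
    {A B : Matrix (BlockIdx e (RotIdx b s)) (BlockIdx e (RotIdx b s)) ℝ}
    (hAB : A * B = 1) {α : ℝ} (hα : 4 ≤ α)
    (hA : ∀ x, ‖cLin A x - cLin (stdMat e b s α 1 (1 / 2) α⁻¹) x‖ ≤ 1 / 100 * ‖x‖)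
    (hB : ∀ x, ‖cLin B x - cLin (stdMat e b s α⁻¹ (-1) 2 α) x‖ ≤ 1 / 100 * ‖x‖)
    {r : ℕ} {y : ℝ} (hy : countGe (A.map Complex.ofReal).charpoly.roots y = r)
    (hr : e < r) (hr' : r < e + 2 * b) : Even (r - e) := by
  have hBA : B * A = 1 := mul_eq_one_comm.1 hAB
  have hmul : ∀ {A B : Matrix (BlockIdx e (RotIdx b s)) (BlockIdx e (RotIdx b s)) ℝ}, A * B = 1 →
      cLin A * cLin B = 1 := by
    intro A B h
    have h2 : A.map Complex.ofReal * B.map Complex.ofReal = 1 := by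
      have := congrArg (Matrix.map · Complex.ofRealHom) h
      rw [Matrix.map_mul, Matrix.map_one _ (by simp) (by simp)] at this
      exact this
    rw [cLin, cLin, Module.End.mul_eq_comp, ← Matrix.mulVecLin_mul, h2, Matrix.mulVecLin_one]
    rfl
  have hTS := hmul hAB
  have hST := hmul hBA
  set M := (A.map Complex.ofReal).charpoly.roots with hM
  have hchar : (cLin A).charpoly.roots = M := by
    rw [hM, ← Matrix.charpoly_toLin' (A.map Complex.ofReal)]
    rfl
  have h1 := countLe_two_of_near hα hA
  have h2 := countGe_two_of_near hα hST hTS hB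
  have h3 := countGe_of_near hα hST hTS hB
  have h4 := countLe_of_near hα hA
  rw [hchar] at h1 h2 h3 h4
  have hcard : M.card = e + 2 * b + s + 1 := by
    rw [hM, ← (IsAlgClosed.splits (A.map Complex.ofReal).charpoly).natDegree_eq_card_roots,
      Matrix.charpoly_natDegree_eq_dim, card_blockIdx_rotIdx]
  have hlt : ∀ x : ℝ, (M.filter (x < ‖·‖)).card ≤ countGe M x := fun x =>
    Multiset.card_le_card (Multiset.monotone_filter_right M fun _ h => le_of_lt h)
  have h5 := countLe_add_card_filter_lt M 2
  have h6 := countLe_add_card_filter_lt M (7 / 10)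
  have h7 := hlt 2
  have h8 := hlt (7 / 10)
  -- At least `e + 2b` elements have modulus at least `7/10` and at most `e` have modulus at least
  -- `2`, so a level with `e < r < e + 2b` elements lies strictly between these radii.
  have hy2 : y < 2 := by
    by_contra! h
    have := countGe_anti M h
    omega
  have hy7 : 7 / 10 < y := by
    by_contra! h
    have := countGe_anti M h
    omega
  have h9 := countGe_eq_add M hy2.le
  have h10 : Even (M.filter fun z => y ≤ ‖z‖ ∧ ‖z‖ < 2).card := by
    refine even_card_filter_of_conj (map_conj_roots_charpoly A) _ (fun z => by simp) ?_
    rintro z hz ⟨hz1, hz2⟩ him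
    obtain ⟨μ, rfl⟩ : ∃ μ : ℝ, z = μ := ⟨z.re, by apply Complex.ext <;> simp [him]⟩
    rw [Complex.norm_real, Real.norm_eq_abs] at hz1 hz2
    have heig : End.HasEigenvalue (cLin A) (μ : ℂ) := by
      rw [Module.End.hasEigenvalue_iff_isRoot_charpoly]
      apply Polynomial.isRoot_of_mem_roots
      rwa [hchar]
    obtain ⟨x, hx⟩ := heig.exists_hasEigenvector
    -- A real eigenvalue here would make an eigenvector move by at least `1/10` and at most `1/100`
    -- of its norm.
    have e1 := norm_stdMat_sub_real_ge hα (hy7.le.trans hz1) hz2.le x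
    have e2 := hA x
    rw [hx.apply_eq_smul, norm_sub_rev] at e2
    have e3 := norm_pos_iff.2 hx.2
    linarith
  have : r - e = (M.filter fun z => y ≤ ‖z‖ ∧ ‖z‖ < 2).card := by omega
  rwa [this]

end NearStd

/-! ### Quasi-isometric embeddings from expanded vectors. -/

section SigmaRatio

open Module

lemma norm_toLp_le_sqrt_mul {n : ℕ} {𝕜 : Type*} [RCLike 𝕜] (v : Fin n → 𝕜) :
    ‖WithLp.toLp 2 v‖ ≤ Real.sqrt n * ‖v‖ := by
  rw [EuclideanSpace.norm_eq]
  refine Real.sqrt_le_iff.2 ⟨by positivity, ?_⟩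
  rw [mul_pow, Real.sq_sqrt (by positivity)]
  calc ∑ i, ‖v i‖ ^ 2 ≤ ∑ _i : Fin n, ‖v‖ ^ 2 := by
        gcongr with i
        exact norm_le_pi_norm v i
    _ = _ := by simp

lemma norm_le_norm_toLp {n : ℕ} {𝕜 : Type*} [RCLike 𝕜] (v : Fin n → 𝕜) :
    ‖v‖ ≤ ‖WithLp.toLp 2 v‖ :=
  (pi_norm_le_iff_of_nonneg (norm_nonneg _)).2 fun i =>
    PiLp.norm_apply_le (p := 2) (WithLp.toLp 2 v) i

lemma sigma_pos {𝕜 : Type*} [RCLike 𝕜] {n : ℕ} (hn : n ≠ 0)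
    (g : Matrix.GeneralLinearGroup (Fin n) 𝕜) : 0 < sigma n g := by
  have hinj : Function.Injective (Matrix.toEuclideanLin (g : Matrix (Fin n) (Fin n) 𝕜)) := by
    refine Function.LeftInverse.injective
      (g := Matrix.toEuclideanLin ((g⁻¹ : Matrix.GeneralLinearGroup (Fin n) 𝕜) : Matrix _ _ 𝕜))
      fun x => ?_
    rw [Matrix.toLpLin_apply, Matrix.toLpLin_apply, Matrix.mulVec_mulVec, ← Units.val_mul]
    simp
  exact (LinearMap.injective_iff_forall_lt_finrank_singularValues_pos _).1 hinj (n - 1)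
    (by simp; omega)

/-- A matrix that expands some vector, and whose inverse expands some vector, has far apart extreme
singular values. -/
lemma mul_div_le_sigma_ratio {𝕜 : Type*} [RCLike 𝕜] {n : ℕ} (hn : n ≠ 0)
    (g : Matrix.GeneralLinearGroup (Fin n) 𝕜) {A B : ℝ} (hA : 0 < A) (hB : 0 < B)
    {v w : Fin n → 𝕜} (hv : v ≠ 0) (hw : w ≠ 0)
    (hgv : A * ‖v‖ ≤ ‖(g : Matrix (Fin n) (Fin n) 𝕜).mulVec v‖)
    (hgw : B * ‖w‖ ≤
      ‖((g⁻¹ : Matrix.GeneralLinearGroup (Fin n) 𝕜) : Matrix (Fin n) (Fin n) 𝕜).mulVec w‖) :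
    A * B / n ≤ sigma 1 g / sigma n g := by
  have hn0 : (0 : ℝ) < n := by positivity
  set s := Real.sqrt n with hs
  have hs0 : 0 < s := Real.sqrt_pos.2 hn0
  have h1 : A / s ≤ sigma 1 g := by
    refine LinearMap.le_singularValues_of_le_norm _ (by positivity)
      (Submodule.span 𝕜 {WithLp.toLp 2 v}) ?_ ?_
    · rw [finrank_span_singleton (by simpa using hv)]
    · intro x hx
      obtain ⟨c, rfl⟩ := Submodule.mem_span_singleton.1 hx
      rw [map_smul, norm_smul, norm_smul, mul_left_comm]
      refine mul_le_mul_of_nonneg_left ?_ (norm_nonneg _)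
      rw [Matrix.toLpLin_apply]
      refine le_trans ?_ (norm_le_norm_toLp _)
      refine le_trans ?_ hgv
      rw [div_mul_eq_mul_div, div_le_iff₀ hs0, mul_assoc, mul_comm _ s]
      gcongr
      exact norm_toLp_le_sqrt_mul v
  set w' := ((g⁻¹ : Matrix.GeneralLinearGroup (Fin n) 𝕜) : Matrix (Fin n) (Fin n) 𝕜).mulVec w
    with hw'
  have hgw' : (g : Matrix (Fin n) (Fin n) 𝕜).mulVec w' = w := by
    rw [hw', Matrix.mulVec_mulVec, ← Units.val_mul]; simp
  have hw0 : w' ≠ 0 := by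
    intro h; apply hw; rw [← hgw', h, Matrix.mulVec_zero]
  have h2 : sigma n g ≤ s / B := by
    refine LinearMap.singularValues_le_of_norm_le _ (by positivity) (by simp; omega)
      (Submodule.span 𝕜 {WithLp.toLp 2 w'}) ?_ ?_
    · rw [finrank_span_singleton (by simpa using hw0)]; simp; omega
    · intro x hx
      obtain ⟨c, rfl⟩ := Submodule.mem_span_singleton.1 hx
      rw [map_smul, norm_smul, norm_smul, mul_left_comm]
      refine mul_le_mul_of_nonneg_left ?_ (norm_nonneg _)
      rw [Matrix.toLpLin_apply]
      simp only [hgw']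
      rw [div_mul_eq_mul_div, le_div_iff₀ hB]
      calc ‖WithLp.toLp 2 w‖ * B ≤ s * ‖w‖ * B := by
            gcongr; exact norm_toLp_le_sqrt_mul w
        _ = s * (B * ‖w‖) := by ring
        _ ≤ s * ‖WithLp.toLp 2 w'‖ := by
            gcongr; exact hgw.trans (norm_le_norm_toLp _)
  rw [le_div_iff₀ (sigma_pos hn g)]
  refine le_trans ?_ h1
  calc A * B / n * sigma n g ≤ A * B / n * (s / B) := by gcongr
    _ = A / s := by
      have : s * s = n := Real.mul_self_sqrt hn0.le
      field_simp
      rw [sq, this]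

/-- A vector expanded by `ρ γ` bounds `σ_1` below; one expanded by `ρ γ⁻¹` bounds `σ_n` above. The
exponential factor from `γ⁻¹` is not needed and only its constant is kept. -/
lemma isQIEmbedding_of_expanding {Γ : Type*} [Group Γ] {n : ℕ} (hn : n ≠ 0) {𝕜 : Type*} [RCLike 𝕜]
    (ρ : Γ →* Matrix.GeneralLinearGroup (Fin n) 𝕜) (S : Finset Γ)
    (hS : Subgroup.closure (S : Set Γ) = ⊤) {c : ℝ} (hc : 0 < c)
    (h : ∀ γ, ∃ x : Fin n → 𝕜, x ≠ 0 ∧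
      c * 2 ^ wordLength S γ * ‖x‖ ≤ ‖(ρ γ : Matrix (Fin n) (Fin n) 𝕜).mulVec x‖) :
    IsQIEmbedding ρ := by
  refine ⟨S, hS, c * c / n, Real.log 2, by positivity, Real.log_pos (by norm_num), fun γ => ?_⟩
  obtain ⟨v, hv, hgv⟩ := h γ
  obtain ⟨w, hw, hgw⟩ := h γ⁻¹
  rw [map_inv] at hgw
  have hlen : (1 : ℝ) ≤ 2 ^ wordLength S γ⁻¹ := one_le_pow₀ (by norm_num)
  have := mul_div_le_sigma_ratio hn (ρ γ) (A := c * 2 ^ wordLength S γ) (B := c) (by positivity) hc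
    hv hw hgv (le_trans (by gcongr; nlinarith) hgw)
  refine le_trans (le_of_eq ?_) this
  rw [mul_comm (Real.log 2), ← Real.rpow_natCast, Real.rpow_def_of_pos (by norm_num),
    mul_comm (Real.log 2)]
  ring

end SigmaRatio

/-! ### Elementary bounds for word length. -/

section WordLength

variable {Γ : Type*} [Group Γ] {S : Finset Γ}

lemma wordLength_mul_le (hS : Subgroup.closure (S : Set Γ) = ⊤) (x y : Γ) :
    wordLength S (x * y) ≤ wordLength S x + wordLength S y := by
  obtain ⟨l, hl, hlS, rfl⟩ := exists_word_length_eq_wordLength hS x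
  obtain ⟨m, hm, hmS, rfl⟩ := exists_word_length_eq_wordLength hS y
  rw [← hl, ← hm, ← List.length_append, ← List.prod_append]
  refine wordLength_le_length _ fun z hz => ?_
  rcases List.mem_append.1 hz with h | h
  exacts [hlS z h, hmS z h]

lemma wordLength_one : wordLength S (1 : Γ) = 0 :=
  Nat.le_zero.1 (wordLength_le_length (S := S) [] (by simp))

lemma wordLength_le_one {x : Γ} (hx : x ∈ S) : wordLength S x ≤ 1 := by
  simpa using wordLength_le_length (S := S) [x] (by simpa using Or.inl hx)

lemma wordLength_zpow_le {x : Γ} (hx : x ∈ S) (k : ℤ) : wordLength S (x ^ k) ≤ k.natAbs := by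
  rcases Int.natAbs_eq k with h | h
  · have := wordLength_le_length (S := S) (List.replicate k.natAbs x) (by simp; tauto)
    rw [List.prod_replicate, List.length_replicate] at this
    rwa [h, zpow_natCast, Int.natAbs_natCast]
  · have := wordLength_le_length (S := S) (List.replicate k.natAbs x⁻¹) (by simp; tauto)
    rw [List.prod_replicate, List.length_replicate] at this
    rw [h, zpow_neg, zpow_natCast, Int.natAbs_neg, Int.natAbs_natCast]
    rwa [inv_pow] at this

end WordLength

/-! ### Alternating words and quantitative ping-pong. -/

section PingPong

variable {F : Type} [Group F]

/-- `ReducedWord F γ ℓ`: `γ` is an alternating product of nontrivial powers of the free generator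
and nontrivial elements of `ℤ × F`, starting with a power of the free generator unless it is
trivial; `ℓ` bounds its length. -/
inductive ReducedWord (F : Type) [Group F] : FreeProdGroup F 1 → ℕ → Prop
  | one : ReducedWord F 1 0
  | pow (k : ℤ) (hk : k ≠ 0) : ReducedWord F (genA F ^ k) k.natAbs
  | cons (k : ℤ) (hk : k ≠ 0) (j : ℤ) (f : F) (hjf : ¬ (j = 0 ∧ f = 1)) (γ : FreeProdGroup F 1)
      (ℓ : ℕ) (h : ReducedWord F γ ℓ) :
      ReducedWord F (genA F ^ k * (genT F ^ j * inF f * γ)) (k.natAbs + j.natAbs + 1 + ℓ)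

/-- Only the existence of an alternating form matters, not its uniqueness. The element of `ℤ × F` in
front may be trivial. -/
lemma exists_reducedWord (γ : FreeProdGroup F 1) :
    ∃ (j : ℤ) (f : F) (γ' : FreeProdGroup F 1) (ℓ : ℕ), ReducedWord F γ' ℓ ∧
      γ = genT F ^ j * inF f * γ' := by
  induction γ using Monoid.Coprod.induction_on' with
  | one => exact ⟨0, 1, 1, 0, .one, by simp⟩
  | inl_mul z x ih =>
    obtain ⟨j, f, γ', ℓ, h, rfl⟩ := ih
    refine ⟨z.1.toAdd + j, z.2 * f, γ', ℓ, h, ?_⟩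
    rw [inl_eq_genT_zpow_mul_inF, zpow_add, map_mul]
    have hc : Commute (inF z.2) (genT F ^ j) :=
      (Commute.zpow_left (genT_comm_inF z.2 : Commute (genT F) (inF z.2)) j).symm
    have := hc.eq
    simp only [mul_assoc]
    rw [← mul_assoc (inF z.2) (genT F ^ j), this]
    simp only [mul_assoc]
  | inr_mul w x ih =>
    obtain ⟨j, f, γ', ℓ, h, rfl⟩ := ih
    obtain ⟨k, hk⟩ := inr_eq_genA_zpow (F := F) w
    rw [hk]
    by_cases hk0 : k = 0
    · exact ⟨j, f, γ', ℓ, h, by simp [hk0]⟩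
    by_cases hjf : j = 0 ∧ f = 1
    · obtain ⟨rfl, rfl⟩ := hjf
      simp only [zpow_zero, map_one, one_mul]
      cases h with
      | one => exact ⟨0, 1, _, _, .pow k hk0, by simp⟩
      | pow i hi =>
        rw [← zpow_add]
        by_cases hki : k + i = 0
        · exact ⟨0, 1, 1, 0, .one, by simp [hki]⟩
        · exact ⟨0, 1, _, _, .pow _ hki, by simp⟩
      | cons i hi j' f' hjf γ ℓ h =>
        rw [← mul_assoc, ← zpow_add]
        by_cases hki : k + i = 0
        · exact ⟨j', f', γ, ℓ, h, by simp [hki]⟩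
        · exact ⟨0, 1, _, _, .cons _ hki j' f' hjf γ ℓ h, by simp⟩
    · exact ⟨0, 1, _, _, .cons k hk0 j f hjf γ' ℓ h, by simp⟩

/-- The standard generating set of `(ℤ × F) * F_1`. -/
noncomputable def stdGens (F : Type) [Group F] [Finite F] : Finset (FreeProdGroup F 1) := by
  classical exact insert (genT F) (insert (genA F) (Set.finite_range (inF (F := F))).toFinset)

variable [Finite F]

lemma genT_mem_stdGens : genT F ∈ stdGens F := by simp [stdGens]

lemma genA_mem_stdGens : genA F ∈ stdGens F := by simp [stdGens]

lemma inF_mem_stdGens (f : F) : inF f ∈ stdGens F := by simp [stdGens]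

lemma closure_stdGens : Subgroup.closure (stdGens F : Set (FreeProdGroup F 1)) = ⊤ := by
  refine eq_top_iff.2 fun γ _ => ?_
  have hz : ∀ (j : ℤ) (f : F), genT F ^ j * inF f ∈
      Subgroup.closure (stdGens F : Set (FreeProdGroup F 1)) := fun j f =>
    mul_mem (zpow_mem (Subgroup.subset_closure (genT_mem_stdGens (F := F))) j)
      (Subgroup.subset_closure (inF_mem_stdGens f))
  have ha : ∀ k : ℤ, genA F ^ k ∈ Subgroup.closure (stdGens F : Set (FreeProdGroup F 1)) :=
    zpow_mem (Subgroup.subset_closure (genA_mem_stdGens (F := F)))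
  obtain ⟨j, f, γ', ℓ, h, rfl⟩ := exists_reducedWord γ
  refine mul_mem (hz j f) ?_
  induction h with
  | one => exact one_mem _
  | pow k hk => exact ha k
  | cons k hk j f hjf γ ℓ h ih => exact mul_mem (ha k) (mul_mem (hz j f) (ih trivial))

lemma wordLength_genT_mul_inF_le (j : ℤ) (f : F) :
    wordLength (stdGens F) (genT F ^ j * inF f) ≤ j.natAbs + 1 :=
  (wordLength_mul_le (closure_stdGens (F := F)) _ _).trans
    (add_le_add (wordLength_zpow_le genT_mem_stdGens j) (wordLength_le_one (inF_mem_stdGens f)))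

/-- The `1` added to `ℓ` by each `cons` pays for the letter from `F`. This inequality suffices:
growth like `2 ^ ℓ` implies growth in the word length. -/
lemma ReducedWord.wordLength_le {γ : FreeProdGroup F 1} {ℓ : ℕ} (h : ReducedWord F γ ℓ) :
    wordLength (stdGens F) γ ≤ ℓ := by
  induction h with
  | one => exact wordLength_one.le
  | pow k hk => exact wordLength_zpow_le genA_mem_stdGens k
  | cons k hk j f hjf γ ℓ h ih =>
    have h1 := wordLength_mul_le (closure_stdGens (F := F)) (genA F ^ k) (genT F ^ j * inF f * γ)
    have h2 := wordLength_mul_le (closure_stdGens (F := F)) (genT F ^ j * inF f) γ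
    have h3 := wordLength_genT_mul_inF_le j f
    have h4 := wordLength_zpow_le (genA_mem_stdGens (F := F)) k
    omega

/-- Ping-pong: if the powers of the free generator map `D` into `N` and expand by a large factor,
and the nontrivial elements of `ℤ × F` map `N` into `D` and expand up to a constant, then the norm
of some vector grows exponentially in the word length. -/
theorem exists_norm_ge_of_pingPong {V : Type*} [NormedAddCommGroup V] [Module ℂ V]
    (ρ : FreeProdGroup F 1 →* Module.End ℂ V) {N D : Set V} {c Λ : ℝ} (hc : 0 < c) (hc1 : c ≤ 1)
    (hΛ : 2 ≤ Λ) (hcΛ : 4 ≤ c * Λ) (hN : ∃ x ∈ N, x ≠ 0) (hD : ∃ x ∈ D, x ≠ 0)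
    (hA : ∀ k : ℤ, k ≠ 0 → ∀ x ∈ D, ρ (genA F ^ k) x ∈ N ∧
      Λ ^ k.natAbs * ‖x‖ ≤ ‖ρ (genA F ^ k) x‖)
    (hT : ∀ (k : ℤ) (f : F), ¬ (k = 0 ∧ f = 1) → ∀ x ∈ N, ρ (genT F ^ k * inF f) x ∈ D ∧
      c * 2 ^ k.natAbs * ‖x‖ ≤ ‖ρ (genT F ^ k * inF f) x‖) (γ : FreeProdGroup F 1) :
    ∃ x : V, x ≠ 0 ∧ c / 2 * 2 ^ wordLength (stdGens F) γ * ‖x‖ ≤ ‖ρ γ x‖ := by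
  have key : ∀ γ ℓ, ReducedWord F γ ℓ → ∃ x : V, x ≠ 0 ∧ ρ γ x ∈ N ∧ 2 ^ ℓ * ‖x‖ ≤ ‖ρ γ x‖ := by
    intro γ ℓ h
    induction h with
    | one =>
      obtain ⟨x, hx, hx0⟩ := hN
      exact ⟨x, hx0, by simpa using hx, by simp⟩
    | pow k hk =>
      obtain ⟨x, hx, hx0⟩ := hD
      refine ⟨x, hx0, (hA k hk x hx).1, le_trans ?_ (hA k hk x hx).2⟩
      gcongr
    | cons k hk j f hjf γ ℓ h ih =>
      obtain ⟨x, hx0, hxN, hx⟩ := ih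
      have h1 := hT j f hjf _ hxN
      have h2 := hA k hk _ h1.1
      refine ⟨x, hx0, ?_, ?_⟩
      · rw [map_mul, map_mul]; exact h2.1
      · rw [map_mul, map_mul]
        refine le_trans ?_ h2.2
        -- Since `k ≠ 0`, one factor `Λ` is available; by `4 ≤ c * Λ` it pays for the loss `c` of
        -- the other factor and for the letter from `F`.
        have h3 : (2 : ℝ) ^ (k.natAbs + 1) ≤ Λ ^ k.natAbs * c := by
          obtain ⟨i, hi⟩ := Nat.exists_eq_succ_of_ne_zero (Int.natAbs_ne_zero.2 hk)
          rw [hi, Nat.succ_eq_add_one]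
          calc (2 : ℝ) ^ (i + 1 + 1) = 2 ^ i * 4 := by ring
            _ ≤ Λ ^ i * (c * Λ) := by gcongr
            _ = _ := by ring
        calc (2 : ℝ) ^ (k.natAbs + j.natAbs + 1 + ℓ) * ‖x‖
            = 2 ^ (k.natAbs + 1) * (2 ^ j.natAbs * (2 ^ ℓ * ‖x‖)) := by ring
          _ ≤ Λ ^ k.natAbs * c * (2 ^ j.natAbs * ‖ρ γ x‖) := by gcongr
          _ = Λ ^ k.natAbs * (c * 2 ^ j.natAbs * ‖ρ γ x‖) := by ring
          _ ≤ _ := by gcongr; exact h1.2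
  obtain ⟨j, f, γ', ℓ, h, rfl⟩ := exists_reducedWord γ
  obtain ⟨x, hx0, hxN, hx⟩ := key γ' ℓ h
  have hlen : wordLength (stdGens F) (genT F ^ j * inF f * γ') ≤ j.natAbs + 1 + ℓ :=
    (wordLength_mul_le (closure_stdGens (F := F)) _ _).trans
      (add_le_add (wordLength_genT_mul_inF_le j f) h.wordLength_le)
  have hmain : c * 2 ^ j.natAbs * ‖ρ γ' x‖ ≤ ‖ρ (genT F ^ j * inF f * γ') x‖ := by
    by_cases hjf : j = 0 ∧ f = 1
    · obtain ⟨rfl, rfl⟩ := hjf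
      simpa using mul_le_of_le_one_left (norm_nonneg _) hc1
    · rw [map_mul]; exact (hT j f hjf _ hxN).2
  refine ⟨x, hx0, le_trans ?_ hmain⟩
  calc c / 2 * 2 ^ wordLength (stdGens F) (genT F ^ j * inF f * γ') * ‖x‖
      ≤ c / 2 * 2 ^ (j.natAbs + 1 + ℓ) * ‖x‖ := by gcongr; norm_num
    _ = c * 2 ^ j.natAbs * (2 ^ ℓ * ‖x‖) := by ring
    _ ≤ _ := by gcongr

end PingPong

/-! ### The sup norm on a sum of coordinate sets. -/

section SumNorm

variable {α β : Type*} [Fintype α] [Fintype β]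

lemma sum_norm_le_iff {x : α ⊕ β → ℂ} {r : ℝ} (hr : 0 ≤ r) :
    ‖x‖ ≤ r ↔ ‖x ∘ Sum.inl‖ ≤ r ∧ ‖x ∘ Sum.inr‖ ≤ r := by
  simp [pi_norm_le_iff_of_nonneg hr]

lemma norm_comp_inl_le (x : α ⊕ β → ℂ) : ‖x ∘ Sum.inl‖ ≤ ‖x‖ :=
  ((sum_norm_le_iff (norm_nonneg x)).1 le_rfl).1

lemma norm_comp_inr_le (x : α ⊕ β → ℂ) : ‖x ∘ Sum.inr‖ ≤ ‖x‖ :=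
  ((sum_norm_le_iff (norm_nonneg x)).1 le_rfl).2

end SumNorm

/-! ### Powers of block diagonal matrices. -/

section BlockDynamics

variable {d : ℕ} {M : Type} [Fintype M] [DecidableEq M]

lemma fromBlocks_scalar_pow_mulVec (μ : ℂ) (D : Matrix (M ⊕ Unit) (M ⊕ Unit) ℂ)
    (x : BlockIdx d M → ℂ) (k : ℕ) :
    (Matrix.fromBlocks (μ • 1) 0 0 D ^ k).mulVec x =
      Sum.elim (μ ^ k • (x ∘ Sum.inl)) ((D ^ k).mulVec (x ∘ Sum.inr)) := by
  rw [Matrix.fromBlocks_diagonal_pow, Matrix.fromBlocks_mulVec, smul_pow, one_pow]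
  simp [Matrix.smul_mulVec]

lemma norm_pow_mulVec_le {ι : Type*} [Fintype ι] [DecidableEq ι] {D : Matrix ι ι ℂ} {C : ℝ}
    (hC : 0 ≤ C) (hD : ∀ x, ‖D.mulVec x‖ ≤ C * ‖x‖) (k : ℕ) (x : ι → ℂ) :
    ‖(D ^ k).mulVec x‖ ≤ C ^ k * ‖x‖ := by
  induction k with
  | zero => simp
  | succ k ih =>
    rw [pow_succ', ← Matrix.mulVec_mulVec, pow_succ', mul_assoc]
    exact (hD _).trans (by gcongr)

/-- The scalar block dominates: relative to `‖μ‖ ^ k` the other block contributes at most `2 ^ k /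
‖μ‖ ^ k ≤ 2 / ‖μ‖`. Keeping just one such factor makes the error uniform in `k`. -/
lemma norm_scalar_block_pow_sub_le {μ : ℂ} {D : Matrix (M ⊕ Unit) (M ⊕ Unit) ℂ}
    (hD : ∀ x, ‖D.mulVec x‖ ≤ 2 * ‖x‖) (hμ : 2 ≤ ‖μ‖) {k : ℕ} (hk : k ≠ 0)
    (x : BlockIdx d M → ℂ) (w : Fin d → ℂ) :
    ‖(Matrix.fromBlocks (μ • 1) 0 0 D ^ k).mulVec x - μ ^ k • Sum.elim w 0‖ ≤
      ‖μ‖ ^ k * (‖x ∘ Sum.inl - w‖ + 2 / ‖μ‖ * ‖x ∘ Sum.inr‖) := by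
  have hμ0 : 0 < ‖μ‖ := by linarith
  rw [fromBlocks_scalar_pow_mulVec]
  refine (sum_norm_le_iff (by positivity)).2 ⟨?_, ?_⟩
  · have : (Sum.elim (μ ^ k • (x ∘ Sum.inl)) ((D ^ k).mulVec (x ∘ Sum.inr)) -
        μ ^ k • Sum.elim w 0) ∘ Sum.inl = μ ^ k • (x ∘ Sum.inl - w) := by
      ext i; simp [mul_sub]
    rw [this, norm_smul, norm_pow]
    gcongr
    exact le_add_of_nonneg_right (by positivity)
  · have : (Sum.elim (μ ^ k • (x ∘ Sum.inl)) ((D ^ k).mulVec (x ∘ Sum.inr)) -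
        μ ^ k • Sum.elim w 0) ∘ Sum.inr = (D ^ k).mulVec (x ∘ Sum.inr) := by
      ext i; simp
    rw [this]
    refine (norm_pow_mulVec_le (by norm_num) hD k _).trans ?_
    obtain ⟨j, rfl⟩ := Nat.exists_eq_succ_of_ne_zero hk
    calc (2 : ℝ) ^ (j + 1) * ‖x ∘ Sum.inr‖ = 2 ^ j * 2 * ‖x ∘ Sum.inr‖ := by rw [pow_succ]
      _ ≤ ‖μ‖ ^ j * 2 * ‖x ∘ Sum.inr‖ := by gcongr
      _ = ‖μ‖ ^ (j + 1) * (2 / ‖μ‖ * ‖x ∘ Sum.inr‖) := by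
        rw [pow_succ]; field_simp
      _ ≤ _ := by
        gcongr
        exact le_add_of_nonneg_left (norm_nonneg _)

/-- A map that is close to a block diagonal one whose last entry is large expands the last
coordinate on a cone around the last axis. -/
lemma last_coord_pow {D N : Matrix (M ⊕ Unit) (M ⊕ Unit) ℂ} {ℓ : ℝ} (hℓ : 3 ≤ ℓ)
    (hDN : ∀ x, ‖D.mulVec x - N.mulVec x‖ ≤ ‖x‖)
    (hN : ∀ x, ‖(N.mulVec x) ∘ Sum.inl‖ ≤ 2 * ‖x ∘ Sum.inl‖)
    (hN' : ∀ x, (ℓ + 1) * ‖x (.inr ())‖ ≤ ‖N.mulVec x (.inr ())‖)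
    {x : M ⊕ Unit → ℂ} (hx : ‖x ∘ Sum.inl‖ ≤ ‖x (.inr ())‖) {k : ℕ} (hk : k ≠ 0) :
    ℓ ^ k * ‖x (.inr ())‖ ≤ ‖(D ^ k).mulVec x (.inr ())‖ ∧
      ‖(D ^ k).mulVec x ∘ Sum.inl‖ ≤ 3 / ℓ * ‖(D ^ k).mulVec x (.inr ())‖ := by
  have hℓ0 : 0 < ℓ := by linarith
  -- One step maps the cone into the narrower cone of slope `3/ℓ ≤ 1`, so it can be iterated.
  have step : ∀ y : M ⊕ Unit → ℂ, ‖y ∘ Sum.inl‖ ≤ ‖y (.inr ())‖ →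
      ℓ * ‖y (.inr ())‖ ≤ ‖D.mulVec y (.inr ())‖ ∧
        ‖D.mulVec y ∘ Sum.inl‖ ≤ 3 / ℓ * ‖D.mulVec y (.inr ())‖ := by
    intro y hy
    have hny : ‖y‖ ≤ ‖y (.inr ())‖ := by
      refine (sum_norm_le_iff (norm_nonneg _)).2 ⟨hy, ?_⟩
      exact (pi_norm_le_iff_of_nonneg (norm_nonneg _)).2 fun i => le_rfl
    have h0 := (hDN y).trans hny
    have h1 : ℓ * ‖y (.inr ())‖ ≤ ‖D.mulVec y (.inr ())‖ := by
      have e1 := norm_le_pi_norm (D.mulVec y - N.mulVec y) (.inr ())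
      have e2 := norm_sub_norm_le (N.mulVec y (.inr ())) (D.mulVec y (.inr ()))
      rw [norm_sub_rev] at e2
      have e3 := hN' y
      simp only [Pi.sub_apply] at e1
      linarith
    refine ⟨h1, ?_⟩
    have h2 : ‖D.mulVec y ∘ Sum.inl‖ ≤ 3 * ‖y (.inr ())‖ := by
      have e : D.mulVec y ∘ Sum.inl =
          N.mulVec y ∘ Sum.inl + (D.mulVec y - N.mulVec y) ∘ Sum.inl := by ext i; simp
      rw [e]
      have e1 := norm_add_le (N.mulVec y ∘ Sum.inl) ((D.mulVec y - N.mulVec y) ∘ Sum.inl)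
      have e2 := norm_comp_inl_le (D.mulVec y - N.mulVec y)
      have e3 := hN y
      linarith
    rw [div_mul_eq_mul_div, le_div_iff₀ hℓ0]
    nlinarith
  have main : ∀ k, ℓ ^ (k + 1) * ‖x (.inr ())‖ ≤ ‖(D ^ (k + 1)).mulVec x (.inr ())‖ ∧
      ‖(D ^ (k + 1)).mulVec x ∘ Sum.inl‖ ≤ 3 / ℓ * ‖(D ^ (k + 1)).mulVec x (.inr ())‖ := by
    intro k
    induction k with
    | zero => simpa using step x hx
    | succ k ih =>
      have h3 : ‖(D ^ (k + 1)).mulVec x ∘ Sum.inl‖ ≤ ‖(D ^ (k + 1)).mulVec x (.inr ())‖ :=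
        ih.2.trans (mul_le_of_le_one_left (norm_nonneg _) ((div_le_one hℓ0).2 hℓ))
      have h4 := step _ h3
      rw [Matrix.mulVec_mulVec, ← pow_succ'] at h4
      refine ⟨le_trans ?_ h4.1, h4.2⟩
      rw [pow_succ', mul_assoc]
      gcongr
      exact ih.1
  obtain ⟨j, rfl⟩ := Nat.exists_eq_succ_of_ne_zero hk
  exact main j

/-- For negative powers of `t`: the scalar block no longer grows, while the last coordinate
dominates the middle ones. The multiplier `m` is the last coordinate of the image. -/
lemma norm_scalar_block_pow_sub_last_le {μ : ℂ} (hμ : ‖μ‖ ≤ 1)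
    {D N : Matrix (M ⊕ Unit) (M ⊕ Unit) ℂ} {ℓ : ℝ} (hℓ : 3 ≤ ℓ)
    (hDN : ∀ x, ‖D.mulVec x - N.mulVec x‖ ≤ ‖x‖)
    (hN : ∀ x, ‖(N.mulVec x) ∘ Sum.inl‖ ≤ 2 * ‖x ∘ Sum.inl‖)
    (hN' : ∀ x, (ℓ + 1) * ‖x (.inr ())‖ ≤ ‖N.mulVec x (.inr ())‖)
    {x : BlockIdx d M → ℂ} (hx : ‖x ∘ Sum.inr ∘ Sum.inl‖ ≤ ‖x (.inr (.inr ()))‖)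
    {k : ℕ} (hk : k ≠ 0) :
    ∃ m : ℂ, ℓ ^ k * ‖x (.inr (.inr ()))‖ ≤ ‖m‖ ∧
      ‖(Matrix.fromBlocks (μ • 1) 0 0 D ^ k).mulVec x -
          m • (Sum.elim 0 (Sum.elim 0 1) : BlockIdx d M → ℂ)‖ ≤
        ‖x ∘ Sum.inl‖ + 3 / ℓ * ‖m‖ := by
  have hℓ0 : 0 < ℓ := by linarith
  obtain ⟨h1, h2⟩ := last_coord_pow hℓ hDN hN hN' (x := x ∘ Sum.inr) hx hk
  refine ⟨_, h1, ?_⟩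
  set m := (D ^ k).mulVec (x ∘ Sum.inr) (.inr ()) with hm
  rw [fromBlocks_scalar_pow_mulVec]
  refine (sum_norm_le_iff (by positivity)).2 ⟨?_, (sum_norm_le_iff (by positivity)).2 ⟨?_, ?_⟩⟩
  · refine le_trans ?_ (le_add_of_nonneg_right (by positivity))
    have : (Sum.elim (μ ^ k • (x ∘ Sum.inl)) ((D ^ k).mulVec (x ∘ Sum.inr)) -
        m • (Sum.elim 0 (Sum.elim 0 1) : BlockIdx d M → ℂ)) ∘ Sum.inl = μ ^ k • (x ∘ Sum.inl) := by
      ext i; simp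
    rw [this, norm_smul, norm_pow]
    exact mul_le_of_le_one_left (norm_nonneg _) (pow_le_one₀ (norm_nonneg _) hμ)
  · refine le_trans ?_ ((le_add_of_nonneg_left (norm_nonneg _)).trans' h2)
    apply le_of_eq
    congr 1
    ext i; simp
  · refine le_trans (le_of_eq ?_) (by positivity : (0 : ℝ) ≤ _)
    rw [norm_eq_zero]
    ext i; simp [hm]

end BlockDynamics

/-! ### Signed permutations and Schur's lemma. -/

section Schur

variable {d : ℕ}

/-- The orthogonal group of the lattice `ℤ^d`, that is, the group of signed permutation matrices. -/
abbrev SignedPerm (d : ℕ) : Type := Matrix.orthogonalGroup (Fin d) ℤ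

/-- A signed permutation as a matrix over a ring. -/
def SignedPerm.mat (R : Type*) [CommRing R] : SignedPerm d →* Matrix (Fin d) (Fin d) R :=
  ((Int.castRingHom R).mapMatrix.toMonoidHom).comp (Submonoid.subtype _)

lemma SignedPerm.mat_apply (R : Type*) [CommRing R] (f : SignedPerm d) (i j : Fin d) :
    f.mat R i j = (f.1 i j : R) := rfl

lemma SignedPerm.mat_complex (f : SignedPerm d) :
    f.mat ℂ = (f.mat ℝ).map Complex.ofReal := by
  ext i j
  simp [SignedPerm.mat_apply]

/-- The squares in a row add up to `1`, and `|a| ≤ a ^ 2` for integers. This yields both finiteness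
of the group and its contraction of the sup norm. -/
lemma SignedPerm.sum_abs_le (f : SignedPerm d) (i : Fin d) : ∑ j, |f.1 i j| ≤ 1 := by
  have h : f.1 * f.1.transpose = 1 := (Matrix.mem_orthogonalGroup_iff _ _).1 f.2
  have h1 := congrFun (congrFun h i) i
  rw [Matrix.mul_apply, Matrix.one_apply_eq] at h1
  rw [← h1]
  refine Finset.sum_le_sum fun j _ => ?_
  rw [Matrix.transpose_apply, ← sq, ← sq_abs]
  rcases (abs_nonneg (f.1 i j)).eq_or_lt with h | h
  · simp [← h]
  · nlinarith

instance (d : ℕ) : Finite (SignedPerm d) := by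
  have hb : ∀ (f : SignedPerm d) i j, f.1 i j ∈ Set.Icc (-1 : ℤ) 1 := fun f i j =>
    abs_le.1 ((Finset.single_le_sum (f := fun j => |f.1 i j|) (fun _ _ => abs_nonneg _)
      (Finset.mem_univ j)).trans (f.sum_abs_le i))
  let φ : SignedPerm d → (Fin d → Fin d → Set.Icc (-1 : ℤ) 1) := fun f i j => ⟨f.1 i j, hb f i j⟩
  refine Finite.of_injective φ fun f g h => ?_
  ext i j
  exact congrArg Subtype.val (congrFun (congrFun h i) j)

lemma SignedPerm.norm_mulVec_le (f : SignedPerm d) (x : Fin d → ℂ) :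
    ‖(f.mat ℂ).mulVec x‖ ≤ ‖x‖ := by
  refine (pi_norm_le_iff_of_nonneg (norm_nonneg _)).2 fun i => ?_
  calc ‖(f.mat ℂ).mulVec x i‖ ≤ ∑ j, ‖f.mat ℂ i j * x j‖ :=
        norm_sum_le Finset.univ fun j => f.mat ℂ i j * x j
    _ ≤ ∑ j, (|f.1 i j| : ℝ) * ‖x‖ := by
      refine Finset.sum_le_sum fun j _ => ?_
      rw [norm_mul, SignedPerm.mat_apply, Complex.norm_intCast]
      gcongr
      exact norm_le_pi_norm x j
    _ = (∑ j, |f.1 i j| : ℤ) * ‖x‖ := by rw [← Finset.sum_mul]; push_cast; rfl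
    _ ≤ (1 : ℤ) * ‖x‖ := by
      have := f.sum_abs_le i
      gcongr
    _ = ‖x‖ := by simp

lemma SignedPerm.exists_mat_mulVec_ne (f : SignedPerm d) (hf : f ≠ 1) :
    ∃ w : Fin d → ℝ, (f.mat ℝ).mulVec w ≠ w := by
  by_contra! h
  apply hf
  ext i j
  have h1 := congrFun (h (Pi.single j 1)) i
  rw [Matrix.mulVec_single_one] at h1
  have h2 : ((f.1 i j : ℤ) : ℝ) = (Pi.single j 1 : Fin d → ℝ) i := h1
  rw [Pi.single_apply] at h2
  have h3 : f.1 i j = if i = j then 1 else 0 := by exact_mod_cast h2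
  rw [h3]
  simp [Matrix.one_apply]

lemma matrix_eq_zero_of_neg_eq {α β : Type*} {B : Matrix α β ℂ} (h : -B = B) : B = 0 := by
  ext i j
  have := congrFun (congrFun h i) j
  simpa using (neg_eq_self).1 this

/-- The signed permutation matrices act absolutely irreducibly. -/
lemma SignedPerm.eq_scalar_of_commute [NeZero d] {X : Matrix (Fin d) (Fin d) ℂ}
    (h : ∀ f : SignedPerm d, Commute (f.mat ℂ) X) : X = X 0 0 • 1 := by
  have hperm : ∀ i, X i i = X 0 0 := by
    intro i
    -- Transpositions equate the diagonal entries; sign changes in a single coordinate remove the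
    -- off-diagonal ones.
    let σ := Equiv.swap i 0
    have hσ : (σ.permMatrix ℤ) ∈ Matrix.orthogonalGroup (Fin d) ℤ := by
      rw [Matrix.mem_orthogonalGroup_iff, Matrix.transpose_permMatrix, ← Matrix.permMatrix_mul]
      simp
    have h1 := congrFun (congrFun (h ⟨_, hσ⟩).eq i) 0
    have h2 : ∀ a b, SignedPerm.mat ℂ ⟨_, hσ⟩ a b = if σ a = b then 1 else 0 := by
      intro a b
      rw [SignedPerm.mat_apply]
      simp [PEquiv.toMatrix_apply, Equiv.Perm.permMatrix, eq_comm]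
    simp only [Matrix.mul_apply, h2] at h1
    have h3 : ∀ k, σ k = 0 ↔ k = i := fun k => by
      rw [← Equiv.eq_symm_apply]; simp [σ]
    simpa [h3, σ] using h1.symm
  have hoff : ∀ i j, i ≠ j → X i j = 0 := by
    intro i j hij
    let D : Matrix (Fin d) (Fin d) ℤ := Matrix.diagonal fun k => if k = i then -1 else 1
    have hD : D ∈ Matrix.orthogonalGroup (Fin d) ℤ := by
      rw [Matrix.mem_orthogonalGroup_iff, Matrix.diagonal_transpose, Matrix.diagonal_mul_diagonal,
        ← Matrix.diagonal_one]
      congr 1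
      ext k
      by_cases hk : k = i <;> simp [hk]
    have h1 := congrFun (congrFun (h ⟨_, hD⟩).eq i) j
    have h2 : SignedPerm.mat ℂ ⟨_, hD⟩ = Matrix.diagonal fun k => if k = i then -1 else 1 := by
      ext a b
      rw [SignedPerm.mat_apply]
      by_cases hab : a = b
      · subst hab
        by_cases ha : a = i <;> simp [D, ha]
      · simp [D, hab]
    rw [h2, Matrix.diagonal_mul, Matrix.mul_diagonal] at h1
    simp only [if_true, if_neg hij.symm, mul_one, neg_mul, one_mul] at h1
    exact neg_eq_self.1 h1
  ext i j
  by_cases hij : i = j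
  · subst hij; simp [hperm]
  · simp [hij, hoff i j hij]

variable {M : Type} [Fintype M] [DecidableEq M]

/-- The action of the signed permutations on the first block of coordinates. -/
def SignedPerm.blockMat (R : Type*) [CommRing R] (M : Type) [Fintype M] [DecidableEq M] :
    SignedPerm d →* Matrix (BlockIdx d M) (BlockIdx d M) R where
  toFun f := Matrix.fromBlocks (f.mat R) 0 0 1
  map_one' := by simp
  map_mul' f g := by simp [Matrix.fromBlocks_multiply]

lemma SignedPerm.blockMat_mulVec (f : SignedPerm d) (x : BlockIdx d M → ℂ) :
    (f.blockMat ℂ M).mulVec x = Sum.elim ((f.mat ℂ).mulVec (x ∘ Sum.inl)) (x ∘ Sum.inr) := by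
  simp [SignedPerm.blockMat, Matrix.fromBlocks_mulVec]

lemma SignedPerm.norm_blockMat_mulVec_le (f : SignedPerm d) (x : BlockIdx d M → ℂ) :
    ‖(f.blockMat ℂ M).mulVec x‖ ≤ ‖x‖ := by
  rw [f.blockMat_mulVec]
  refine (sum_norm_le_iff (norm_nonneg _)).2 ⟨?_, ?_⟩
  · rw [Sum.elim_comp_inl]
    exact (f.norm_mulVec_le _).trans (norm_comp_inl_le x)
  · rw [Sum.elim_comp_inr]
    exact norm_comp_inr_le x

/-- The element `-1` acts by `-1` on the first block and trivially on the rest, so it kills the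
off-diagonal blocks; irreducibility makes the first block scalar. -/
lemma SignedPerm.eq_fromBlocks_of_commute [NeZero d]
    {X : Matrix (BlockIdx d M) (BlockIdx d M) ℂ}
    (h : ∀ f : SignedPerm d, Commute (f.blockMat ℂ M) X) :
    X = Matrix.fromBlocks (X (.inl 0) (.inl 0) • 1) 0 0 X.toBlocks₂₂ := by
  have hX := Matrix.fromBlocks_toBlocks X
  have key : ∀ f : SignedPerm d, f.mat ℂ * X.toBlocks₁₁ = X.toBlocks₁₁ * f.mat ℂ ∧
      f.mat ℂ * X.toBlocks₁₂ = X.toBlocks₁₂ ∧ X.toBlocks₂₁ = X.toBlocks₂₁ * f.mat ℂ := by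
    intro f
    have h1 := (h f).eq
    rw [← hX] at h1
    simp only [SignedPerm.blockMat, MonoidHom.coe_mk, OneHom.coe_mk, Matrix.fromBlocks_multiply,
      Matrix.fromBlocks_inj] at h1
    simp only [Matrix.zero_mul, Matrix.mul_zero, add_zero, zero_add, Matrix.one_mul,
      Matrix.mul_one] at h1
    exact ⟨h1.1, h1.2.1, h1.2.2.1⟩
  have hneg : (-1 : Matrix (Fin d) (Fin d) ℤ) ∈ Matrix.orthogonalGroup (Fin d) ℤ := by
    rw [Matrix.mem_orthogonalGroup_iff]; simp
  have hneg' : SignedPerm.mat ℂ ⟨_, hneg⟩ = -1 := by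
    ext i j
    rw [SignedPerm.mat_apply]
    simp [Matrix.one_apply, apply_ite]
  obtain ⟨-, h2, h3⟩ := key ⟨_, hneg⟩
  rw [hneg'] at h2 h3
  have h12 : X.toBlocks₁₂ = 0 := matrix_eq_zero_of_neg_eq (by simpa using h2)
  have h21 : X.toBlocks₂₁ = 0 := matrix_eq_zero_of_neg_eq (by simpa using h3.symm)
  have h11 := SignedPerm.eq_scalar_of_commute fun f => (key f).1
  conv_lhs => rw [← hX, h12, h21, h11]
  rfl

end Schur

/-! ### A vector and linear forms in general position. -/

section Generic

/-- A vector with trivial stabiliser among the signed permutations. -/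
lemma SignedPerm.exists_forall_mulVec_ne (d : ℕ) [NeZero d] :
    ∃ w : Fin d → ℝ, w ≠ 0 ∧ ∀ f : SignedPerm d, f ≠ 1 → (f.mat ℝ).mulVec w ≠ w := by
  have h : ∀ f : SignedPerm d, ∃ φ : Module.Dual ℝ (Fin d → ℝ), (∃ x, φ x ≠ 0) ∧
      (f ≠ 1 → ∃ i, ∀ x, φ x = (f.mat ℝ).mulVec x i - x i) := by
    intro f
    by_cases hf : f = 1
    -- The identity imposes no condition on the stabiliser; this nonzero form ensures `w ≠ 0`
    -- instead.
    · exact ⟨LinearMap.proj 0, ⟨1, by simp⟩, fun h => absurd hf h⟩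
    · obtain ⟨x, hx⟩ := f.exists_mat_mulVec_ne hf
      obtain ⟨i, hi⟩ := Function.ne_iff.1 hx
      refine ⟨(LinearMap.proj i).comp ((f.mat ℝ).mulVecLin - LinearMap.id), ⟨x, ?_⟩,
        fun _ => ⟨i, ?_⟩⟩
      · simpa [sub_eq_zero] using hi
      · intro x; simp
  choose φ hφ hφ' using h
  obtain ⟨w, hw⟩ := Module.Dual.exists_forall_ne_zero_of_forall_exists φ hφ
  refine ⟨w, ?_, fun f hf hfw => ?_⟩
  · rintro rfl
    exact hw 1 (map_zero _)
  · obtain ⟨i, hi⟩ := hφ' f hf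
    apply hw f
    rw [hi, hfw, sub_self]

open scoped Matrix in
/-- Two linear forms in general position with respect to an orbit of the signed permutations. -/
lemma SignedPerm.exists_forms (d : ℕ) [NeZero d] :
    ∃ w p q : Fin d → ℝ,
      (∀ f : SignedPerm d, p ⬝ᵥ (f.mat ℝ).mulVec w ≠ 0 ∧ q ⬝ᵥ (f.mat ℝ).mulVec w ≠ 0 ∧
        p ⬝ᵥ (f.mat ℝ).mulVec w ≠ q ⬝ᵥ w ∧ q ⬝ᵥ (f.mat ℝ).mulVec w ≠ p ⬝ᵥ w) ∧
      ∀ f : SignedPerm d, f ≠ 1 → p ⬝ᵥ (f.mat ℝ).mulVec w ≠ p ⬝ᵥ w ∧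
        q ⬝ᵥ (f.mat ℝ).mulVec w ≠ q ⬝ᵥ w := by
  classical
  obtain ⟨w, hw0, hw⟩ := SignedPerm.exists_forall_mulVec_ne d
  have hfw : ∀ f : SignedPerm d, (f.mat ℝ).mulVec w ≠ 0 := by
    intro f h
    apply hw0
    have : ((f⁻¹).mat ℝ).mulVec ((f.mat ℝ).mulVec w) = w := by
      rw [Matrix.mulVec_mulVec, ← map_mul]; simp
    rw [← this, h, Matrix.mulVec_zero]
  -- All six conditions say that one form `(p, q)` on the doubled space does not vanish on finitely
  -- many nonzero vectors. For `f = 1` the last two are void, and `(w, w)` is a harmless nonzero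
  -- filler.
  let v : Fin 6 × SignedPerm d → (Fin d → ℝ) × (Fin d → ℝ) := fun i =>
    ![((i.2.mat ℝ).mulVec w, 0), (0, (i.2.mat ℝ).mulVec w), ((i.2.mat ℝ).mulVec w, -w),
      (-w, (i.2.mat ℝ).mulVec w), if i.2 = 1 then (w, w) else ((i.2.mat ℝ).mulVec w - w, 0),
      if i.2 = 1 then (w, w) else (0, (i.2.mat ℝ).mulVec w - w)] i.1
  obtain ⟨θ, hθ⟩ := Module.exists_dual_forall_apply_ne_zero (K := ℝ) v (by
    rintro ⟨i, f⟩
    by_cases hf : f = 1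
    · fin_cases i <;> simp [v, hw0, hf]
    · fin_cases i <;> simp [v, hfw, hw0, hf, sub_eq_zero, hw f hf])
  have hsum : ∀ φ : (Fin d → ℝ) →ₗ[ℝ] ℝ, ∃ p : Fin d → ℝ, ∀ x, φ x = p ⬝ᵥ x := by
    refine fun φ => ⟨fun i => φ (Pi.single i 1), fun x => ?_⟩
    rw [LinearMap.pi_apply_eq_sum_univ φ x]
    refine Finset.sum_congr rfl fun i _ => ?_
    rw [smul_eq_mul, mul_comm]
    congr 2
    ext j
    simp [Pi.single_apply, eq_comm]
  obtain ⟨p, hp⟩ := hsum (θ.comp (LinearMap.inl ℝ _ _))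
  obtain ⟨q, hq⟩ := hsum (θ.comp (LinearMap.inr ℝ _ _))
  refine ⟨w, p, q, fun f => ⟨?_, ?_, ?_, ?_⟩, fun f hf => ⟨?_, ?_⟩⟩
  · rw [← hp]; exact hθ (0, f)
  · rw [← hq]; exact hθ (1, f)
  · rw [← hp, ← hq, ne_eq, ← sub_eq_zero]
    convert hθ (2, f) using 1
    simp [v, ← map_sub]
  · rw [← hp, ← hq, ne_eq, ← sub_eq_zero]
    convert hθ (3, f) using 1
    simp [v, ← map_sub]
  · rw [← hp, ← hp, ne_eq, ← sub_eq_zero, ← map_sub]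
    simpa [v, hf] using hθ (4, f)
  · rw [← hq, ← hq, ne_eq, ← sub_eq_zero, ← map_sub]
    simpa [v, hf] using hθ (5, f)

end Generic

/-! ### How elements of `ℤ × F` move a thin cone. -/

section Moves

variable {d : ℕ} {M : Type} [Fintype M]

/-- The vector with first block `w`, last coordinate `β`, and zeros elsewhere. -/
def endVec {R : Type*} [Zero R] (M : Type) (w : Fin d → R) (β : R) : BlockIdx d M → R :=
  Sum.elim w (Sum.elim 0 fun _ => β)

lemma norm_endVec_le (w : Fin d → ℂ) (β : ℂ) : ‖endVec M w β‖ ≤ ‖w‖ + ‖β‖ := by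
  refine (sum_norm_le_iff (by positivity)).2 ⟨by simp [endVec],
    (sum_norm_le_iff (by positivity)).2 ⟨?_, ?_⟩⟩
  · have : (endVec M w β ∘ Sum.inr) ∘ Sum.inl = 0 := by ext i; simp [endVec]
    rw [this, norm_zero]; positivity
  · refine (pi_norm_le_iff_of_nonneg (by positivity)).2 fun i => ?_
    simp [endVec]

variable [DecidableEq M]

/-- `Q` and `Q'` are close to `1`; the blocks `D` and `D'` are, respectively, bounded and close to
a block diagonal matrix whose last entry is large; the scalar `μ` is large. -/
structure NearTorus (ℓ δ : ℝ) (Q Q' : Matrix (BlockIdx d M) (BlockIdx d M) ℂ) (μ : ℂ)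
    (D D' : Matrix (M ⊕ Unit) (M ⊕ Unit) ℂ) : Prop where
  norm_sub_le : ∀ x, ‖Q.mulVec x - x‖ ≤ δ * ‖x‖
  norm_sub_le' : ∀ x, ‖Q'.mulVec x - x‖ ≤ δ * ‖x‖
  le_norm : ℓ ≤ ‖μ‖
  norm_le : ∀ x, ‖D.mulVec x‖ ≤ 2 * ‖x‖
  exists_near : ∃ N : Matrix (M ⊕ Unit) (M ⊕ Unit) ℂ,
    (∀ x, ‖D'.mulVec x - N.mulVec x‖ ≤ ‖x‖) ∧
    (∀ x, ‖(N.mulVec x) ∘ Sum.inl‖ ≤ 2 * ‖x ∘ Sum.inl‖) ∧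
    ∀ x, (ℓ + 1) * ‖x (.inr ())‖ ≤ ‖N.mulVec x (.inr ())‖

/-- Applying a matrix near `1` at most triples the width of a cone. This is used once for each of
the two conjugating matrices. -/
lemma norm_mulVec_sub_smul_le {ι : Type*} [Fintype ι] {Q : Matrix ι ι ℂ} {δ η : ℝ}
    (hQ : ∀ x, ‖Q.mulVec x - x‖ ≤ δ * ‖x‖) (hδ : δ ≤ 1) {e x : ι → ℂ} {a : ℂ}
    (he : δ * ‖e‖ ≤ η) (hx : ‖x - a • e‖ ≤ η * ‖a‖) :
    ‖Q.mulVec x - a • e‖ ≤ 3 * η * ‖a‖ := by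
  have h1 : Q.mulVec x - a • e =
      (Q.mulVec (x - a • e) - (x - a • e)) + (x - a • e) + a • (Q.mulVec e - e) := by
    rw [Matrix.mulVec_sub, Matrix.mulVec_smul, smul_sub]; abel
  rw [h1]
  calc _ ≤ ‖Q.mulVec (x - a • e) - (x - a • e)‖ + ‖x - a • e‖ + ‖a • (Q.mulVec e - e)‖ :=
        norm_add₃_le
    _ ≤ 1 * (η * ‖a‖) + η * ‖a‖ + ‖a‖ * η := by
        gcongr
        · exact (hQ _).trans (mul_le_mul hδ hx (norm_nonneg _) (by norm_num))
        · rw [norm_smul]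
          gcongr
          exact (hQ _).trans he
    _ = _ := by ring

/-- The elements of `ℤ × F` move a neighbourhood of the line through `endVec M w β` close to
finitely many lines. -/
lemma exists_moves (w : Fin d → ℂ) {β : ℂ} (hβ : β ≠ 0) {ε : ℝ} (hε : 0 < ε) :
    ∃ c η δ ℓ₀ : ℝ, 0 < c ∧ c ≤ 1 ∧ 0 < η ∧ 0 < δ ∧ ∀ ℓ, ℓ₀ ≤ ℓ →
      ∀ (Q Q' : Matrix (BlockIdx d M) (BlockIdx d M) ℂ) (μ : ℂ)
        (D D' : Matrix (M ⊕ Unit) (M ⊕ Unit) ℂ), NearTorus ℓ δ Q Q' μ D D' →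
      ∀ (y : BlockIdx d M → ℂ) (a : ℂ), ‖y - a • endVec M w β‖ ≤ η * ‖a‖ → ∀ f : SignedPerm d,
        ‖(Q * f.blockMat ℂ M * Q').mulVec y - a • endVec M ((f.mat ℂ).mulVec w) β‖ ≤ ε * ‖a‖ ∧
        (∀ k : ℕ, k ≠ 0 → ∃ m : ℂ, c * 2 ^ k * ‖a‖ ≤ ‖m‖ ∧
          ‖(Q * Matrix.fromBlocks (μ • 1) 0 0 D ^ k * f.blockMat ℂ M * Q').mulVec y -
            m • endVec M ((f.mat ℂ).mulVec w) 0‖ ≤ ε * ‖m‖) ∧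
        (∀ k : ℕ, k ≠ 0 → ∃ m : ℂ, c * 2 ^ k * ‖a‖ ≤ ‖m‖ ∧
          ‖(Q * Matrix.fromBlocks (μ⁻¹ • 1) 0 0 D' ^ k * f.blockMat ℂ M * Q').mulVec y -
            m • endVec M (0 : Fin d → ℂ) 1‖ ≤ ε * ‖m‖) := by
  have hβ0 : 0 < ‖β‖ := norm_pos_iff.2 hβ
  set R : ℝ := ‖w‖ + ‖β‖ + 1 with hR
  have hR1 : 1 ≤ R := by rw [hR]; linarith [norm_nonneg w]
  have hR0 : 0 < R := by linarith
  set ε₁ : ℝ := ε / 3 with hε₁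
  have hε₁0 : 0 < ε₁ := by positivity
  set η₁ : ℝ := min (ε₁ / 2) (min (‖β‖ / 2) 1) with hη₁
  have hη₁0 : 0 < η₁ := by positivity
  have hη₁a : η₁ ≤ ε₁ / 2 := min_le_left _ _
  have hη₁b : η₁ ≤ ‖β‖ / 2 := (min_le_right _ _).trans (min_le_left _ _)
  have hη₁c : η₁ ≤ 1 := (min_le_right _ _).trans (min_le_right _ _)
  -- The divisions by `3` pay for the conjugating matrices. The three lower bounds on `ℓ` give cone
  -- invariance for the last coordinate, closeness for positive powers, and closeness for negative
  -- powers.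
  refine ⟨min 1 (‖β‖ / 2), η₁ / 3, η₁ / 3 / R, max 3 (max (4 * R / ε₁) ((2 * R / ‖β‖ + 3) / ε₁)),
    by positivity, min_le_left _ _, by positivity, by positivity, ?_⟩
  intro ℓ hℓ Q Q' μ D D' H y a hy f
  have hℓ3 : 3 ≤ ℓ := (le_max_left _ _).trans hℓ
  have hℓ0 : 0 < ℓ := by linarith
  have hℓ4 : 2 / ℓ * R ≤ ε₁ / 2 := by
    have := ((le_max_left _ _).trans (le_max_right _ _)).trans hℓ
    rw [div_le_iff₀ hε₁0] at this
    rw [div_mul_eq_mul_div, div_le_iff₀ hℓ0]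
    linarith
  have hℓ5 : (2 * R / ‖β‖ + 3) / ℓ ≤ ε₁ := by
    have := ((le_max_right _ _).trans (le_max_right _ _)).trans hℓ
    rw [div_le_iff₀ hε₁0] at this
    rw [div_le_iff₀ hℓ0]
    linarith
  have hδ1 : η₁ / 3 / R ≤ 1 := by
    rw [div_le_one hR0]; linarith
  have hδR : ∀ e : BlockIdx d M → ℂ, ‖e‖ ≤ R → η₁ / 3 / R * ‖e‖ ≤ η₁ / 3 := by
    intro e he
    rw [div_mul_eq_mul_div, div_le_iff₀ hR0]
    gcongr
  have hfw := f.norm_mulVec_le w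
  set x := (f.blockMat ℂ M).mulVec (Q'.mulVec y) with hx
  have hxa : ‖x - a • endVec M ((f.mat ℂ).mulVec w) β‖ ≤ η₁ * ‖a‖ := by
    have h1 : (f.blockMat ℂ M).mulVec (endVec M w β) = endVec M ((f.mat ℂ).mulVec w) β := by
      rw [f.blockMat_mulVec]; rfl
    rw [hx, ← h1, ← Matrix.mulVec_smul, ← Matrix.mulVec_sub]
    refine (f.norm_blockMat_mulVec_le _).trans ?_
    have := norm_mulVec_sub_smul_le H.norm_sub_le' hδ1
      (hδR (endVec M w β) ((norm_endVec_le _ _).trans (by linarith))) hy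
    linarith
  have hpost : ∀ (z e : BlockIdx d M → ℂ) (m : ℂ), ‖e‖ ≤ R → ‖z - m • e‖ ≤ ε₁ * ‖m‖ →
      ‖Q.mulVec z - m • e‖ ≤ ε * ‖m‖ := by
    intro z e m he hz
    have := norm_mulVec_sub_smul_le H.norm_sub_le hδ1 ((hδR e he).trans (by linarith)) hz
    rw [hε₁] at this
    linarith
  have hxt : ‖x ∘ Sum.inl - a • (f.mat ℂ).mulVec w‖ ≤ η₁ * ‖a‖ := (norm_comp_inl_le _).trans hxa
  have hxr := (norm_comp_inr_le _).trans hxa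
  have hxm : ‖x ∘ Sum.inr ∘ Sum.inl‖ ≤ η₁ * ‖a‖ := by
    refine le_trans (le_of_eq ?_) ((norm_comp_inl_le _).trans hxr)
    congr 1
    ext i; simp [endVec]
  have hxb : ‖x (.inr (.inr ())) - a * β‖ ≤ η₁ * ‖a‖ :=
    (norm_le_pi_norm (x - a • endVec M ((f.mat ℂ).mulVec w) β) (.inr (.inr ()))).trans hxa
  refine ⟨?_, fun k hk => ?_, fun k hk => ?_⟩
  · rw [← Matrix.mulVec_mulVec, ← Matrix.mulVec_mulVec]
    refine hpost _ _ _ ((norm_endVec_le _ _).trans (by linarith)) (hxa.trans ?_)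
    gcongr; linarith
  · rw [← Matrix.mulVec_mulVec, ← Matrix.mulVec_mulVec, ← Matrix.mulVec_mulVec]
    have hμ : 2 ≤ ‖μ‖ := by linarith [H.le_norm]
    have hn : ‖μ ^ k * a‖ = ‖μ‖ ^ k * ‖a‖ := by rw [norm_mul, norm_pow]
    refine ⟨μ ^ k * a, ?_, hpost _ _ _
      ((norm_endVec_le _ _).trans (by rw [norm_zero]; linarith)) ?_⟩
    · rw [hn]
      gcongr
      calc min 1 (‖β‖ / 2) * 2 ^ k ≤ 1 * ‖μ‖ ^ k := by
            gcongr; exact min_le_left _ _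
        _ = _ := one_mul _
    · have h1 := norm_scalar_block_pow_sub_le H.norm_le hμ hk x (a • (f.mat ℂ).mulVec w)
      have h2 : μ ^ k • (Sum.elim (a • (f.mat ℂ).mulVec w) 0 : BlockIdx d M → ℂ) =
          (μ ^ k * a) • endVec M ((f.mat ℂ).mulVec w) 0 := by
        rw [mul_smul]
        congr 1
        ext i
        rcases i with i | i | i <;> simp [endVec]
      rw [h2] at h1
      refine h1.trans ?_
      have h3 : ‖x ∘ Sum.inr‖ ≤ R * ‖a‖ := by
        refine (sum_norm_le_iff (by positivity)).2 ⟨hxm.trans (by gcongr; linarith), ?_⟩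
        refine (pi_norm_le_iff_of_nonneg (by positivity)).2 fun i => ?_
        have := norm_sub_norm_le (x (.inr (.inr ()))) (a * β)
        rw [norm_mul] at this
        change ‖x (.inr (.inr ()))‖ ≤ _
        calc _ ≤ (η₁ + ‖β‖) * ‖a‖ := by linarith
          _ ≤ _ := by gcongr; linarith [norm_nonneg w]
      rw [hn]
      calc ‖μ‖ ^ k * (‖x ∘ Sum.inl - a • (f.mat ℂ).mulVec w‖ + 2 / ‖μ‖ * ‖x ∘ Sum.inr‖)
          ≤ ‖μ‖ ^ k * (η₁ * ‖a‖ + 2 / ℓ * (R * ‖a‖)) := by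
            gcongr
            exact H.le_norm
        _ = (η₁ + 2 / ℓ * R) * (‖μ‖ ^ k * ‖a‖) := by ring
        _ ≤ ε₁ * (‖μ‖ ^ k * ‖a‖) := by gcongr; linarith
  · rw [← Matrix.mulVec_mulVec, ← Matrix.mulVec_mulVec, ← Matrix.mulVec_mulVec]
    obtain ⟨N, hN1, hN2, hN3⟩ := H.exists_near
    have hμ : ‖μ⁻¹‖ ≤ 1 := by
      rw [norm_inv]; exact inv_le_one_of_one_le₀ (by linarith [H.le_norm])
    -- This is where `β ≠ 0` enters: negative powers need a nonzero last coordinate to expand.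
    have hb : ‖β‖ / 2 * ‖a‖ ≤ ‖x (.inr (.inr ()))‖ := by
      have h1 := norm_sub_norm_le (a * β) (x (.inr (.inr ())))
      rw [norm_sub_rev, norm_mul] at h1
      have h2 : η₁ * ‖a‖ ≤ ‖β‖ / 2 * ‖a‖ := by gcongr
      linarith
    obtain ⟨m, hm, hm'⟩ := norm_scalar_block_pow_sub_last_le hμ hℓ3 hN1 hN2 hN3
      (hxm.trans (le_trans (by gcongr) hb)) hk
    have hℓk : ℓ ≤ ℓ ^ k := le_self_pow₀ (by linarith) hk
    refine ⟨m, le_trans ?_ hm, hpost _ _ _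
      ((norm_endVec_le _ _).trans (by rw [norm_zero, norm_one]; linarith [norm_nonneg w])) ?_⟩
    · calc min 1 (‖β‖ / 2) * 2 ^ k * ‖a‖ ≤ ‖β‖ / 2 * ℓ ^ k * ‖a‖ := by
            gcongr
            · exact min_le_right _ _
            · linarith
        _ = ℓ ^ k * (‖β‖ / 2 * ‖a‖) := by ring
        _ ≤ _ := by gcongr
    · refine hm'.trans ?_
      have h1 : ‖x ∘ Sum.inl‖ ≤ R * ‖a‖ := by
        have h2 := norm_sub_norm_le (x ∘ Sum.inl) (a • (f.mat ℂ).mulVec w)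
        rw [norm_smul] at h2
        calc _ ≤ η₁ * ‖a‖ + ‖a‖ * ‖w‖ := by
              have : ‖a‖ * ‖(f.mat ℂ).mulVec w‖ ≤ ‖a‖ * ‖w‖ := by gcongr
              linarith
          _ = (η₁ + ‖w‖) * ‖a‖ := by ring
          _ ≤ _ := by gcongr; linarith
      have h2 : ‖a‖ ≤ 2 / ‖β‖ / ℓ * ‖m‖ := by
        have : ℓ * (‖β‖ / 2 * ‖a‖) ≤ ‖m‖ := le_trans (by gcongr) hm
        rw [div_div, div_mul_eq_mul_div, le_div_iff₀ (by positivity)]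
        linarith
      calc ‖x ∘ Sum.inl‖ + 3 / ℓ * ‖m‖ ≤ R * (2 / ‖β‖ / ℓ * ‖m‖) + 3 / ℓ * ‖m‖ := by
            refine add_le_add (h1.trans ?_) le_rfl
            gcongr
        _ = (2 * R / ‖β‖ + 3) / ℓ * ‖m‖ := by field_simp
        _ ≤ _ := by gcongr

end Moves

/-! ### Frames with prescribed extreme vectors and forms. -/

section Frame

open scoped Matrix

lemma finrank_ker_inf_ker {V : Type*} [AddCommGroup V] [Module ℝ V] [FiniteDimensional ℝ V]
    (φ ψ : V →ₗ[ℝ] ℝ) {v u : V} (hφu : φ u = 0) (hψv : ψ v = 0) (hφv : φ v ≠ 0) (hψu : ψ u ≠ 0) :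
    Module.finrank ℝ (φ.prod ψ).ker + 2 = Module.finrank ℝ V := by
  have h := (φ.prod ψ).finrank_range_add_finrank_ker
  have hsurj : (φ.prod ψ).range = ⊤ := by
    rw [LinearMap.range_eq_top]
    rintro ⟨a, b⟩
    refine ⟨(a / φ v) • v + (b / ψ u) • u, ?_⟩
    simp [hφu, hψv, hφv, hψu]
  rw [hsurj, finrank_top, Module.finrank_prod, Module.finrank_self] at h
  omega

/-- A frame whose first and last vectors, and first and last coordinate forms, are prescribed up to
scale. -/
lemma exists_frame {J M' : Type} [Fintype J] [DecidableEq J] [Fintype M'] [DecidableEq M']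
    (hcard : Fintype.card M' + 2 = Fintype.card J) {v u φ ψ : J → ℝ}
    (hφu : φ ⬝ᵥ u = 0) (hψv : ψ ⬝ᵥ v = 0) (hφv : φ ⬝ᵥ v ≠ 0) (hψu : ψ ⬝ᵥ u ≠ 0) :
    ∃ (G : Matrix J (BlockIdx 1 M') ℝ) (H : Matrix (BlockIdx 1 M') J ℝ), G * H = 1 ∧ H * G = 1 ∧
      (∀ i, G i (.inl 0) = v i) ∧ (∀ i, G i (.inr (.inr ())) = u i) ∧
      (∀ j, H (.inl 0) j = (φ ⬝ᵥ v)⁻¹ * φ j) ∧ ∀ j, H (.inr (.inr ())) j = (ψ ⬝ᵥ u)⁻¹ * ψ j := by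
  let Φ : (J → ℝ) →ₗ[ℝ] ℝ := dotProductBilin ℝ ℝ φ
  let Ψ : (J → ℝ) →ₗ[ℝ] ℝ := dotProductBilin ℝ ℝ ψ
  have hΦ : ∀ x, Φ x = φ ⬝ᵥ x := fun x => rfl
  have hΨ : ∀ x, Ψ x = ψ ⬝ᵥ x := fun x => rfl
  have hK := finrank_ker_inf_ker Φ Ψ (v := v) (u := u) hφu hψv hφv hψu
  -- The middle vectors of the frame may be any basis of the common kernel of the two forms.
  let κ : (M' → ℝ) ≃ₗ[ℝ] (Φ.prod Ψ).ker := LinearEquiv.ofFinrankEq _ _ (by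
    rw [Module.finrank_fintype_fun_eq_card] at hK ⊢
    omega)
  have hκ : ∀ x, Φ (κ x) = 0 ∧ Ψ (κ x) = 0 := by
    intro x
    have := LinearMap.mem_ker.1 (κ x).2
    exact ⟨congrArg Prod.fst this, congrArg Prod.snd this⟩
  let g : (BlockIdx 1 M' → ℝ) →ₗ[ℝ] (J → ℝ) :=
    (LinearMap.proj (Sum.inl 0)).smulRight v + (LinearMap.proj (Sum.inr (Sum.inr ()))).smulRight u +
      (Φ.prod Ψ).ker.subtype.comp (κ.toLinearMap.comp (LinearMap.funLeft ℝ ℝ (Sum.inr ∘ Sum.inl)))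
  have hg : ∀ y, g y = y (.inl 0) • v + y (.inr (.inr ())) • u +
      (κ (y ∘ Sum.inr ∘ Sum.inl) : J → ℝ) := fun y => rfl
  have hΦg : ∀ y, Φ (g y) = y (.inl 0) * (φ ⬝ᵥ v) := by
    intro y
    rw [hg, map_add, map_add, map_smul, map_smul, (hκ _).1, hΦ, hΦ, hφu]
    simp
  have hΨg : ∀ y, Ψ (g y) = y (.inr (.inr ())) * (ψ ⬝ᵥ u) := by
    intro y
    rw [hg, map_add, map_add, map_smul, map_smul, (hκ _).2, hΨ, hΨ, hψv]
    simp
  have hinj : Function.Injective g := by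
    rw [← LinearMap.ker_eq_bot, LinearMap.ker_eq_bot']
    intro y hy
    have h1 : y (.inl 0) = 0 := by
      have := hΦg y
      rw [hy, map_zero] at this
      exact (mul_eq_zero.1 this.symm).resolve_right hφv
    have h2 : y (.inr (.inr ())) = 0 := by
      have := hΨg y
      rw [hy, map_zero] at this
      exact (mul_eq_zero.1 this.symm).resolve_right hψu
    rw [hg, h1, h2, zero_smul, zero_smul, zero_add, zero_add] at hy
    have h3 : y ∘ Sum.inr ∘ Sum.inl = 0 := by
      have : κ (y ∘ Sum.inr ∘ Sum.inl) = 0 := Subtype.ext hy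
      simpa using this
    ext i
    rcases i with i | i | ⟨⟩
    · rw [Subsingleton.elim i 0, h1]; rfl
    · exact congrFun h3 i
    · exact h2
  let e : (BlockIdx 1 M' → ℝ) ≃ₗ[ℝ] (J → ℝ) := LinearEquiv.ofInjectiveOfFinrankEq g hinj (by
    simp; omega)
  have he : ∀ y, e y = g y := fun y => rfl
  refine ⟨LinearMap.toMatrix' e.toLinearMap, LinearMap.toMatrix' e.symm.toLinearMap, ?_, ?_,
    ?_, ?_, ?_, ?_⟩
  · rw [← LinearMap.toMatrix'_comp]; simp
  · rw [← LinearMap.toMatrix'_comp]; simp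
  · intro i
    rw [LinearMap.toMatrix'_apply]
    change e _ i = _
    rw [he, hg]
    have : (Pi.single (Sum.inl 0) 1 : BlockIdx 1 M' → ℝ) ∘ Sum.inr ∘ Sum.inl = 0 := by ext i; simp
    simp [this]
  · intro i
    rw [LinearMap.toMatrix'_apply]
    change e _ i = _
    rw [he, hg]
    have : (Pi.single (Sum.inr (Sum.inr ())) 1 : BlockIdx 1 M' → ℝ) ∘ Sum.inr ∘ Sum.inl = 0 := by
      ext i; simp
    simp [this]
  · intro j
    rw [LinearMap.toMatrix'_apply]
    have := hΦg (e.symm (Pi.single j 1))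
    rw [← he, e.apply_symm_apply, hΦ, dotProduct_single_one] at this
    rw [this, mul_comm, mul_assoc, mul_inv_cancel₀ hφv, mul_one]
    rfl
  · intro j
    rw [LinearMap.toMatrix'_apply]
    have := hΨg (e.symm (Pi.single j 1))
    rw [← he, e.apply_symm_apply, hΨ, dotProduct_single_one] at this
    rw [this, mul_comm, mul_assoc, mul_inv_cancel₀ hψu, mul_one]
    rfl

end Frame

/-! ### Attracting lines and repelling hyperplanes. -/

section Attraction

open Filter Topology

variable {V : Type*} [NormedAddCommGroup V] [NormedSpace ℂ V]

/-- Vectors close to a line on which a linear form does not vanish are far from the kernel of the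
form. -/
lemma eventually_cone_subset (φ : V →L[ℂ] ℂ) {e : V} (he : φ e ≠ 0) :
    ∀ᶠ ε in 𝓝[>] (0 : ℝ), ∀ (y : V) (m : ℂ), ‖y - m • e‖ ≤ ε * ‖m‖ →
      ε * ‖y‖ ≤ ‖φ y‖ ∧ ε * ‖m‖ ≤ ‖y‖ := by
  have he0 : 0 < ‖φ e‖ := norm_pos_iff.2 he
  set C := ‖φ‖ + 1 with hC
  have hC0 : 0 < C := by positivity
  have h1 : ∀ᶠ ε in 𝓝[>] (0 : ℝ), ε < ‖φ e‖ / (2 * C) :=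
    nhdsWithin_le_nhds (eventually_lt_nhds (by positivity))
  have h2 : ∀ᶠ ε in 𝓝[>] (0 : ℝ), ε < ‖φ e‖ / (2 * (‖e‖ + 1)) :=
    nhdsWithin_le_nhds (eventually_lt_nhds (by positivity))
  have h3 : ∀ᶠ ε in 𝓝[>] (0 : ℝ), ε < 1 := nhdsWithin_le_nhds (eventually_lt_nhds (by norm_num))
  filter_upwards [h1, h2, h3, self_mem_nhdsWithin] with ε h1 h2 h3 h0 y m hy
  have h0 : 0 < ε := h0
  rw [lt_div_iff₀ (by positivity)] at h1 h2
  have hφ : ∀ x, ‖φ x‖ ≤ C * ‖x‖ := fun x =>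
    (φ.le_opNorm x).trans (by gcongr; linarith)
  have h4 : ‖φ e‖ / 2 * ‖m‖ ≤ ‖φ y‖ := by
    have e1 : φ y = m * φ e - (-φ (y - m • e)) := by simp
    have e2 := norm_sub_norm_le (m * φ e) (-φ (y - m • e))
    rw [← e1, norm_neg, norm_mul] at e2
    have e3 := (hφ _).trans (mul_le_mul_of_nonneg_left hy hC0.le)
    nlinarith [norm_nonneg m]
  constructor
  · refine le_trans ?_ h4
    have e1 : ‖y‖ ≤ (‖e‖ + 1) * ‖m‖ := by
      have := norm_sub_norm_le y (m • e)
      rw [norm_smul] at this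
      nlinarith [norm_nonneg m]
    calc ε * ‖y‖ ≤ ε * ((‖e‖ + 1) * ‖m‖) := by gcongr
      _ = (ε * (2 * (‖e‖ + 1))) / 2 * ‖m‖ := by ring
      _ ≤ _ := by gcongr
  · have := h4.trans (hφ y)
    refine le_of_mul_le_mul_left ?_ hC0
    refine le_trans ?_ this
    calc C * (ε * ‖m‖) = (ε * (2 * C)) / 2 * ‖m‖ := by ring
      _ ≤ _ := by gcongr

/-- A perturbation of a large multiple of a rank one map contracts the vectors away from its kernel
to a neighbourhood of its image, and expands them. -/
lemma exists_attracting {v : V} (hv : v ≠ 0) {k κ η C : ℝ} (hk : k ≠ 0) (hκ : 0 < κ) (hη : 0 < η)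
    (Λ : ℝ) (φ : V →L[ℂ] ℂ) :
    ∃ L₀ : ℝ, ∀ L, L₀ ≤ L → ∀ A : Module.End ℂ V,
      (∀ x, ‖A x - ((L * k : ℝ) * φ x) • v‖ ≤ C * ‖x‖) → ∀ x, κ * ‖x‖ ≤ ‖φ x‖ →
        (∃ c : ℂ, ‖A x - c • v‖ ≤ η * ‖c‖) ∧ Λ * ‖x‖ ≤ ‖A x‖ := by
  have hv0 : 0 < ‖v‖ := norm_pos_iff.2 hv
  have hk0 : 0 < |k| := abs_pos.2 hk
  -- The first quotient makes the error small relative to the rank one term, the second yields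
  -- expansion by `Λ`. Since `C` is fixed before `L`, there is no circularity.
  refine ⟨max 0 (max (C / (η * (|k| * κ))) ((Λ + C) / (|k| * κ * ‖v‖))),
    fun L hL A hA x hx => ?_⟩
  have hL0 : 0 ≤ L := (le_max_left _ _).trans hL
  have hL1 := ((le_max_left _ _).trans (le_max_right _ _)).trans hL
  have hL2 := ((le_max_right _ _).trans (le_max_right _ _)).trans hL
  rw [div_le_iff₀ (by positivity)] at hL1 hL2
  set c : ℂ := ((L * k : ℝ) * φ x) with hc
  have hcn : L * (|k| * κ) * ‖x‖ ≤ ‖c‖ := by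
    rw [hc, norm_mul, Complex.norm_real, Real.norm_eq_abs, abs_mul, abs_of_nonneg hL0]
    calc _ = L * |k| * (κ * ‖x‖) := by ring
      _ ≤ _ := by gcongr
  refine ⟨⟨c, (hA x).trans ?_⟩, ?_⟩
  · calc C * ‖x‖ ≤ L * (η * (|k| * κ)) * ‖x‖ := by gcongr
      _ = η * (L * (|k| * κ) * ‖x‖) := by ring
      _ ≤ _ := by gcongr
  · have h1 := norm_sub_norm_le (c • v) (A x)
    rw [norm_sub_rev, norm_smul] at h1
    have h2 : (Λ + C) * ‖x‖ ≤ ‖c‖ * ‖v‖ := by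
      calc (Λ + C) * ‖x‖ ≤ L * (|k| * κ * ‖v‖) * ‖x‖ := by gcongr
        _ = L * (|k| * κ) * ‖x‖ * ‖v‖ := by ring
        _ ≤ _ := by gcongr
    have h3 := hA x
    linarith

lemma attracting_pow {A : Module.End ℂ V} {N D : Set V} {Λ : ℝ} (hΛ : 0 ≤ Λ) (hND : N ⊆ D)
    (h : ∀ x ∈ D, A x ∈ N ∧ Λ * ‖x‖ ≤ ‖A x‖) {k : ℕ} (hk : k ≠ 0) :
    ∀ x ∈ D, (A ^ k) x ∈ N ∧ Λ ^ k * ‖x‖ ≤ ‖(A ^ k) x‖ := by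
  obtain ⟨j, rfl⟩ := Nat.exists_eq_succ_of_ne_zero hk
  clear hk
  induction j with
  | zero => simpa using h
  | succ j ih =>
    intro x hx
    obtain ⟨h1, h2⟩ := ih x hx
    obtain ⟨h3, h4⟩ := h _ (hND h1)
    rw [pow_succ' A, pow_succ' Λ]
    refine ⟨h3, le_trans ?_ h4⟩
    rw [mul_assoc]
    gcongr

end Attraction

/-! ### Perturbed matrices and representations of finite groups. -/

section Perturbation

open Filter Topology

variable {X : Type*} {l : Filter X}

lemma eventually_norm_mulVec_sub_le {ι κ : Type*} [Fintype ι] [Fintype κ]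
    {A : X → Matrix ι κ ℂ} {A₀ : Matrix ι κ ℂ} (h : Tendsto A l (𝓝 A₀)) {δ : ℝ} (hδ : 0 < δ) :
    ∀ᶠ x in l, ∀ v, ‖(A x).mulVec v - A₀.mulVec v‖ ≤ δ * ‖v‖ := by
  set r := δ / (Fintype.card κ + 1) with hr
  have hr0 : 0 < r := by positivity
  have h1 : ∀ᶠ x in l, ∀ i j, ‖A x i j - A₀ i j‖ < r := by
    refine eventually_all.2 fun i => eventually_all.2 fun j => ?_
    have h2 : Tendsto (fun x => A x i j) l (𝓝 (A₀ i j)) :=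
      ((continuous_apply_apply i j).tendsto A₀).comp h
    have := (Metric.tendsto_nhds.1 h2) r hr0
    simpa [dist_eq_norm] using this
  filter_upwards [h1] with x hx v
  refine (pi_norm_le_iff_of_nonneg (by positivity)).2 fun i => ?_
  rw [← Matrix.sub_mulVec]
  calc ‖(A x - A₀).mulVec v i‖ ≤ ∑ j, ‖(A x - A₀) i j * v j‖ :=
        norm_sum_le Finset.univ fun j => (A x - A₀) i j * v j
    _ ≤ ∑ _j : κ, r * ‖v‖ := by
        refine Finset.sum_le_sum fun j _ => ?_
        rw [norm_mul]
        exact mul_le_mul (hx i j).le (norm_le_pi_norm v j) (norm_nonneg _) hr0.le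
    _ = Fintype.card κ / (Fintype.card κ + 1) * (δ * ‖v‖) := by
        rw [Finset.sum_const, Finset.card_univ, nsmul_eq_mul, hr]; ring
    _ ≤ 1 * (δ * ‖v‖) := by
        gcongr
        rw [div_le_one (by positivity)]
        linarith
    _ = _ := one_mul _

lemma tendsto_matrix_inv_one {ι : Type*} [Fintype ι] [DecidableEq ι]
    {P : X → Matrix ι ι ℂ} (h : Tendsto P l (𝓝 1)) :
    Tendsto (fun x => (P x)⁻¹) l (𝓝 1) ∧ ∀ᶠ x in l, P x * (P x)⁻¹ = 1 ∧ (P x)⁻¹ * P x = 1 := by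
  have hdet : Tendsto (fun x => (P x).det) l (𝓝 1) := by
    have := ((Continuous.matrix_det continuous_id).tendsto (1 : Matrix ι ι ℂ)).comp h
    simpa [Function.comp_def] using this
  constructor
  · have hadj : Tendsto (fun x => (P x).adjugate) l (𝓝 1) := by
      have := ((Continuous.matrix_adjugate continuous_id).tendsto (1 : Matrix ι ι ℂ)).comp h
      simpa [Function.comp_def] using this
    have h1 := (hdet.inv₀ one_ne_zero).smul hadj
    rw [inv_one, one_smul] at h1
    refine h1.congr fun x => ?_
    rw [Matrix.inv_def, Ring.inverse_eq_inv']
  · filter_upwards [hdet.eventually_ne one_ne_zero] with x hx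
    exact ⟨Matrix.mul_nonsing_inv _ (isUnit_iff_ne_zero.2 hx),
      Matrix.nonsing_inv_mul _ (isUnit_iff_ne_zero.2 hx)⟩

/-- Representations of a finite group that are close to each other are conjugate by an element
close to the identity. -/
lemma exists_intertwiner {F ι : Type*} [Group F] [Finite F] [Fintype ι] [DecidableEq ι]
    {R : X → (F →* Matrix ι ι ℂ)} {R₀ : F →* Matrix ι ι ℂ}
    (h : ∀ f, Tendsto (fun x => R x f) l (𝓝 (R₀ f))) :
    ∃ P P' : X → Matrix ι ι ℂ, Tendsto P l (𝓝 1) ∧ Tendsto P' l (𝓝 1) ∧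
      ∀ᶠ x in l, P x * P' x = 1 ∧ P' x * P x = 1 ∧ ∀ f, R x f * P x = P x * R₀ f := by
  have := Fintype.ofFinite F
  -- Averaging over the group gives an intertwiner; it tends to `1`, hence is eventually invertible.
  let P : X → Matrix ι ι ℂ := fun x => (Fintype.card F : ℂ)⁻¹ • ∑ f, R x f * R₀ f⁻¹
  have hP : Tendsto P l (𝓝 1) := by
    have h1 : Tendsto (fun x => (Fintype.card F : ℂ)⁻¹ • ∑ f, R x f * R₀ f⁻¹) l
        (𝓝 ((Fintype.card F : ℂ)⁻¹ • ∑ f, R₀ f * R₀ f⁻¹)) :=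
      (tendsto_finsetSum _ fun f _ => (h f).mul_const _).const_smul _
    have h2 : (Fintype.card F : ℂ)⁻¹ • ∑ f, R₀ f * R₀ f⁻¹ = 1 := by
      simp only [← map_mul, mul_inv_cancel, map_one, Finset.sum_const, Finset.card_univ]
      rw [← Nat.cast_smul_eq_nsmul ℂ, smul_smul, inv_mul_cancel₀ (by simp), one_smul]
    rwa [h2] at h1
  obtain ⟨h1, h2⟩ := tendsto_matrix_inv_one hP
  refine ⟨P, fun x => (P x)⁻¹, hP, h1, ?_⟩
  filter_upwards [h2] with x hx
  refine ⟨hx.1, hx.2, fun f => ?_⟩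
  simp only [P]
  rw [Matrix.mul_smul, Matrix.smul_mul, Finset.mul_sum, Finset.sum_mul]
  congr 1
  rw [← Equiv.sum_comp (Equiv.mulLeft f) fun g => R x g * R₀ g⁻¹ * R₀ f]
  refine Finset.sum_congr rfl fun g _ => ?_
  simp only [Equiv.coe_mulLeft, map_mul, mul_inv_rev, mul_assoc]
  rw [← map_mul R₀ f⁻¹ f, inv_mul_cancel, map_one, mul_one]

end Perturbation

/-! ### Block form of `ℤ × F` near the model. -/

section NearTorusOfTendsto

open Filter Topology

variable {X : Type*} {l : Filter X} {d b s : ℕ}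

lemma cLin_apply {ι : Type*} [Fintype ι] (A : Matrix ι ι ℝ) (x : ι → ℂ) :
    cLin A x = (A.map Complex.ofReal).mulVec x := rfl

lemma fromBlocks_mulVec_inr {μ : ℂ} {D : Matrix (RotIdx b s ⊕ Unit) (RotIdx b s ⊕ Unit) ℂ}
    (x : RotIdx b s ⊕ Unit → ℂ) :
    (Matrix.fromBlocks (μ • (1 : Matrix (Fin d) (Fin d) ℂ)) 0 0 D).mulVec
      (Sum.elim (0 : Fin d → ℂ) x) = Sum.elim (0 : Fin d → ℂ) (D.mulVec x) := by
  rw [Matrix.fromBlocks_mulVec]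
  simp

lemma norm_sum_elim_zero (x : RotIdx b s ⊕ Unit → ℂ) :
    ‖(Sum.elim 0 x : BlockIdx d (RotIdx b s) → ℂ)‖ = ‖x‖ := by
  refine le_antisymm ((sum_norm_le_iff (norm_nonneg _)).2 ⟨by simp, le_of_eq (by simp)⟩) ?_
  exact norm_comp_inr_le (Sum.elim 0 x : BlockIdx d (RotIdx b s) → ℂ)

/-- The scalar and the lower blocks are read off by testing on a first-block basis vector and on
vectors without first block. A perturbation of size `1` lowers the rate `lam` to `lam - 1`. -/
lemma nearTorus_of_near [NeZero d] {lam δ : ℝ} (hlam : 4 ≤ lam)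
    {Q Q' : Matrix (BlockIdx d (RotIdx b s)) (BlockIdx d (RotIdx b s)) ℂ} {μ ν : ℂ}
    {D D' : Matrix (RotIdx b s ⊕ Unit) (RotIdx b s ⊕ Unit) ℂ}
    (hQ : ∀ x, ‖Q.mulVec x - x‖ ≤ δ * ‖x‖) (hQ' : ∀ x, ‖Q'.mulVec x - x‖ ≤ δ * ‖x‖)
    (hT : ∀ x, ‖(Matrix.fromBlocks (μ • 1) 0 0 D).mulVec x -
      cLin (stdMat d b s lam 1 (1 / 2) lam⁻¹) x‖ ≤ 1 * ‖x‖)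
    (hS : ∀ x, ‖(Matrix.fromBlocks (ν • 1) 0 0 D').mulVec x -
      cLin (stdMat d b s lam⁻¹ (-1) 2 lam) x‖ ≤ 1 * ‖x‖) :
    NearTorus (lam - 1) δ Q Q' μ D D' := by
  have hlam0 : 0 < lam := by linarith
  have hlam' : lam⁻¹ ≤ 1 := inv_le_one_of_one_le₀ (by linarith)
  refine ⟨hQ, hQ', ?_, fun x => ?_, (stdMat d b s lam⁻¹ (-1) 2 lam).toBlocks₂₂.map Complex.ofReal,
    fun x => ?_, fun x => ?_, fun x => ?_⟩
  · have h1 := (norm_le_pi_norm _ (.inl 0)).trans (hT (Pi.single (.inl 0) 1))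
    rw [Pi.sub_apply, cLin_stdMat_top, Matrix.mulVec_single_one] at h1
    simp only [Matrix.col_apply, Matrix.fromBlocks_apply₁₁, Matrix.smul_apply, Matrix.one_apply_eq,
      Pi.single_eq_same, Pi.norm_single, norm_one, smul_eq_mul, mul_one] at h1
    have h2 := norm_sub_norm_le (lam : ℂ) μ
    rw [norm_sub_rev, Complex.norm_real, Real.norm_eq_abs, abs_of_pos hlam0] at h2
    linarith
  · have h1 := hT (Sum.elim 0 x)
    rw [fromBlocks_mulVec_inr, norm_sum_elim_zero] at h1
    have h2 := cLin_stdMat_norm_le (e := d) (a := lam) (ε := 1) (κ := 1 / 2) (β := lam⁻¹) (c := 1)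
      (x := (Sum.elim 0 x : BlockIdx d (RotIdx b s) → ℂ))
      (by norm_num) (by norm_num) (Or.inl fun i => rfl) (Or.inr le_rfl)
      (Or.inr (by rw [abs_of_pos] <;> norm_num)) (Or.inr (by rwa [abs_of_pos (by positivity)]))
    rw [norm_sum_elim_zero] at h2
    have h3 := norm_sub_norm_le (Sum.elim 0 (D.mulVec x) : BlockIdx d (RotIdx b s) → ℂ)
      (cLin (stdMat d b s lam 1 (1 / 2) lam⁻¹) (Sum.elim 0 x))
    rw [norm_sum_elim_zero] at h3
    linarith
  · have h1 := (norm_comp_inr_le _).trans (hS (Sum.elim 0 x))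
    rw [fromBlocks_mulVec_inr, norm_sum_elim_zero, one_mul] at h1
    refine le_trans (le_of_eq ?_) h1
    congr 1
    ext i
    simp [cLin_apply, stdMat, blockMat, Matrix.mulVec, dotProduct]
  · have h2 := cLin_stdMat_norm_le (e := d) (a := lam⁻¹) (ε := -1) (κ := 2) (β := lam) (c := 2)
      (x := (Sum.elim 0 (Sum.elim (x ∘ Sum.inl) 0) : BlockIdx d (RotIdx b s) → ℂ))
      (by norm_num) (by norm_num) (Or.inl fun i => rfl) (Or.inr (by norm_num))
      (Or.inr (by norm_num)) (Or.inl rfl)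
    rw [norm_sum_elim_zero] at h2
    have h3 : ‖(Sum.elim (x ∘ Sum.inl) 0 : RotIdx b s ⊕ Unit → ℂ)‖ ≤ ‖x ∘ Sum.inl‖ :=
      (sum_norm_le_iff (norm_nonneg _)).2 ⟨le_rfl, by rw [Sum.elim_comp_inr]; simp⟩
    refine le_trans (le_of_eq ?_) (((norm_comp_inl_le _).trans (norm_comp_inr_le _)).trans
      (h2.trans (by gcongr)))
    congr 1
    ext i
    simp [cLin_apply, stdMat, blockMat, Matrix.mulVec, dotProduct]
  · simp [stdMat, blockMat, Matrix.mulVec, dotProduct, abs_of_pos hlam0]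

/-- Representations close to the model are conjugate, by matrices close to the identity, to block
diagonal ones on `ℤ × F`. -/
lemma eventually_nearTorus [NeZero d] {lam δ : ℝ} (hlam : 4 ≤ lam) (hδ : 0 < δ)
    {R : X → (FreeProdGroup (SignedPerm d) 1 →*
      Matrix (BlockIdx d (RotIdx b s)) (BlockIdx d (RotIdx b s)) ℂ)}
    (hF : ∀ f, Tendsto (fun x => R x (inF f)) l (𝓝 (f.blockMat ℂ (RotIdx b s))))
    (hT : Tendsto (fun x => R x (genT _)) l
      (𝓝 ((stdMat d b s lam 1 (1 / 2) lam⁻¹).map Complex.ofReal)))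
    (hS : Tendsto (fun x => R x (genT _)⁻¹) l
      (𝓝 ((stdMat d b s lam⁻¹ (-1) 2 lam).map Complex.ofReal))) :
    ∀ᶠ x in l, ∃ Q Q' μ D D', NearTorus (lam - 1) δ Q Q' μ D D' ∧ Q * Q' = 1 ∧ Q' * Q = 1 ∧
      (∀ f, R x (inF f) = Q * f.blockMat ℂ (RotIdx b s) * Q') ∧
      R x (genT _) = Q * Matrix.fromBlocks (μ • 1) 0 0 D * Q' ∧
      R x (genT _)⁻¹ = Q * Matrix.fromBlocks (μ⁻¹ • 1) 0 0 D' * Q' := by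
  obtain ⟨P, P', hP, hP', hPP'⟩ := exists_intertwiner (R := fun x => (R x).comp inF) hF
  have hT' := (hP'.mul hT).mul hP
  have hS' := (hP'.mul hS).mul hP
  rw [one_mul, mul_one] at hT' hS'
  filter_upwards [hPP', eventually_norm_mulVec_sub_le hP hδ, eventually_norm_mulVec_sub_le hP' hδ,
    eventually_norm_mulVec_sub_le hT' one_pos, eventually_norm_mulVec_sub_le hS' one_pos]
    with x ⟨h1, h2, h3⟩ hQ hQ' hT'' hS''
  simp only [Matrix.one_mulVec] at hQ hQ'
  have hconj : ∀ f, R x (inF f) = P x * f.blockMat ℂ (RotIdx b s) * P' x := by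
    intro f
    have := h3 f
    rw [← this, mul_assoc, h1, mul_one]
    rfl
  have hconj' : ∀ f : SignedPerm d, f.blockMat ℂ (RotIdx b s) = P' x * R x (inF f) * P x := by
    intro f
    rw [hconj]
    simp only [mul_assoc]
    rw [h2, mul_one, ← mul_assoc, h2, one_mul]
  have hcomm : ∀ γ : FreeProdGroup (SignedPerm d) 1, (∀ f, Commute (inF f) γ) →
      ∀ f : SignedPerm d, Commute (f.blockMat ℂ (RotIdx b s)) (P' x * R x γ * P x) := by
    intro γ hγ f
    have h4 : ∀ A B, P' x * A * P x * (P' x * B * P x) = P' x * (A * B) * P x := by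
      intro A B
      calc _ = P' x * A * (P x * P' x) * B * P x := by simp only [mul_assoc]
        _ = _ := by rw [h1]; simp only [mul_assoc, one_mul]
    rw [Commute, SemiconjBy, hconj', h4, h4, ← map_mul, ← map_mul, (hγ f).eq]
  have hct : ∀ f : SignedPerm d, Commute (inF f) (genT _) := fun f => (genT_comm_inF f).symm
  have hT1 := SignedPerm.eq_fromBlocks_of_commute (hcomm _ hct)
  have hS1 := SignedPerm.eq_fromBlocks_of_commute (hcomm _ fun f => (hct f).inv_right)
  set μ := (P' x * R x (genT _) * P x) (.inl 0) (.inl 0)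
  set ν := (P' x * R x (genT _)⁻¹ * P x) (.inl 0) (.inl 0)
  have hback : ∀ A, A = P x * (P' x * A * P x) * P' x := by
    intro A
    calc A = (P x * P' x) * A * (P x * P' x) := by rw [h1, one_mul, mul_one]
      _ = _ := by simp only [mul_assoc]
  clear_value μ ν
  -- The blocks of `t` and `t⁻¹` were found separately; their scalars are mutually inverse.
  have hμν : μ * ν = 1 := by
    have h5 : (P' x * R x (genT _) * P x) * (P' x * R x (genT _)⁻¹ * P x) = 1 := by
      calc _ = P' x * (R x (genT _) * (P x * P' x) * R x (genT _)⁻¹) * P x := by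
            simp only [mul_assoc]
        _ = 1 := by rw [h1, mul_one, ← map_mul, mul_inv_cancel, map_one, mul_one, h2]
    rw [hT1, hS1, Matrix.fromBlocks_multiply] at h5
    have h6 := congrFun (congrFun h5 (.inl 0)) (.inl 0)
    rw [mul_comm]
    simpa using h6
  have hν : ν = μ⁻¹ := eq_inv_of_mul_eq_one_right hμν
  refine ⟨P x, P' x, μ, (P' x * R x (genT _) * P x).toBlocks₂₂,
    (P' x * R x (genT _)⁻¹ * P x).toBlocks₂₂, nearTorus_of_near (ν := ν) hlam hQ hQ' ?_ ?_, h1, h2,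
    hconj, ?_, ?_⟩
  · rw [← hT1]; exact hT''
  · rw [← hS1]; exact hS''
  · rw [← hT1]; exact hback _
  · rw [← hν, ← hS1]; exact hback _

end NearTorusOfTendsto

/-! ### Real vectors and forms on complex space; rank one approximation. -/

section RealVectors

variable {J : Type} [Fintype J]

/-- A real linear form as a form on complex vectors. -/
noncomputable def realForm (p : J → ℝ) : (J → ℂ) →L[ℂ] ℂ :=
  ∑ j, (p j : ℂ) • ContinuousLinearMap.proj j

lemma realForm_apply (p : J → ℝ) (x : J → ℂ) : realForm p x = ∑ j, (p j : ℂ) * x j := by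
  simp [realForm]

lemma realForm_ofReal (p x : J → ℝ) :
    realForm p (Complex.ofReal ∘ x) = ((p ⬝ᵥ x : ℝ) : ℂ) := by
  simp [realForm_apply, dotProduct]

lemma ofReal_comp_endVec {d : ℕ} {M : Type} (w : Fin d → ℝ) (β : ℝ) :
    endVec M (Complex.ofReal ∘ w) (β : ℂ) = Complex.ofReal ∘ endVec M w β := by
  ext i
  rcases i with i | i | i <;> simp [endVec]

lemma endVec_dotProduct_endVec {d : ℕ} {M : Type} [Fintype M] (p w : Fin d → ℝ) (α β : ℝ) :
    endVec M p α ⬝ᵥ endVec M w β = p ⬝ᵥ w + α * β := by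
  simp [dotProduct, endVec]

lemma SignedPerm.mat_mulVec_ofReal {d : ℕ} (f : SignedPerm d) (w : Fin d → ℝ) :
    (f.mat ℂ).mulVec (Complex.ofReal ∘ w) = Complex.ofReal ∘ (f.mat ℝ).mulVec w := by
  ext i
  simp [f.mat_complex, Matrix.mulVec, dotProduct]

lemma exists_norm_mulVec_le {ι κ : Type*} [Fintype ι] [Fintype κ] (G : Matrix ι κ ℂ) :
    ∃ C : ℝ, 0 < C ∧ ∀ x, ‖G.mulVec x‖ ≤ C * ‖x‖ := by
  refine ⟨‖LinearMap.toContinuousLinearMap G.mulVecLin‖ + 1, by positivity, fun x => ?_⟩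
  refine (ContinuousLinearMap.le_opNorm (LinearMap.toContinuousLinearMap G.mulVecLin) x).trans ?_
  gcongr
  linarith

/-- In a frame, a matrix with one large diagonal entry is a bounded perturbation of a rank one
map. -/
lemma exists_rankOne_approx {I : Type} [Fintype I] [DecidableEq I] (G : Matrix J I ℝ)
    (H : Matrix I J ℝ) {i₀ : I} {v φ : J → ℝ} {k : ℝ} (hG : ∀ i, G i i₀ = v i)
    (hH : ∀ j, H i₀ j = k * φ j) :
    ∃ C : ℝ, ∀ (N : Matrix I I ℝ) (α : ℝ),
      (∀ y, ‖cLin N y - ((α : ℂ) * y i₀) • Pi.single i₀ 1‖ ≤ 2 * ‖y‖) →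
      ∀ x, ‖((G * N * H).map Complex.ofReal).mulVec x -
        ((α * k : ℝ) * realForm φ x) • (Complex.ofReal ∘ v)‖ ≤ C * ‖x‖ := by
  obtain ⟨CG, hCG0, hCG⟩ := exists_norm_mulVec_le (G.map Complex.ofReal)
  obtain ⟨CH, hCH0, hCH⟩ := exists_norm_mulVec_le (H.map Complex.ofReal)
  refine ⟨CG * (2 * CH), fun N α hN x => ?_⟩
  set y := (H.map Complex.ofReal).mulVec x with hy
  have h1 : ((G * N * H).map Complex.ofReal).mulVec x =
      (G.map Complex.ofReal).mulVec (cLin N y) := by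
    rw [cLin_apply, hy, Matrix.mulVec_mulVec, Matrix.mulVec_mulVec]
    congr 1
    have : ∀ {α β γ : Type} [Fintype β] (A : Matrix α β ℝ) (B : Matrix β γ ℝ),
        (A * B).map Complex.ofReal = A.map Complex.ofReal * B.map Complex.ofReal :=
      fun A B => Matrix.map_mul (f := Complex.ofRealHom)
    rw [this, this]
  have h2 : ((α * k : ℝ) * realForm φ x) • (Complex.ofReal ∘ v) =
      (G.map Complex.ofReal).mulVec (((α : ℂ) * y i₀) • Pi.single i₀ 1) := by
    rw [Matrix.mulVec_smul, Matrix.mulVec_single_one]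
    have h3 : y i₀ = k * realForm φ x := by
      simp [hy, Matrix.mulVec, dotProduct, hH, realForm_apply, Finset.mul_sum, mul_assoc]
    have h4 : (G.map Complex.ofReal).col i₀ = Complex.ofReal ∘ v := by
      ext i; simp [hG]
    rw [h3, h4, Complex.ofReal_mul, mul_assoc]
  rw [h1, h2, ← Matrix.mulVec_sub]
  refine (hCG _).trans ?_
  rw [mul_assoc]
  gcongr
  refine (hN y).trans ?_
  rw [mul_assoc]
  gcongr
  exact hCH x

lemma norm_stdMat_sub_top_le {b s : ℕ} {α ε κ β : ℝ} (hε : |ε| = 1) (hκ : |κ| ≤ 2)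
    (hβ : |β| ≤ 2) (y : BlockIdx 1 (RotIdx b s) → ℂ) :
    ‖cLin (stdMat 1 b s α ε κ β) y - ((α : ℂ) * y (.inl 0)) • Pi.single (.inl 0) 1‖ ≤
      2 * ‖y‖ := by
  refine le_trans (le_of_eq ?_) (cLin_stdMat_norm_le (e := 1) (a := 0) (ε := ε) (κ := κ) (β := β)
    (c := 2) (x := y) (by norm_num) hε (Or.inr (by norm_num)) (Or.inr (by norm_num)) (Or.inr hκ)
    (Or.inr hβ))
  congr 1
  funext i
  revert i
  refine BlockIdx.rot_cases ?_ ?_ ?_ ?_ ?_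
  · intro i
    rw [Subsingleton.elim i 0]
    simp [cLin_stdMat_top]
  all_goals simp [cLin_stdMat_rot_inl, cLin_stdMat_rot_inr, cLin_stdMat_mid, cLin_stdMat_bot]

lemma norm_stdMat_sub_bot_le {b s : ℕ} {α ε κ β : ℝ} (hε : |ε| = 1) (hκ : |κ| ≤ 2)
    (hα : |α| ≤ 2) (y : BlockIdx 1 (RotIdx b s) → ℂ) :
    ‖cLin (stdMat 1 b s α ε κ β) y -
        ((β : ℂ) * y (.inr (.inr ()))) • Pi.single (.inr (.inr ())) 1‖ ≤
      2 * ‖y‖ := by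
  refine le_trans (le_of_eq ?_) (cLin_stdMat_norm_le (e := 1) (a := α) (ε := ε) (κ := κ) (β := 0)
    (c := 2) (x := y) (by norm_num) hε (Or.inr hα) (Or.inr (by norm_num)) (Or.inr hκ)
    (Or.inr (by norm_num)))
  congr 1
  funext i
  revert i
  refine BlockIdx.rot_cases ?_ ?_ ?_ ?_ ?_
  all_goals simp [cLin_stdMat_top, cLin_stdMat_rot_inl, cLin_stdMat_rot_inr, cLin_stdMat_mid,
    cLin_stdMat_bot]

end RealVectors

/-! ### All elements of `ℤ × F` acting on a cone. -/

section TorusMoves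

variable {d : ℕ} {M : Type} [Fintype M]

lemma NearTorus.mono {ℓ δ δ' : ℝ} {Q Q' : Matrix (BlockIdx d M) (BlockIdx d M) ℂ} {μ : ℂ}
    {D D' : Matrix (M ⊕ Unit) (M ⊕ Unit) ℂ} (h : NearTorus ℓ δ Q Q' μ D D') (hδ : δ ≤ δ') :
    NearTorus ℓ δ' Q Q' μ D D' :=
  ⟨fun x => (h.1 x).trans (by gcongr), fun x => (h.2 x).trans (by gcongr), h.3, h.4, h.5⟩

variable [DecidableEq M]

lemma conj_pow_mul {A : Type*} [Monoid A] {Q Q' : A} (h : Q' * Q = 1) (T f : A) (k : ℕ) :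
    (Q * T * Q') ^ k * (Q * f * Q') = Q * T ^ k * f * Q' := by
  induction k with
  | zero => simp
  | succ k ih =>
    rw [pow_succ', mul_assoc, ih, pow_succ']
    calc _ = Q * T * (Q' * Q) * T ^ k * f * Q' := by simp only [mul_assoc]
      _ = _ := by rw [h]; simp only [mul_assoc, one_mul]

/-- The zero, positive and negative powers are merged into one statement. The target line keeps its
last coordinate only for the zero power, where ping-pong will require `f ≠ 1`. -/
lemma exists_torus_moves (w : Fin d → ℂ) {β : ℂ} (hβ : β ≠ 0) {ε : ℝ} (hε : 0 < ε) :
    ∃ c η δ ℓ₀ : ℝ, 0 < c ∧ 0 < η ∧ 0 < δ ∧ ∀ ℓ, ℓ₀ ≤ ℓ →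
      ∀ (R : FreeProdGroup (SignedPerm d) 1 →* Matrix (BlockIdx d M) (BlockIdx d M) ℂ)
        (Q Q' : Matrix (BlockIdx d M) (BlockIdx d M) ℂ) (μ : ℂ)
        (D D' : Matrix (M ⊕ Unit) (M ⊕ Unit) ℂ), NearTorus ℓ δ Q Q' μ D D' → Q' * Q = 1 →
      (∀ f, R (inF f) = Q * f.blockMat ℂ M * Q') →
      R (genT _) = Q * Matrix.fromBlocks (μ • 1) 0 0 D * Q' →
      R (genT _)⁻¹ = Q * Matrix.fromBlocks (μ⁻¹ • 1) 0 0 D' * Q' →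
      ∀ (y : BlockIdx d M → ℂ) (a : ℂ), ‖y - a • endVec M w β‖ ≤ η * ‖a‖ →
      ∀ (k : ℤ) (f : SignedPerm d), ∃ (m : ℂ) (e : BlockIdx d M → ℂ),
        (e = endVec M ((f.mat ℂ).mulVec w) 0 ∨ e = endVec M (0 : Fin d → ℂ) 1 ∨
          k = 0 ∧ e = endVec M ((f.mat ℂ).mulVec w) β) ∧ c * 2 ^ k.natAbs * ‖a‖ ≤ ‖m‖ ∧
        ‖(R (genT (SignedPerm d) ^ k * inF f)).mulVec y - m • e‖ ≤ ε * ‖m‖ := by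
  obtain ⟨c, η, δ, ℓ₀, hc, hc1, hη, hδ, h⟩ := exists_moves (M := M) w hβ hε
  refine ⟨c, η, δ, ℓ₀, hc, hη, hδ, fun ℓ hℓ R Q Q' μ D D' hN hQ hF hT hS y a hy k f => ?_⟩
  obtain ⟨h1, h2, h3⟩ := h ℓ hℓ Q Q' μ D D' hN y a hy f
  by_cases hk : k = 0
  · refine ⟨a, _, Or.inr (Or.inr ⟨hk, rfl⟩), ?_, ?_⟩
    · rw [hk]
      simpa using mul_le_of_le_one_left (norm_nonneg a) hc1
    · rw [hk, zpow_zero, one_mul, hF]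
      exact h1
  · have hk' := Int.natAbs_ne_zero.2 hk
    rcases Int.natAbs_eq k with hk1 | hk1
    · obtain ⟨m, hm, hm'⟩ := h2 _ hk'
      refine ⟨m, _, Or.inl rfl, hm, ?_⟩
      have : R (genT (SignedPerm d) ^ k * inF f) =
          Q * Matrix.fromBlocks (μ • 1) 0 0 D ^ k.natAbs * f.blockMat ℂ M * Q' := by
        rw [← conj_pow_mul hQ, ← hT, ← hF, ← map_pow, ← map_mul, ← zpow_natCast, ← hk1]
      rw [this]
      exact hm'
    · obtain ⟨m, hm, hm'⟩ := h3 _ hk'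
      refine ⟨m, _, Or.inr (Or.inl rfl), hm, ?_⟩
      have : R (genT (SignedPerm d) ^ k * inF f) =
          Q * Matrix.fromBlocks (μ⁻¹ • 1) 0 0 D' ^ k.natAbs * f.blockMat ℂ M * Q' := by
        rw [← conj_pow_mul hQ, ← hS, ← hF, ← map_pow, ← map_mul, ← zpow_natCast, inv_zpow,
          ← zpow_neg, ← hk1]
      rw [this]
      exact hm'

end TorusMoves

/-! ### Exponential growth near the model. -/

section Growth

open Filter Topology

/-- Vectors close to a given line. -/
def coneAround {V : Type*} [NormedAddCommGroup V] [NormedSpace ℂ V] (v : V) (η : ℝ) : Set V :=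
  {y | ∃ a : ℂ, ‖y - a • v‖ ≤ η * ‖a‖}

/-- Vectors far from the kernel of a linear form. -/
def awayFromKer {V : Type*} [NormedAddCommGroup V] [NormedSpace ℂ V] (φ : V →L[ℂ] ℂ) (ε : ℝ) :
    Set V :=
  {y | ε * ‖y‖ ≤ ‖φ y‖}

/-- A real matrix conjugate to a standard one, whose powers attract. -/
lemma exists_attracting_frame {J : Type} [Fintype J] [DecidableEq J] {b s : ℕ}
    (G : Matrix J (BlockIdx 1 (RotIdx b s)) ℝ) (H : Matrix (BlockIdx 1 (RotIdx b s)) J ℝ)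
    {v u φ ψ : J → ℝ} {k₁ k₂ : ℝ} (hk₁ : k₁ ≠ 0) (hk₂ : k₂ ≠ 0) (hv : v ≠ 0) (hu : u ≠ 0)
    (hGv : ∀ i, G i (.inl 0) = v i) (hGu : ∀ i, G i (.inr (.inr ())) = u i)
    (hHφ : ∀ j, H (.inl 0) j = k₁ * φ j) (hHψ : ∀ j, H (.inr (.inr ())) j = k₂ * ψ j)
    {κ η : ℝ} (hκ : 0 < κ) (hη : 0 < η) (Λ : ℝ) :
    ∃ L : ℝ, 4 ≤ L ∧ ∀ A B : Matrix J J ℂ,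
      (∀ x, ‖A.mulVec x - ((G * stdMat 1 b s L 1 (1 / 2) L⁻¹ * H).map Complex.ofReal).mulVec x‖ ≤
        1 * ‖x‖) →
      (∀ x, ‖B.mulVec x - ((G * stdMat 1 b s L⁻¹ (-1) 2 L * H).map Complex.ofReal).mulVec x‖ ≤
        1 * ‖x‖) →
      (∀ x ∈ awayFromKer (realForm φ) κ, A.mulVec x ∈ coneAround (Complex.ofReal ∘ v) η ∧
        Λ * ‖x‖ ≤ ‖A.mulVec x‖) ∧
      ∀ x ∈ awayFromKer (realForm ψ) κ, B.mulVec x ∈ coneAround (Complex.ofReal ∘ u) η ∧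
        Λ * ‖x‖ ≤ ‖B.mulVec x‖ := by
  have hne : ∀ z : J → ℝ, z ≠ 0 → Complex.ofReal ∘ z ≠ 0 := by
    intro z hz h
    apply hz
    ext i
    simpa using congrFun h i
  obtain ⟨C₁, hC₁⟩ := exists_rankOne_approx G H hGv hHφ
  obtain ⟨C₂, hC₂⟩ := exists_rankOne_approx G H hGu hHψ
  obtain ⟨L₁, hL₁⟩ := exists_attracting (C := C₁ + 1) (hne v hv) hk₁ hκ hη Λ (realForm φ)
  obtain ⟨L₂, hL₂⟩ := exists_attracting (C := C₂ + 1) (hne u hu) hk₂ hκ hη Λ (realForm ψ)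
  set L := max 4 (max L₁ L₂) with hL
  have hL4 : 4 ≤ L := le_max_left _ _
  have hLi : |L⁻¹| ≤ 2 := by
    rw [abs_of_pos (by positivity)]
    exact (inv_le_one_of_one_le₀ (by linarith)).trans (by norm_num)
  refine ⟨L, hL4, fun A B hA hB => ⟨?_, ?_⟩⟩
  · refine hL₁ L ((le_max_left _ _).trans (le_max_right _ _)) A.mulVecLin fun x => ?_
    have h1 := hC₁ (stdMat 1 b s L 1 (1 / 2) L⁻¹) L
      (norm_stdMat_sub_top_le (by norm_num) (by norm_num [abs_of_pos]) hLi) x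
    calc _ ≤ _ := norm_sub_le_norm_sub_add_norm_sub _
          (((G * stdMat 1 b s L 1 (1 / 2) L⁻¹ * H).map Complex.ofReal).mulVec x) _
      _ ≤ 1 * ‖x‖ + C₁ * ‖x‖ := add_le_add (hA x) h1
      _ = _ := by ring
  · refine hL₂ L ((le_max_right _ _).trans (le_max_right _ _)) B.mulVecLin fun x => ?_
    have h1 := hC₂ (stdMat 1 b s L⁻¹ (-1) 2 L) L
      (norm_stdMat_sub_bot_le (by norm_num) (by norm_num) hLi) x
    calc _ ≤ _ := norm_sub_le_norm_sub_add_norm_sub _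
          (((G * stdMat 1 b s L⁻¹ (-1) 2 L * H).map Complex.ofReal).mulVec x) _
      _ ≤ 1 * ‖x‖ + C₂ * ‖x‖ := add_le_add (hB x) h1
      _ = _ := by ring

/-- The action of a group on vectors through matrices. -/
noncomputable def matAction {Γ J : Type} [Group Γ] [Fintype J] [DecidableEq J]
    (R : Γ →* Matrix J J ℂ) : Γ →* Module.End ℂ (J → ℂ) where
  toFun γ := (R γ).mulVecLin
  map_one' := by rw [map_one, Matrix.mulVecLin_one]; rfl
  map_mul' x y := by rw [map_mul, Matrix.mulVecLin_mul]; rfl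

/-- There are model representations of `(ℤ × F) * F_1` such that all nearby representations grow
exponentially. -/
theorem exists_model (d b s b' s' : ℕ) [NeZero d] (hcard : 2 * b' + s' + 2 = d + 2 * b + s + 1) :
    ∃ (lam L : ℝ) (G : Matrix (BlockIdx d (RotIdx b s)) (BlockIdx 1 (RotIdx b' s')) ℝ)
      (H : Matrix (BlockIdx 1 (RotIdx b' s')) (BlockIdx d (RotIdx b s)) ℝ),
      4 ≤ lam ∧ 4 ≤ L ∧ G * H = 1 ∧ H * G = 1 ∧
      ∀ {X : Type} (l : Filter X) (R : X → (FreeProdGroup (SignedPerm d) 1 →*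
        Matrix (BlockIdx d (RotIdx b s)) (BlockIdx d (RotIdx b s)) ℂ)),
        (∀ f, Tendsto (fun x => R x (inF f)) l (𝓝 (f.blockMat ℂ (RotIdx b s)))) →
        Tendsto (fun x => R x (genT _)) l
          (𝓝 ((stdMat d b s lam 1 (1 / 2) lam⁻¹).map Complex.ofReal)) →
        Tendsto (fun x => R x (genT _)⁻¹) l
          (𝓝 ((stdMat d b s lam⁻¹ (-1) 2 lam).map Complex.ofReal)) →
        Tendsto (fun x => R x (genA _)) l
          (𝓝 ((G * stdMat 1 b' s' L 1 (1 / 2) L⁻¹ * H).map Complex.ofReal)) →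
        Tendsto (fun x => R x (genA _)⁻¹) l
          (𝓝 ((G * stdMat 1 b' s' L⁻¹ (-1) 2 L * H).map Complex.ofReal)) →
        ∀ᶠ x in l, ∃ c : ℝ, 0 < c ∧ ∀ γ, ∃ v, v ≠ 0 ∧
          c * 2 ^ wordLength (stdGens (SignedPerm d)) γ * ‖v‖ ≤ ‖(R x γ).mulVec v‖ := by
  classical
  obtain ⟨w, p, q, hw1, hw2⟩ := SignedPerm.exists_forms d
  set M := RotIdx b s
  have hw3 := hw1 1
  rw [map_one, Matrix.one_mulVec] at hw3
  obtain ⟨hpw, hqw, hpq, -⟩ := hw3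
  -- the relevant vectors and forms
  let vec : (Fin d → ℝ) → ℝ → BlockIdx d M → ℂ := fun x β => Complex.ofReal ∘ endVec M x β
  let φ := endVec M p (1 : ℝ)
  let ψ := endVec M q (1 : ℝ)
  have hφ : ∀ x β, φ ⬝ᵥ endVec M x β = p ⬝ᵥ x + β := fun x β => by
    rw [endVec_dotProduct_endVec, one_mul]
  have hψ : ∀ x β, ψ ⬝ᵥ endVec M x β = q ⬝ᵥ x + β := fun x β => by
    rw [endVec_dotProduct_endVec, one_mul]
  have hφC : ∀ x β, p ⬝ᵥ x + β ≠ 0 → realForm φ (vec x β) ≠ 0 := fun x β h => by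
    rw [realForm_ofReal, hφ]; exact_mod_cast h
  have hψC : ∀ x β, q ⬝ᵥ x + β ≠ 0 → realForm ψ (vec x β) ≠ 0 := fun x β h => by
    rw [realForm_ofReal, hψ]; exact_mod_cast h
  -- The last coordinates are chosen so that the attracting vector of `a` lies in the kernel of `ψ`
  -- and that of `a⁻¹` in the kernel of `φ`, as the frame requires.
  set βv : ℝ := -(q ⬝ᵥ w) with hβv
  set βu : ℝ := -(p ⬝ᵥ w) with hβu
  have hφv : p ⬝ᵥ w + βv ≠ 0 := by rw [hβv, ← sub_eq_add_neg]; exact sub_ne_zero.2 hpq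
  have hψu : q ⬝ᵥ w + βu ≠ 0 := by rw [hβu, ← sub_eq_add_neg]; exact sub_ne_zero.2 hpq.symm
  -- the common size of the neighbourhoods
  let P : ℝ → (BlockIdx d M → ℂ) → ((BlockIdx d M → ℂ) →L[ℂ] ℂ) → Prop := fun ε e θ =>
    ∀ (y : BlockIdx d M → ℂ) (m : ℂ), ‖y - m • e‖ ≤ ε * ‖m‖ →
      ε * ‖y‖ ≤ ‖θ y‖ ∧ ε * ‖m‖ ≤ ‖y‖
  have hev : ∀ᶠ ε in 𝓝[>] (0 : ℝ), (P ε (vec w βv) (realForm φ) ∧ P ε (vec w βu) (realForm ψ)) ∧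
      (P ε (vec 0 1) (realForm φ) ∧ P ε (vec 0 1) (realForm ψ)) ∧
      (∀ f : SignedPerm d, P ε (vec ((f.mat ℝ).mulVec w) 0) (realForm φ) ∧
        P ε (vec ((f.mat ℝ).mulVec w) 0) (realForm ψ)) ∧
      ∀ f : SignedPerm d, f ≠ 1 → (P ε (vec ((f.mat ℝ).mulVec w) βv) (realForm φ) ∧
        P ε (vec ((f.mat ℝ).mulVec w) βv) (realForm ψ)) ∧
        (P ε (vec ((f.mat ℝ).mulVec w) βu) (realForm φ) ∧
        P ε (vec ((f.mat ℝ).mulVec w) βu) (realForm ψ)) := by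
    refine ((eventually_cone_subset _ (hφC _ _ hφv)).and
      (eventually_cone_subset _ (hψC _ _ hψu))).and
      (((eventually_cone_subset _ (hφC _ _ (by simp))).and
      (eventually_cone_subset _ (hψC _ _ (by simp)))).and
      ((eventually_all.2 fun f => ((eventually_cone_subset _ (hφC _ _ ?_)).and
      (eventually_cone_subset _ (hψC _ _ ?_)))).and
      (eventually_all.2 fun f => eventually_imp_distrib_left.2 fun hf =>
      ((eventually_cone_subset _ (hφC _ _ ?_)).and (eventually_cone_subset _ (hψC _ _ ?_))).and
      ((eventually_cone_subset _ (hφC _ _ ?_)).and (eventually_cone_subset _ (hψC _ _ ?_))))))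
    · simpa using (hw1 f).1
    · simpa using (hw1 f).2.1
    · rw [hβv, ← sub_eq_add_neg]; exact sub_ne_zero.2 (hw1 f).2.2.1
    · rw [hβv, ← sub_eq_add_neg]; exact sub_ne_zero.2 (hw2 f hf).2
    · rw [hβu, ← sub_eq_add_neg]; exact sub_ne_zero.2 (hw2 f hf).1
    · rw [hβu, ← sub_eq_add_neg]; exact sub_ne_zero.2 (hw1 f).2.2.2
  -- The width `ε` depends only on `w`, `p`, `q`. The cone sizes, the expansion factor, and finally
  -- `L` and `lam` are fixed after it.
  obtain ⟨ε, ⟨⟨hPv, hPu⟩, hP1, hPf, hPf'⟩, hε⟩ := (hev.and self_mem_nhdsWithin).exists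
  replace hε : 0 < ε := hε
  obtain ⟨c₁, η₁, δ₁, ℓ₁, hc₁, hη₁, hδ₁, H₁⟩ := exists_torus_moves (M := M) (Complex.ofReal ∘ w)
    (β := βv) (by rw [hβv]; simpa using hqw) hε
  obtain ⟨c₂, η₂, δ₂, ℓ₂, hc₂, hη₂, hδ₂, H₂⟩ := exists_torus_moves (M := M) (Complex.ofReal ∘ w)
    (β := βu) (by rw [hβu]; simpa using hpw) hε
  rw [ofReal_comp_endVec] at H₁ H₂
  simp only [SignedPerm.mat_mulVec_ofReal] at H₁ H₂
  have hv0 : endVec M w βv ≠ 0 := fun h => hφv (by rw [← hφ, h, dotProduct_zero])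
  have hu0 : endVec M w βu ≠ 0 := fun h => hψu (by rw [← hψ, h, dotProduct_zero])
  have hvC0 : vec w βv ≠ 0 := fun h => hφC _ _ hφv (by rw [h, map_zero])
  have h1C0 : vec 0 1 ≠ 0 := fun h => hφC _ _ (by simp) (h ▸ map_zero (realForm φ))
  obtain ⟨G, Hm, hGH, hHG, hGv, hGu, hHφ, hHψ⟩ := exists_frame (J := BlockIdx d M)
    (M' := RotIdx b' s') (v := endVec M w βv) (u := endVec M w βu) (φ := φ) (ψ := ψ)
    (by rw [card_blockIdx_rotIdx, ← hcard]; simp; ring)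
    (by rw [hφ, hβu]; ring) (by rw [hψ, hβv]; ring) (by rw [hφ]; exact hφv)
    (by rw [hψ]; exact hψu)
  set η := min (min η₁ η₂) ε with hη
  have hη0 : 0 < η := by positivity
  set C := ‖vec w βv‖ + ‖vec w βu‖ + η with hC
  have hC0 : 0 < C := by positivity
  -- A vector of the cone with multiplier `a` has norm at most `C * ‖a‖`, and its image with
  -- multiplier `m` has norm at least `ε * ‖m‖`; this converts bounds on multipliers into bounds on
  -- norms.
  set c := min 1 (ε * min c₁ c₂ / C) with hc
  have hc0 : 0 < c := by positivity
  set Λ := max 2 (4 / c) with hΛ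
  obtain ⟨L, hL4, hL⟩ := exists_attracting_frame G Hm
    (inv_ne_zero (by rw [hφ]; exact hφv : φ ⬝ᵥ endVec M w βv ≠ 0))
    (inv_ne_zero (by rw [hψ]; exact hψu : ψ ⬝ᵥ endVec M w βu ≠ 0)) hv0 hu0 hGv hGu hHφ hHψ
    hε hη0 Λ
  refine ⟨max 4 (max ℓ₁ ℓ₂ + 1), L, G, Hm, le_max_left _ _, hL4, hGH, hHG, ?_⟩
  set lam := max 4 (max ℓ₁ ℓ₂ + 1) with hlam
  have hlam1 : max ℓ₁ ℓ₂ ≤ lam - 1 := by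
    have : max ℓ₁ ℓ₂ + 1 ≤ lam := le_max_right _ _
    linarith
  intro X l R hF hT hS hA hB
  filter_upwards [eventually_nearTorus (δ := min δ₁ δ₂) (le_max_left _ _) (by positivity) hF hT hS,
    eventually_norm_mulVec_sub_le hA one_pos, eventually_norm_mulVec_sub_le hB one_pos]
    with x hxT hxA hxB
  obtain ⟨Q, Q', μ, D, D', hN, -, hQQ, hRF, hRT, hRS⟩ := hxT
  obtain ⟨hLA, hLB⟩ := hL _ _ hxA hxB
  refine ⟨c / 2, by positivity, ?_⟩
  -- ping-pong
  have hvec1 : endVec M (0 : Fin d → ℂ) 1 = vec 0 1 := by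
    ext i
    rcases i with i | i | i <;> simp [vec, endVec]
  -- `N` surrounds the attracting lines of `a` and `a⁻¹`; `Dm` avoids both repelling hyperplanes.
  -- Each cone avoids the hyperplane of its own generator, which allows iteration, although it lies
  -- near the other hyperplane.
  let N := coneAround (vec w βv) η ∪ coneAround (vec w βu) η
  let Dm := awayFromKer (realForm φ) ε ∩ awayFromKer (realForm ψ) ε
  have hηε : η ≤ ε := min_le_right _ _
  have hNv : coneAround (vec w βv) η ⊆ awayFromKer (realForm φ) ε := by
    rintro y ⟨a, ha⟩
    exact (hPv y a (ha.trans (by gcongr))).1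
  have hNu : coneAround (vec w βu) η ⊆ awayFromKer (realForm ψ) ε := by
    rintro y ⟨a, ha⟩
    exact (hPu y a (ha.trans (by gcongr))).1
  have hgrow : ∀ (y z v : BlockIdx d M → ℂ) (a m : ℂ) (c' : ℝ) (k : ℕ), min c₁ c₂ ≤ c' →
      ‖v‖ + η ≤ C → ‖y - a • v‖ ≤ η * ‖a‖ → c' * 2 ^ k * ‖a‖ ≤ ‖m‖ → ε * ‖m‖ ≤ ‖z‖ →
      c * 2 ^ k * ‖y‖ ≤ ‖z‖ := by
    intro y z v a m c' k hc' hvC hy hm hz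
    have h1 : ‖y‖ ≤ C * ‖a‖ := by
      have := norm_sub_norm_le y (a • v)
      rw [norm_smul] at this
      calc ‖y‖ ≤ (‖v‖ + η) * ‖a‖ := by linarith
        _ ≤ _ := by gcongr
    refine le_trans ?_ hz
    calc c * 2 ^ k * ‖y‖ ≤ (ε * min c₁ c₂ / C) * 2 ^ k * (C * ‖a‖) := by
          gcongr
          exact min_le_right _ _
      _ = ε * (min c₁ c₂ * 2 ^ k * ‖a‖) := by field_simp
      _ ≤ ε * (c' * 2 ^ k * ‖a‖) := by gcongr
      _ ≤ _ := by gcongr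
  refine exists_norm_ge_of_pingPong (matAction (R x)) (N := N) (D := Dm) (Λ := Λ) hc0
    (min_le_left _ _) (le_max_left _ _) ?_ ⟨vec w βv, Or.inl ⟨1, by simp [hη0.le]⟩, hvC0⟩
    ⟨vec 0 1, ⟨(hP1.1 _ 1 (by simp [hε.le])).1, (hP1.2 _ 1 (by simp [hε.le])).1⟩, h1C0⟩ ?_ ?_
  · have : 4 / c ≤ Λ := le_max_right _ _
    rwa [div_le_iff₀' hc0] at this
  · intro k hk y hy
    have hΛ0 : 0 ≤ Λ := le_trans (by norm_num) (le_max_left _ _)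
    have hk' := Int.natAbs_ne_zero.2 hk
    rcases Int.natAbs_eq k with hk1 | hk1
    · have h1 := attracting_pow (A := matAction (R x) (genA (SignedPerm d))) hΛ0 hNv hLA hk' y hy.1
      rw [← map_pow, ← zpow_natCast, ← hk1] at h1
      exact ⟨Or.inl h1.1, h1.2⟩
    · have h1 := attracting_pow (A := matAction (R x) (genA (SignedPerm d))⁻¹) hΛ0 hNu hLB hk' y
        hy.2
      rw [← map_pow, ← zpow_natCast, inv_zpow, ← zpow_neg, ← hk1] at h1
      exact ⟨Or.inr h1.1, h1.2⟩
  · intro k f hkf y hy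
    rcases hy with ⟨a, ha⟩ | ⟨a, ha⟩
    · obtain ⟨m, e, he, hm, hme⟩ := H₁ _ ((le_max_left _ _).trans hlam1) (R x) Q Q' μ D D'
        (hN.mono (min_le_left _ _)) hQQ hRF hRT hRS y a
        (ha.trans (by gcongr; exact (min_le_left _ _).trans (min_le_left _ _))) k f
      have hPe : P ε e (realForm φ) ∧ P ε e (realForm ψ) := by
        rcases he with rfl | rfl | ⟨hk, rfl⟩
        · rw [← Complex.ofReal_zero, ofReal_comp_endVec]; exact hPf f
        · rw [hvec1]; exact hP1
        · rw [ofReal_comp_endVec]; exact (hPf' f fun hf => hkf ⟨hk, hf⟩).1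
      exact ⟨⟨(hPe.1 _ m hme).1, (hPe.2 _ m hme).1⟩, hgrow _ _ _ a m c₁ _ (min_le_left _ _)
        (by rw [hC]; linarith [norm_nonneg (vec w βu)]) ha hm (hPe.1 _ m hme).2⟩
    · obtain ⟨m, e, he, hm, hme⟩ := H₂ _ ((le_max_right _ _).trans hlam1) (R x) Q Q' μ D D'
        (hN.mono (min_le_right _ _)) hQQ hRF hRT hRS y a
        (ha.trans (by gcongr; exact (min_le_left _ _).trans (min_le_right _ _))) k f
      have hPe : P ε e (realForm φ) ∧ P ε e (realForm ψ) := by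
        rcases he with rfl | rfl | ⟨hk, rfl⟩
        · rw [← Complex.ofReal_zero, ofReal_comp_endVec]; exact hPf f
        · rw [hvec1]; exact hP1
        · rw [ofReal_comp_endVec]; exact (hPf' f fun hf => hkf ⟨hk, hf⟩).2
      exact ⟨⟨(hPe.1 _ m hme).1, (hPe.2 _ m hme).1⟩, hgrow _ _ _ a m c₂ _ (min_le_right _ _)
        (by rw [hC]; linarith [norm_nonneg (vec w βv)]) ha hm (hPe.1 _ m hme).2⟩

end Growth

/-! ### Eigenvalue counts for the generators. -/

section Counting

lemma countGe_add (M N : Multiset ℂ) (x : ℝ) : countGe (M + N) x = countGe M x + countGe N x := by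
  simp [countGe]

lemma norm_le_of_mem_roots_charpoly {ι : Type*} [Fintype ι] [DecidableEq ι] {D : Matrix ι ι ℂ}
    {C : ℝ} (hD : ∀ x, ‖D.mulVec x‖ ≤ C * ‖x‖) {z : ℂ} (hz : z ∈ D.charpoly.roots) : ‖z‖ ≤ C := by
  have h1 : D.charpoly.IsRoot z := (Polynomial.mem_roots'.1 hz).2
  have h2 : Module.End.HasEigenvalue D.mulVecLin z := by
    rw [Module.End.hasEigenvalue_iff_isRoot_charpoly]
    rwa [← Matrix.toLin'_apply', Matrix.charpoly_toLin']
  obtain ⟨v, hv⟩ := h2.exists_hasEigenvector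
  have h3 := hD v
  have h4 : D.mulVec v = z • v := hv.apply_eq_smul
  rw [h4, norm_smul] at h3
  exact le_of_mul_le_mul_right h3 (norm_pos_iff.2 hv.2)

/-- The eigenvalues of largest modulus of a map with a large scalar block are those of the
block. -/
lemma countGe_fromBlocks_scalar {d : ℕ} {ι : Type*} [Fintype ι] [DecidableEq ι] {D : Matrix ι ι ℂ}
    {C : ℝ} (hD : ∀ x, ‖D.mulVec x‖ ≤ C * ‖x‖) {μ : ℂ} (hμ : C ≤ ‖μ‖) (y : ℝ) :
    countGe (Matrix.fromBlocks (μ • (1 : Matrix (Fin d) (Fin d) ℂ)) 0 0 D).charpoly.roots y = 0 ∨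
      d ≤ countGe (Matrix.fromBlocks (μ • (1 : Matrix (Fin d) (Fin d) ℂ)) 0 0 D).charpoly.roots
        y := by
  have h1 : (μ • (1 : Matrix (Fin d) (Fin d) ℂ)).charpoly =
      (Polynomial.X - Polynomial.C μ) ^ d := by
    rw [Matrix.smul_one_eq_diagonal, Matrix.charpoly_diagonal]
    simp
  have h2 : (Matrix.fromBlocks (μ • (1 : Matrix (Fin d) (Fin d) ℂ)) 0 0 D).charpoly.roots =
      Multiset.replicate d μ + D.charpoly.roots := by
    rw [Matrix.charpoly_fromBlocks_zero₁₂, Polynomial.roots_mul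
      (mul_ne_zero (Matrix.charpoly_monic _).ne_zero (Matrix.charpoly_monic _).ne_zero), h1,
      Polynomial.roots_pow, Polynomial.roots_X_sub_C, Multiset.nsmul_singleton]
  rw [h2, countGe_add]
  by_cases hy : y ≤ ‖μ‖
  · right
    have : countGe (Multiset.replicate d μ) y = d := by
      rw [countGe, Multiset.filter_eq_self.2, Multiset.card_replicate]
      intro z hz
      rwa [Multiset.eq_of_mem_replicate hz]
    omega
  · left
    push Not at hy
    have h3 : countGe (Multiset.replicate d μ) y = 0 := by
      rw [countGe, Multiset.filter_eq_nil.2, Multiset.card_zero]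
      intro z hz
      rw [Multiset.eq_of_mem_replicate hz]
      exact not_le.2 hy
    have h4 : countGe D.charpoly.roots y = 0 := by
      rw [countGe, Multiset.filter_eq_nil.2, Multiset.card_zero]
      intro z hz
      exact not_le.2 (((norm_le_of_mem_roots_charpoly hD hz).trans hμ).trans_lt hy)
    omega

/-- The conjugating matrices may connect different index types, as those of the frame do. -/
lemma charpoly_conj_eq {ι κ : Type*} [Fintype ι] [Fintype κ] [DecidableEq ι] [DecidableEq κ]
    {R : Type*} [CommRing R] [Nontrivial R] (hcard : Fintype.card ι = Fintype.card κ)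
    {G : Matrix ι κ R} {H : Matrix κ ι R} (hHG : H * G = 1) (A : Matrix κ κ R) :
    (G * A * H).charpoly = A.charpoly := by
  rw [Matrix.mul_assoc, Matrix.charpoly_mul_comm_of_le _ _ hcard.ge, hcard, Nat.sub_self, pow_zero,
    one_mul, Matrix.mul_assoc, hHG, Matrix.mul_one]

/-- The exponent of the generator of the central factor. -/
def expT (F : Type) [Group F] : FreeProdGroup F 1 →* Multiplicative ℤ :=
  liftHom (Multiplicative.ofAdd 1) 1 1 fun _ => Commute.one_right _

/-- The exponent of the free generator. -/
def expA (F : Type) [Group F] : FreeProdGroup F 1 →* Multiplicative ℤ :=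
  liftHom 1 (Multiplicative.ofAdd 1) 1 fun _ => Commute.one_right _

lemma expT_genT (F : Type) [Group F] : expT F (genT F) = Multiplicative.ofAdd 1 :=
  liftHom_genT _ _ _ _

lemma expA_genA (F : Type) [Group F] : expA F (genA F) = Multiplicative.ofAdd 1 :=
  liftHom_genA _ _ _ _

/-- The first gap comes from the powers of `γ`, the second from those of `γ⁻¹`. -/
lemma IsAnosov.exists_countGe {Γ : Type*} [Group Γ] {n j : ℕ}
    {ρ : Γ →* Matrix.GeneralLinearGroup (Fin n) ℂ} (hρ : IsAnosov j ρ) (hj : 1 ≤ j)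
    (hjn : j ≤ n - 1) (h : Γ →* Multiplicative ℤ) (γ : Γ) (hγ : h γ = Multiplicative.ofAdd 1) :
    (∃ x, countGe (ρ γ : Matrix (Fin n) (Fin n) ℂ).charpoly.roots x = j) ∧
      ∃ x, countGe (ρ γ : Matrix (Fin n) (Fin n) ℂ).charpoly.roots x = n - j := by
  obtain ⟨c, ε, hc, hε, h1⟩ := hρ.exists_gap_pow h γ (by simp [hγ])
  obtain ⟨c', ε', hc', hε', h2⟩ := hρ.exists_gap_pow h γ⁻¹ (by simp [hγ])
  rw [map_inv] at h2
  exact ⟨exists_countGe_eq_of_gap _ hj hjn hc hε h1,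
    exists_countGe_eq_of_gap_inverse _ hj hjn hc' hε' h2⟩

end Counting

/-! ### Passing between block coordinates and `Fin n`. -/

section Reindex

variable {Γ : Type} [Group Γ] {J : Type} [Fintype J] [DecidableEq J] {n : ℕ}

/-- The matrices of a representation, in coordinates indexed by `J`. -/
def reindexRep {𝕜 : Type*} [RCLike 𝕜] (e : J ≃ Fin n)
    (ρ : Γ →* Matrix.GeneralLinearGroup (Fin n) 𝕜) : Γ →* Matrix J J 𝕜 :=
  ((Matrix.reindexAlgEquiv 𝕜 𝕜 e.symm : Matrix (Fin n) (Fin n) 𝕜 →* Matrix J J 𝕜)).comp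
    ((Units.coeHom _).comp ρ)

lemma reindexRep_apply {𝕜 : Type*} [RCLike 𝕜] (e : J ≃ Fin n)
    (ρ : Γ →* Matrix.GeneralLinearGroup (Fin n) 𝕜) (γ : Γ) :
    reindexRep e ρ γ = (ρ γ : Matrix (Fin n) (Fin n) 𝕜).submatrix e e := rfl

lemma charpoly_reindexRep {𝕜 : Type*} [RCLike 𝕜] (e : J ≃ Fin n)
    (ρ : Γ →* Matrix.GeneralLinearGroup (Fin n) 𝕜) (γ : Γ) :
    (reindexRep e ρ γ).charpoly = (ρ γ : Matrix (Fin n) (Fin n) 𝕜).charpoly :=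
  Matrix.charpoly_reindex e.symm _

lemma reindexRep_complexify (e : J ≃ Fin n) (ρ : Γ →* Matrix.GeneralLinearGroup (Fin n) ℝ)
    (γ : Γ) : reindexRep e (complexify ρ) γ = (reindexRep e ρ γ).map Complex.ofReal := rfl

lemma continuous_reindexRep (e : J ≃ Fin n) (γ : Γ) :
    Continuous fun ρ : Γ →* Matrix.GeneralLinearGroup (Fin n) ℂ => reindexRep e ρ γ := by
  simp only [reindexRep_apply]
  exact (Units.continuous_val.comp (continuous_eval γ)).matrix_submatrix _ _

lemma exists_norm_mulVec_ge_of_reindexRep (e : J ≃ Fin n)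
    (ρ : Γ →* Matrix.GeneralLinearGroup (Fin n) ℂ) (γ : Γ) {c : ℝ}
    (h : ∃ v, v ≠ 0 ∧ c * ‖v‖ ≤ ‖(reindexRep e ρ γ).mulVec v‖) :
    ∃ v, v ≠ 0 ∧ c * ‖v‖ ≤ ‖(ρ γ : Matrix (Fin n) (Fin n) ℂ).mulVec v‖ := by
  obtain ⟨v, hv, hv'⟩ := h
  have hnorm : ∀ x : J → ℂ, ‖x ∘ e.symm‖ = ‖x‖ := fun x => le_antisymm
    ((pi_norm_le_iff_of_nonneg (norm_nonneg _)).2 fun i => norm_le_pi_norm x _)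
    ((pi_norm_le_iff_of_nonneg (norm_nonneg _)).2 fun i => by
      simpa using norm_le_pi_norm (x ∘ e.symm) (e i))
  refine ⟨v ∘ e.symm, fun h0 => hv ?_, ?_⟩
  · ext i
    simpa using congrFun h0 (e i)
  · have : (ρ γ : Matrix (Fin n) (Fin n) ℂ).mulVec (v ∘ e.symm) =
        ((reindexRep e ρ γ).mulVec v) ∘ e.symm := by
      rw [reindexRep_apply, Matrix.submatrix_mulVec_equiv]
      ext i
      simp
    rw [this, hnorm, hnorm]
    exact hv'

/-- A representation over `ℝ` with matrices indexed by `J`, as a representation into `GL_n`. -/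
def toFinRep (e : J ≃ Fin n) (ψ : Γ →* (Matrix J J ℝ)ˣ) :
    Γ →* Matrix.GeneralLinearGroup (Fin n) ℝ :=
  (Units.map (Matrix.reindexAlgEquiv ℝ ℝ e : Matrix J J ℝ →* Matrix (Fin n) (Fin n) ℝ)).comp ψ

lemma reindexRep_toFinRep (e : J ≃ Fin n) (ψ : Γ →* (Matrix J J ℝ)ˣ) (γ : Γ) :
    reindexRep e (toFinRep e ψ) γ = ψ γ := by
  ext i j
  simp [reindexRep_apply, toFinRep]

end Reindex

/-! ### The model representation and its neighbourhood. -/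

section Main

open Filter Topology

lemma map_ofReal_mul {α β γ : Type*} [Fintype β] (A : Matrix α β ℝ) (B : Matrix β γ ℝ) :
    (A * B).map Complex.ofReal = A.map Complex.ofReal * B.map Complex.ofReal :=
  Matrix.map_mul (f := Complex.ofRealHom)

lemma map_ofReal_one {α : Type*} [DecidableEq α] :
    (1 : Matrix α α ℝ).map Complex.ofReal = 1 :=
  Matrix.map_one _ Complex.ofReal_zero Complex.ofReal_one

lemma SignedPerm.blockMat_complex {d : ℕ} {M : Type} [Fintype M] [DecidableEq M]
    (f : SignedPerm d) : (f.blockMat ℝ M).map Complex.ofReal = f.blockMat ℂ M := by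
  simp [SignedPerm.blockMat, Matrix.fromBlocks_map, f.mat_complex]

lemma conj_mul_conj {ι κ : Type*} [Fintype ι] [Fintype κ] [DecidableEq ι] [DecidableEq κ]
    {R : Type*} [CommRing R] {G : Matrix ι κ R} {H : Matrix κ ι R} (hGH : G * H = 1)
    (hHG : H * G = 1) {A B : Matrix κ κ R} (hAB : A * B = 1) : G * A * H * (G * B * H) = 1 := by
  calc G * A * H * (G * B * H) = G * (A * (H * G) * B) * H := by simp only [Matrix.mul_assoc]
    _ = 1 := by rw [hHG, Matrix.mul_one, hAB, Matrix.mul_one, hGH]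

/-- The model representation. -/
noncomputable def modelRep {d b s b' s' : ℕ} {lam L : ℝ} (hlam : lam ≠ 0) (hL : L ≠ 0)
    {G : Matrix (BlockIdx d (RotIdx b s)) (BlockIdx 1 (RotIdx b' s')) ℝ}
    {H : Matrix (BlockIdx 1 (RotIdx b' s')) (BlockIdx d (RotIdx b s)) ℝ}
    (hGH : G * H = 1) (hHG : H * G = 1) :
    FreeProdGroup (SignedPerm d) 1 →*
      (Matrix (BlockIdx d (RotIdx b s)) (BlockIdx d (RotIdx b s)) ℝ)ˣ :=
  liftHom ⟨stdMat d b s lam 1 (1 / 2) lam⁻¹, stdMat d b s lam⁻¹ (-1) 2 lam,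
      stdMat_mul_inv lam hlam, mul_eq_one_comm.1 (stdMat_mul_inv lam hlam)⟩
    ⟨G * stdMat 1 b' s' L 1 (1 / 2) L⁻¹ * H, G * stdMat 1 b' s' L⁻¹ (-1) 2 L * H,
      conj_mul_conj hGH hHG (stdMat_mul_inv L hL),
      conj_mul_conj hGH hHG (mul_eq_one_comm.1 (stdMat_mul_inv L hL))⟩
    (SignedPerm.blockMat ℝ (RotIdx b s)).toHomUnits fun f => by
      rw [Commute, SemiconjBy]
      ext1
      simp [stdMat, blockMat, SignedPerm.blockMat, Matrix.fromBlocks_multiply]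

section

variable {d b s b' s' : ℕ} {lam L : ℝ} (hlam : lam ≠ 0) (hL : L ≠ 0)
  {G : Matrix (BlockIdx d (RotIdx b s)) (BlockIdx 1 (RotIdx b' s')) ℝ}
  {H : Matrix (BlockIdx 1 (RotIdx b' s')) (BlockIdx d (RotIdx b s)) ℝ}
  (hGH : G * H = 1) (hHG : H * G = 1)

lemma modelRep_inF (f : SignedPerm d) :
    (modelRep hlam hL hGH hHG (inF f)).val = f.blockMat ℝ (RotIdx b s) := by
  rw [modelRep, liftHom_inF, MonoidHom.coe_toHomUnits]

lemma modelRep_genT :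
    (modelRep hlam hL hGH hHG (genT (SignedPerm d))).val = stdMat d b s lam 1 (1 / 2) lam⁻¹ := by
  rw [modelRep, liftHom_genT]

lemma modelRep_genT_inv : (modelRep hlam hL hGH hHG (genT (SignedPerm d))⁻¹).val =
    stdMat d b s lam⁻¹ (-1) 2 lam := by
  rw [modelRep, map_inv, liftHom_genT, Units.inv_mk]

lemma modelRep_genA : (modelRep hlam hL hGH hHG (genA (SignedPerm d))).val =
    G * stdMat 1 b' s' L 1 (1 / 2) L⁻¹ * H := by
  rw [modelRep, liftHom_genA]

lemma modelRep_genA_inv : (modelRep hlam hL hGH hHG (genA (SignedPerm d))⁻¹).val =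
    G * stdMat 1 b' s' L⁻¹ (-1) 2 L * H := by
  rw [modelRep, map_inv, liftHom_genA, Units.inv_mk]

end

/-- First `d ≤ r ≤ n - d`. For even `n`, the free generator excludes even `r` and the central one
odd `r`. For odd `n`, one of `r` and `n - r` is odd, and the central generator excludes it. -/
lemma parity_contradiction {d b s b' s' n r : ℕ} (hd : 2 ≤ d) (hd2 : Even d)
    (hs : s = (n - 1) % 2) (hs' : s' = n % 2) (hn : n = d + 2 * b + s + 1)
    (hn' : n = 2 * b' + s' + 2) (hr : 1 ≤ r) (hrn : r ≤ n - 1) (h1 : r = 0 ∨ d ≤ r)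
    (h2 : n - r = 0 ∨ d ≤ n - r) (h3 : d < r → r < d + 2 * b → Even (r - d))
    (h4 : d < n - r → n - r < d + 2 * b → Even (n - r - d))
    (h5 : 1 < r → r < 1 + 2 * b' → Even (r - 1)) : False := by
  rw [Nat.even_iff] at h3 h4 h5 hd2
  have h6 : d ≤ r := by omega
  have h7 : d ≤ n - r := by omega
  clear h1 h2
  rcases Nat.mod_two_eq_zero_or_one n with hn2 | hn2
  · have hs1 : s = 1 := by omega
    have hs0 : s' = 0 := by omega
    subst hs1 hs0
    rcases Nat.mod_two_eq_zero_or_one r with hr2 | hr2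
    · have := h5 (by omega) (by omega)
      omega
    · have := h3 (by omega) (by omega)
      omega
  · have hs1 : s = 0 := by omega
    subst hs1
    rcases Nat.mod_two_eq_zero_or_one r with hr2 | hr2
    · have := h4 (by omega) (by omega)
      omega
    · have := h3 (by omega) (by omega)
      omega

lemma not_isAnosov_of_parity {F : Type} [Group F] {d b s b' s' n : ℕ} (hd : 2 ≤ d)
    (hd2 : Even d) (hs : s = (n - 1) % 2) (hs' : s' = n % 2) (hn : n = d + 2 * b + s + 1)
    (hn' : n = 2 * b' + s' + 2)
    {r : ℕ} {ρ : FreeProdGroup F 1 →* Matrix.GeneralLinearGroup (Fin n) ℂ}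
    (hT : ∀ (y : ℝ) (j : ℕ), countGe (ρ (genT F) : Matrix (Fin n) (Fin n) ℂ).charpoly.roots y = j →
      j = 0 ∨ d ≤ j)
    (hT' : ∀ (y : ℝ) (j : ℕ), countGe (ρ (genT F) : Matrix (Fin n) (Fin n) ℂ).charpoly.roots y = j →
      d < j → j < d + 2 * b → Even (j - d))
    (hA : ∀ (y : ℝ) (j : ℕ), countGe (ρ (genA F) : Matrix (Fin n) (Fin n) ℂ).charpoly.roots y = j →
      1 < j → j < 1 + 2 * b' → Even (j - 1))
    (hr : 1 ≤ r) (hrn : r ≤ n - 1) : ¬ IsAnosov r ρ := by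
  intro h
  obtain ⟨⟨y₁, h₁⟩, y₂, h₂⟩ := h.exists_countGe hr hrn (expT _) (genT F) (expT_genT F)
  obtain ⟨⟨y₃, h₃⟩, -⟩ := h.exists_countGe hr hrn (expA _) (genA F) (expA_genA F)
  exact parity_contradiction hd hd2 hs hs' hn hn' hr hrn (hT y₁ r h₁) (hT y₂ (n - r) h₂)
    (hT' y₁ r h₁) (hT' y₂ (n - r) h₂) (hA y₃ r h₃)

theorem exists_representation {d : ℕ} (hd : 2 ≤ d) (hd2 : Even d) {n : ℕ} (hn : d + 1 ≤ n) :
    ∃ (ψ : FreeProdGroup (SignedPerm d) 1 →* Matrix.GeneralLinearGroup (Fin n) ℝ)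
      (O : Set (FreeProdGroup (SignedPerm d) 1 →* Matrix.GeneralLinearGroup (Fin n) ℂ)),
      IsOpen O ∧ complexify ψ ∈ O ∧
      (∀ ρ ∈ O, IsQIEmbedding ρ ∧ ¬ IsLocallyRigid ρ) ∧
      (∀ j : ℕ, 1 ≤ j → j ≤ d - 1 → ∀ ρ ∈ O, ¬ IsAnosov j ρ) ∧
      (∀ r : ℕ, 1 ≤ r → r ≤ n - 1 →
        ∀ ρ : FreeProdGroup (SignedPerm d) 1 →* Matrix.GeneralLinearGroup (Fin n) ℝ,
          complexify ρ ∈ O → ¬ IsAnosov r ρ) := by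
  have : NeZero d := ⟨by omega⟩
  have hn0 : n ≠ 0 := by omega
  -- As `d` is even, one scalar line is left over beside the planes of `t` exactly when `n` is even,
  -- and beside those of `a` exactly when `n` is odd.
  obtain ⟨s, hs⟩ : ∃ s, s = (n - 1) % 2 := ⟨_, rfl⟩
  obtain ⟨b, hb⟩ : ∃ b, b = (n - 1 - d) / 2 := ⟨_, rfl⟩
  obtain ⟨s', hs'⟩ : ∃ s', s' = n % 2 := ⟨_, rfl⟩
  obtain ⟨b', hb'⟩ : ∃ b', b' = (n - 2) / 2 := ⟨_, rfl⟩
  have hn1 : n = d + 2 * b + s + 1 := by have := Nat.even_iff.1 hd2; omega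
  have hn2 : n = 2 * b' + s' + 2 := by omega
  obtain ⟨lam, L, G, H, hlam, hL, hGH, hHG, hmodel⟩ := exists_model d b s b' s' (by omega)
  let J := BlockIdx d (RotIdx b s)
  have hcard : Fintype.card J = n := by rw [card_blockIdx_rotIdx, hn1]
  let e : J ≃ Fin n := Fintype.equivFinOfCardEq hcard
  let ψJ := modelRep (by positivity : lam ≠ 0) (by positivity : L ≠ 0) hGH hHG
  let ψ := toFinRep e ψJ
  have hlim : ∀ γ, Tendsto (fun ρ => reindexRep e ρ γ) (𝓝 (complexify ψ))
      (𝓝 ((ψJ γ : Matrix J J ℝ).map Complex.ofReal)) := by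
    intro γ
    have := (continuous_reindexRep e γ).tendsto (complexify ψ)
    rwa [reindexRep_complexify, reindexRep_toFinRep] at this
  have hlimF : ∀ f : SignedPerm d, Tendsto (fun ρ => reindexRep e ρ (inF f)) (𝓝 (complexify ψ))
      (𝓝 (f.blockMat ℂ (RotIdx b s))) := by
    intro f
    have := hlim (inF f)
    rwa [modelRep_inF, f.blockMat_complex] at this
  have hlimT : Tendsto (fun ρ => reindexRep e ρ (genT (SignedPerm d))) (𝓝 (complexify ψ))
      (𝓝 ((stdMat d b s lam 1 (1 / 2) lam⁻¹).map Complex.ofReal)) := by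
    have := hlim (genT (SignedPerm d))
    rwa [modelRep_genT] at this
  have hlimT' : Tendsto (fun ρ => reindexRep e ρ (genT (SignedPerm d))⁻¹) (𝓝 (complexify ψ))
      (𝓝 ((stdMat d b s lam⁻¹ (-1) 2 lam).map Complex.ofReal)) := by
    have := hlim (genT (SignedPerm d))⁻¹
    rwa [modelRep_genT_inv] at this
  have hlimA : Tendsto (fun ρ => reindexRep e ρ (genA (SignedPerm d))) (𝓝 (complexify ψ))
      (𝓝 ((G * stdMat 1 b' s' L 1 (1 / 2) L⁻¹ * H).map Complex.ofReal)) := by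
    have := hlim (genA (SignedPerm d))
    rwa [modelRep_genA] at this
  have hlimA' : Tendsto (fun ρ => reindexRep e ρ (genA (SignedPerm d))⁻¹) (𝓝 (complexify ψ))
      (𝓝 ((G * stdMat 1 b' s' L⁻¹ (-1) 2 L * H).map Complex.ofReal)) := by
    have := hlim (genA (SignedPerm d))⁻¹
    rwa [modelRep_genA_inv] at this
  have hconj : ∀ {γ : FreeProdGroup (SignedPerm d) 1}
      {N : Matrix (BlockIdx 1 (RotIdx b' s')) (BlockIdx 1 (RotIdx b' s')) ℝ},
      Tendsto (fun ρ => reindexRep e ρ γ) (𝓝 (complexify ψ))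
        (𝓝 ((G * N * H).map Complex.ofReal)) →
      Tendsto (fun ρ => H.map Complex.ofReal * reindexRep e ρ γ * G.map Complex.ofReal)
        (𝓝 (complexify ψ)) (𝓝 (N.map Complex.ofReal)) := by
    intro γ N h
    have hc : Continuous fun A : Matrix J J ℂ =>
        H.map Complex.ofReal * A * G.map Complex.ofReal :=
      (continuous_const.matrix_mul continuous_id).matrix_mul continuous_const
    have h1 := (hc.tendsto _).comp h
    have h2 : H.map Complex.ofReal * (G * N * H).map Complex.ofReal * G.map Complex.ofReal =
        N.map Complex.ofReal := by
      rw [← map_ofReal_mul, ← map_ofReal_mul]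
      congr 1
      calc H * (G * N * H) * G = H * G * N * (H * G) := by simp only [Matrix.mul_assoc]
        _ = N := by rw [hHG, Matrix.one_mul, Matrix.mul_one]
    rwa [h2] at h1
  have hδ : (0 : ℝ) < 1 / 100 := by norm_num
  -- The neighbourhood imposes growth, the block form of `ℤ × F`, and closeness to the standard
  -- matrices of both generators and their inverses. The free generator is compared in the
  -- coordinates of its frame.
  obtain ⟨O, hO, hOo, hψO⟩ := eventually_nhds_iff.1
    ((hmodel _ (fun ρ => reindexRep e ρ) hlimF hlimT hlimT' hlimA hlimA').and
    ((eventually_nearTorus hlam one_pos hlimF hlimT hlimT').and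
    (((eventually_norm_mulVec_sub_le hlimT hδ).and (eventually_norm_mulVec_sub_le hlimT' hδ)).and
    ((eventually_norm_mulVec_sub_le (hconj hlimA) hδ).and
      (eventually_norm_mulVec_sub_le (hconj hlimA') hδ)))))
  have hcount : ∀ ρ ∈ O, ∀ (y : ℝ) (j : ℕ),
      countGe (ρ (genT (SignedPerm d)) : Matrix (Fin n) (Fin n) ℂ).charpoly.roots y = j →
      j = 0 ∨ d ≤ j := by
    rintro ρ hρ y j rfl
    obtain ⟨-, ⟨Q, Q', μ, D, D', hN, hQ, hQ', -, hRT, -⟩, -⟩ := hO ρ hρ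
    rw [← charpoly_reindexRep e, hRT, charpoly_conj_eq rfl hQ']
    exact countGe_fromBlocks_scalar hN.norm_le (by linarith [hN.le_norm]) y
  refine ⟨ψ, O, hOo, hψO, fun ρ hρ => ⟨?_, ?_⟩, fun j hj hjd ρ hρ h => ?_,
    fun r hr hrn ρ hρ h => ?_⟩
  · obtain ⟨⟨c, hc, h⟩, -⟩ := hO ρ hρ
    exact isQIEmbedding_of_expanding hn0 ρ _ closure_stdGens hc fun γ =>
      exists_norm_mulVec_ge_of_reindexRep e ρ γ (h γ)
  · exact not_isLocallyRigid_of_hom hn0 (expT _) (genT (SignedPerm d)) (expT_genT _) ρ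
  · obtain ⟨⟨y, hy⟩, -⟩ :=
      h.exists_countGe hj (by omega) (expT _) (genT (SignedPerm d)) (expT_genT _)
    have := hcount ρ hρ y j hy
    omega
  · obtain ⟨-, -, ⟨h1, h2⟩, h3, h4⟩ := hO _ hρ
    simp only [reindexRep_complexify] at h1 h2 h3 h4
    simp only [← map_ofReal_mul] at h3 h4
    have hinv : ∀ γ, reindexRep e ρ γ * reindexRep e ρ γ⁻¹ = 1 := by
      intro γ; rw [← map_mul, mul_inv_cancel, map_one]
    refine not_isAnosov_of_parity hd hd2 hs hs' hn1 hn2 (hcount _ hρ) ?_ ?_ hr hrn h.complexify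
    · intro y j hy hj1 hj2
      refine even_countGe_sub_of_near (hinv (genT (SignedPerm d))) hlam h1 h2 (y := y) ?_ hj1 hj2
      rw [← hy, ← charpoly_reindexRep e, reindexRep_complexify]
    · intro y j hy hj1 hj2
      refine even_countGe_sub_of_near (conj_mul_conj hHG hGH (hinv (genA (SignedPerm d)))) hL h3 h4
        (y := y) ?_ hj1 hj2
      rw [map_ofReal_mul, map_ofReal_mul, charpoly_conj_eq (by simp; omega), ← hy,
        ← charpoly_reindexRep e, reindexRep_complexify]
      rw [← map_ofReal_mul, hGH, map_ofReal_one]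

end Main

theorem theorem1p2 (d : ℕ) (hd : 2 ≤ d) (hd_even : Even d) :
    ∃ (F : Type) (_ : Group F) (_ : Finite F) (m : ℕ), 1 ≤ m ∧
      IsVirtuallyFree (FreeProdGroup F m) ∧
      ∀ n : ℕ, d + 1 ≤ n →
        ∃ (ψ : FreeProdGroup F m →* Matrix.GeneralLinearGroup (Fin n) ℝ)
          (O : Set (FreeProdGroup F m →* Matrix.GeneralLinearGroup (Fin n) ℂ)),
          IsOpen O ∧ complexify ψ ∈ O ∧
          (∀ ρ ∈ O, IsQIEmbedding ρ ∧ ¬ IsLocallyRigid ρ) ∧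
          (∀ j : ℕ, 1 ≤ j → j ≤ d - 1 → ∀ ρ ∈ O, ¬ IsAnosov j ρ) ∧
          (∀ r : ℕ, 1 ≤ r → r ≤ n - 1 →
            ∀ ρ : FreeProdGroup F m →* Matrix.GeneralLinearGroup (Fin n) ℝ,
              complexify ρ ∈ O → ¬ IsAnosov r ρ) := by
  refine ⟨SignedPerm d, inferInstance, inferInstance, 1, le_rfl, isVirtuallyFree_freeProdGroup _,
    fun n hn => exists_representation hd hd_even hn⟩
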